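/- Call $R$ admissible if $R\in L^1(\mathbb{R})$ and its Fourier transform $\widehat R(t)=\int_{-\infty}^{\infty}e^{-2\pi i x t}R(x)\,dx$ is supported in $[-1,1]$; such an $R$ is identified with the entire function whose restriction to $\mathbb{R}$ agrees with it almost everywhere. Put $$M(R)=\int_{-\infty}^{\infty}R(x)\Big\{1-\Big(\frac{\sin\pi x}{\pi x}\Big)^2\Big\}\,dx .$$ Let $\mathcal H$ be the space of entire functions $f$ of exponential type at most $\pi$ with $\int_{-\infty}^{\infty}|f(x)|^2\{1-(\frac{\sin\pi x}{\pi x})^2\}\,dx<\infty$, with inner product $\langle f,g\rangle=\int_{-\infty}^{\infty}f(x)\overline{g(x)}\{1-(\frac{\sin\pi x}{\pi x})^2\}\,dx$. There is exactly one $K(0,\cdot)\in\mathcal H$ with $f(0)=\langle f,K(0,\cdot)\rangle$ for all $f\in\mathcal H$. If $R$ is admissible, nonnegative on $\mathbb{R}$, and $R(0)\ge 1$, then $$M(R)\ \ge\ \frac1{K(0,0)}=2^{-1/2}\cot\big(2^{-1/2}\big)-\frac12=0.3274992\ldots$$ Equality is attained in this class of functions, and a function $R$ in the class attains it if and only if $$R(z)=\frac{1}{(1-2\pi^2z^2)^2}\Big(\cos(\pi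 z)-2^{1/2}\pi z\cot\big(2^{-1/2}\big)\sin(\pi z)\Big)^2$$ (with the removable singularities at $z=\pm 1/(\pi\sqrt2)$ filled in). -/

import Mathlib

open scoped FourierTransform ComplexOrder ComplexConjugate

noncomputable section

namespace PairCorrelation

/-- The density `1 - (sin πx / πx)²` of the pair correlation measure `μ` (with value `0` at `x = 0`,
as `Real.sinc 0 = 1`). -/
def weight (x : ℝ) : ℝ := 1 - Real.sinc (Real.pi * x) ^ 2

/-- Admissible functions: `R ∈ L¹(ℝ)` whose Fourier transform `R̂(t) = ∫ e^{-2πixt} R(x) dx` is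
supported in `[-1,1]`. Such an `R` agrees almost everywhere with the restriction to `ℝ` of exactly
one entire function, which is the representative used here, so that `R(0)` and `R(z)` have
a meaning. -/
structure Admissible (R : ℂ → ℂ) : Prop where
  entire : Differentiable ℂ R
  integrable : MeasureTheory.Integrable (fun x : ℝ => R x)
  support_fourier : Function.support (𝓕 (fun x : ℝ => R x)) ⊆ Set.Icc (-1) 1

/-- `M(R) = ∫ R(x) {1 - (sin πx / πx)²} dx`. -/
def M (R : ℂ → ℂ) : ℂ := ∫ x : ℝ, R x * (weight x : ℂ)

/-- `f` has exponential type at most `τ`. -/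
def HasExpTypeAtMost (f : ℂ → ℂ) (τ : ℝ) : Prop :=
  ∀ ε : ℝ, 0 < ε → ∃ C : ℝ, 0 < C ∧ ∀ z : ℂ, ‖f z‖ ≤ C * Real.exp ((τ + ε) * ‖z‖)

/-- Membership in `𝓗 = 𝓑₂(π, μ)`: entire functions of exponential type at most `π` with
`∫ |f(x)|² dμ(x) < ∞`. -/
structure MemH (f : ℂ → ℂ) : Prop where
  entire : Differentiable ℂ f
  expType : HasExpTypeAtMost f Real.pi
  sqIntegrable : MeasureTheory.Integrable (fun x : ℝ => ‖f x‖ ^ 2 * weight x)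

/-- The inner product `⟨f, g⟩ = ∫ f(x) conj(g(x)) dμ(x)` of `𝓗`. -/
def innerH (f g : ℂ → ℂ) : ℂ := ∫ x : ℝ, f x * conj (g x) * (weight x : ℂ)

/-- `k ∈ 𝓗` represents evaluation at `w`: `f(w) = ⟨f, k⟩` for all `f ∈ 𝓗`. -/
def IsReproducingAt (w : ℂ) (k : ℂ → ℂ) : Prop :=
  MemH k ∧ ∀ f : ℂ → ℂ, MemH f → f w = innerH f k

open Classical in
/-- The reproducing kernel `K(w, ·)` of `𝓗`, i.e. the element of `𝓗` that represents evaluation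
at `w` (the value `0` is a default that is not used when such an element exists). -/
def K (w : ℂ) : ℂ → ℂ :=
  if h : ∃ k : ℂ → ℂ, IsReproducingAt w k then h.choose else 0

end PairCorrelation

end

/-! Write k for `extremal`, C for `robinCos` and γ for `gapConst`, so that k(z)(1 - 2π²z²) = C(z)
and k(0) = 1. The basic mechanism is the identity x²·weight(x) = x² - (1 - cos 2πx)/(2π²)
(`mul_weight`). If z²g(z) is integrable on ℝ and of type 2π, then g has type 2π as well, so its
integral against cos 2πx vanishes, and ∫ x²g·weight = ∫ (x² - 1/(2π²)) g (`integral_sq_mul_weight`).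

The kernel. For z²g in 𝓗, the mechanism applied to z²g·k turns the pairing with k into a multiple of
∫ g·C. This is zero, because g and zg have type π while C is built from cos πx and x sin πx.
Symmetrizing f and subtracting a multiple of `fejer` reduces every f to this case, so ∫ f·k·weight
is a multiple of f(0). The multiple is found with f = `fejer`: up to a factor, k is the Fourier
transform of cos(√2 s) cut off to [-1/2, 1/2], and subtracting from that function its convolution
with the triangle leaves a constant inside the interval. Hence K(0,·) = k/γ.

The lower bound. Instead of factoring R = |F|² and applying Cauchy–Schwarz, the proof uses a
positive quadrature whose nodes are the zeros of C. The function S = R(z) + R(-z) - 2R(0)k² is even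
and vanishes at 0, so S = z²S₂ and 2M(R) - 2γR(0) = ∫ P with P = (x² - 1/(2π²))S₂. At a node in
[-1/2, 1/2] the first factor of P vanishes, since k > 0 there. At any other node ξ one has k(ξ) = 0,
so P(ξ) is a positive multiple of R(ξ) + R(-ξ). Thus P ≥ 0 at all nodes, and ∫ P ≥ 0. The quadrature
is not written as a sum. With B = U/V the inner function for which U + V = 2C, the positive kernel
Re (1-B)/(1+B) on the line Im z = y integrates like 1 against integrable functions of type 2π
(`integral_mul_nodeKernel`), because all powers of B carry frequencies ≥ 2π. As y → 0 the kernel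
concentrates at the zeros of C. Its quantitative form is `exists_integral_ge`.

Equality. If ∫ P = 0, then R vanishes at every zero of k, and doubly since R ≥ 0. So R = k²h with h
entire. Bounds for R and k on large squares make h a quadratic polynomial; R → 0 on ℝ removes the
square term, R ≥ 0 removes the linear term, and R(0) = 1 gives h = 1. -/

noncomputable section

namespace PairCorrelation

open MeasureTheory Filter Topology Set

/-! ### Vanishing of Fourier integrals beyond the exponential type. -/

/-- A function holomorphic on the closed upper half-plane that decays quadratically there
integrates to zero over the real line. -/
theorem integral_eq_zero_of_upper_decay {H : ℂ → ℂ} {A : ℝ}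
    (hd : DifferentiableOn ℂ H {z | 0 ≤ z.im})
    (hb : ∀ z : ℂ, 0 ≤ z.im → ‖H z‖ ≤ A / (1 + ‖z‖ ^ 2)) :
    ∫ x : ℝ, H x = 0 := by
  have hA : 0 ≤ A := by
    have := (norm_nonneg _).trans (hb 0 (by simp))
    simpa using this
  have hcont : Continuous fun x : ℝ => H x := by
    rw [← continuousOn_univ]
    exact hd.continuousOn.comp Complex.continuous_ofReal.continuousOn (fun x _ => by simp)
  have hint : Integrable fun x : ℝ => H x := by
    refine (integrable_inv_one_add_sq.const_mul A).mono' hcont.aestronglyMeasurable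
      (Eventually.of_forall fun x => ?_)
    have := hb x (by simp)
    rwa [Complex.norm_real, Real.norm_eq_abs, sq_abs, div_eq_mul_inv] at this
  have h1 : Tendsto (fun N : ℝ => ∫ x in (-N)..N, H x) atTop (𝓝 (∫ x : ℝ, H x)) :=
    intervalIntegral_tendsto_integral hint tendsto_neg_atTop_atBot tendsto_id
  refine tendsto_nhds_unique h1 ?_
  -- The three other sides of the rectangle with base [-N, N] and height N have total length 4N, and
  -- on them the function is at most A/(1 + N²).
  have hlim : Tendsto (fun N : ℝ => 4 * A * N⁻¹) atTop (𝓝 0) := by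
    simpa using tendsto_inv_atTop_zero.const_mul (4 * A)
  refine squeeze_zero_norm' ?_ hlim
  filter_upwards [eventually_gt_atTop 0] with N hN
  have hrect := Complex.integral_boundary_rect_eq_zero_of_differentiableOn H
    ((-N : ℝ) : ℂ) ((N : ℂ) + (N : ℂ) * Complex.I) (hd.mono (by
      intro z hz
      have := hz.2
      simp only [Complex.ofReal_im, Complex.add_im, Complex.mul_im, Complex.ofReal_re,
        Complex.I_im, Complex.I_re, mem_preimage] at this
      rw [uIcc_of_le (by linarith)] at this
      exact this.1))
  simp only [Complex.ofReal_im, Complex.add_im, Complex.mul_im, Complex.ofReal_re, Complex.add_re,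
    Complex.mul_re, Complex.I_im, Complex.I_re, mul_zero, mul_one, add_zero, zero_add, sub_zero,
    Complex.ofReal_zero, zero_mul, smul_eq_mul] at hrect
  have hNb : A / (1 + N ^ 2) * N ≤ A * N⁻¹ := by
    rw [← div_eq_mul_inv, div_mul_eq_mul_div, div_le_div_iff₀ (by positivity) hN]
    nlinarith
  have key : ∀ z : ℂ, 0 ≤ z.im → N ≤ ‖z‖ → ‖H z‖ ≤ A / (1 + N ^ 2) := by
    intro z hz hzN
    refine (hb z hz).trans ?_
    gcongr
  have hT : ‖∫ x : ℝ in (-N)..N, H (x + N * Complex.I)‖ ≤ A / (1 + N ^ 2) * |N - (-N)| := by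
    refine intervalIntegral.norm_integral_le_of_norm_le_const fun x _ => key _ ?_ ?_
    · simp [hN.le]
    · have := Complex.abs_im_le_norm ((x : ℂ) + N * Complex.I)
      simpa [abs_of_pos hN] using this
  have hR : ‖∫ y : ℝ in (0 : ℝ)..N, H (N + y * Complex.I)‖ ≤ A / (1 + N ^ 2) * |N - 0| := by
    refine intervalIntegral.norm_integral_le_of_norm_le_const fun y hy => key _ ?_ ?_
    · rw [uIoc_of_le hN.le] at hy
      simp [hy.1.le]
    · have := Complex.abs_re_le_norm ((N : ℂ) + y * Complex.I)
      simpa [abs_of_pos hN] using this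
  have hL : ‖∫ y : ℝ in (0 : ℝ)..N, H (-N + y * Complex.I)‖ ≤ A / (1 + N ^ 2) * |N - 0| := by
    refine intervalIntegral.norm_integral_le_of_norm_le_const fun y hy => key _ ?_ ?_
    · rw [uIoc_of_le hN.le] at hy
      simp [hy.1.le]
    · have := Complex.abs_re_le_norm (-(N : ℂ) + y * Complex.I)
      simpa [abs_of_pos hN] using this
  have e : ∫ x : ℝ in (-N)..N, H x = (∫ x : ℝ in (-N)..N, H (x + N * Complex.I))
      - Complex.I * (∫ y : ℝ in (0 : ℝ)..N, H (N + y * Complex.I))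
      + Complex.I * (∫ y : ℝ in (0 : ℝ)..N, H (-N + y * Complex.I)) := by
    push_cast at hrect
    linear_combination hrect
  rw [e]
  rw [show N - (-N) = 2 * N by ring, abs_of_pos (by linarith : 0 < 2 * N)] at hT
  rw [sub_zero, abs_of_pos hN] at hR hL
  refine (norm_add_le _ _).trans ?_
  refine (add_le_add_left (norm_sub_le _ _) _).trans ?_
  rw [norm_mul, norm_mul, Complex.norm_I]
  linarith

/-- Phragmén–Lindelöf for functions of exponential type bounded on the real line. -/
theorem norm_le_exp_of_bounded_real {F : ℂ → ℂ} {σ A : ℝ} (hd : Differentiable ℂ F)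
    (ht : ∃ C : ℝ, 0 < C ∧ ∀ z : ℂ, ‖F z‖ ≤ C * Real.exp (σ * ‖z‖))
    (hA : ∀ x : ℝ, ‖F x‖ ≤ A) {z : ℂ} (hz : 0 ≤ z.im) :
    ‖F z‖ ≤ A * Real.exp (σ * z.im) := by
  obtain ⟨C, hC, hF⟩ := ht
  -- The rotation ζ ↦ iζ carries the right half-plane to the upper one, and the exponential cancels
  -- the growth along the positive axis, so that Phragmén–Lindelöf applies.
  set G : ℂ → ℂ := fun ζ => F (Complex.I * ζ) * Complex.exp (-(σ : ℂ) * ζ) with hG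
  have hGd : Differentiable ℂ G := by
    have : Differentiable ℂ fun ζ => F (Complex.I * ζ) := hd.comp (by fun_prop)
    exact this.mul (by fun_prop)
  have hnorm : ∀ ζ, ‖G ζ‖ = ‖F (Complex.I * ζ)‖ * Real.exp (-σ * ζ.re) := by
    intro ζ
    simp [hG, Complex.norm_exp]
  have hPL : ∀ ζ : ℂ, 0 ≤ ζ.re → ‖G ζ‖ ≤ A := by
    intro ζ hζ
    refine PhragmenLindelof.right_half_plane_of_bounded_on_real hGd.diffContOnCl
      ⟨1, by norm_num, 2 * |σ|, ?_⟩ ?_ ?_ hζ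
    · refine Asymptotics.IsBigO.of_bound C (Eventually.of_forall fun ζ => ?_)
      rw [hnorm, Real.rpow_one, Real.norm_of_nonneg (Real.exp_pos _).le]
      calc ‖F (Complex.I * ζ)‖ * Real.exp (-σ * ζ.re)
          ≤ (C * Real.exp (|σ| * ‖ζ‖)) * Real.exp (|σ| * ‖ζ‖) := by
            have h1 := hF (Complex.I * ζ)
            rw [norm_mul, Complex.norm_I, one_mul] at h1
            have h2 : σ * ‖ζ‖ ≤ |σ| * ‖ζ‖ := by gcongr; exact le_abs_self σ
            have h3 : -σ * ζ.re ≤ |σ| * ‖ζ‖ := by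
              calc -σ * ζ.re ≤ |-σ * ζ.re| := le_abs_self _
                _ = |σ| * |ζ.re| := by rw [abs_mul, abs_neg]
                _ ≤ _ := by gcongr; exact Complex.abs_re_le_norm ζ
            gcongr
            exact h1.trans (by gcongr)
        _ = C * Real.exp (2 * |σ| * ‖ζ‖) := by
            rw [mul_assoc, ← Real.exp_add]; ring_nf
    · refine isBoundedUnder_of_eventually_le (a := C) ?_
      filter_upwards [eventually_ge_atTop 0] with x hx
      rw [hnorm]
      have h1 := hF (Complex.I * x)
      rw [norm_mul, Complex.norm_I, one_mul, Complex.norm_real, Real.norm_of_nonneg hx] at h1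
      calc _ ≤ C * Real.exp (σ * x) * Real.exp (-σ * x) := by
            rw [Complex.ofReal_re]; gcongr
        _ = C := by rw [mul_assoc, ← Real.exp_add]; simp
    · intro x
      rw [hnorm]
      have : Complex.I * ((x : ℂ) * Complex.I) = ((-x : ℝ) : ℂ) := by
        push_cast; linear_combination (x : ℂ) * Complex.I_mul_I
      rw [this]
      simpa using hA (-x)
  have h := hPL (-Complex.I * z) (by simpa using hz)
  rw [hnorm] at h
  have e1 : Complex.I * (-Complex.I * z) = z := by
    linear_combination (-z) * Complex.I_mul_I
  rw [e1] at h
  have e2 : (-Complex.I * z).re = z.im := by simp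
  rw [e2] at h
  calc ‖F z‖ = ‖F z‖ * Real.exp (-σ * z.im) * Real.exp (σ * z.im) := by
        rw [mul_assoc, ← Real.exp_add]; simp
    _ ≤ _ := by gcongr

/-- An entire function with exponential growth that is integrable on the real line has an entire
primitive, bounded on the real line, of the same type. -/
theorem exists_primitive_bounded {f : ℂ → ℂ} {τ : ℝ} (hτ : 0 ≤ τ) (hd : Differentiable ℂ f)
    (ht : HasExpTypeAtMost f τ) (hint : Integrable fun x : ℝ => f x) :
    ∃ F : ℂ → ℂ, (∀ z, HasDerivAt F (f z) z) ∧ HasExpTypeAtMost F τ ∧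
      ∃ A, ∀ x : ℝ, ‖F x‖ ≤ A := by
  obtain ⟨F, hF0, hF⟩ := hd.isExactOn_univ.with_val_at 0 0
  have hF' : ∀ z, HasDerivAt F (f z) z := fun z => hF z (mem_univ z)
  refine ⟨F, hF', ?_, ∫ x : ℝ, ‖f x‖, ?_⟩
  · intro ε hε
    -- Integrating along a segment costs a factor |z|, which the other half of ε absorbs.
    obtain ⟨C, hC, hfC⟩ := ht (ε / 2) (by positivity)
    refine ⟨C * (2 / ε), by positivity, fun z => ?_⟩
    have h1 : ‖F z - F 0‖ ≤ C * Real.exp ((τ + ε / 2) * ‖z‖) * ‖z - 0‖ := by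
      refine (convex_closedBall (0 : ℂ) ‖z‖).norm_image_sub_le_of_norm_hasDerivWithin_le
        (fun x _ => (hF' x).hasDerivWithinAt) (fun x hx => ?_) (by simp) (by simp)
      refine (hfC x).trans ?_
      have : ‖x‖ ≤ ‖z‖ := by simpa using hx
      gcongr
    rw [hF0, sub_zero, sub_zero] at h1
    have h2 : ‖z‖ ≤ 2 / ε * Real.exp (ε / 2 * ‖z‖) := by
      have := Real.add_one_le_exp (ε / 2 * ‖z‖)
      rw [div_mul_eq_mul_div, le_div_iff₀ hε]
      nlinarith
    calc ‖F z‖ ≤ C * Real.exp ((τ + ε / 2) * ‖z‖) * ‖z‖ := h1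
      _ ≤ C * Real.exp ((τ + ε / 2) * ‖z‖) * (2 / ε * Real.exp (ε / 2 * ‖z‖)) := by gcongr
      _ = C * (2 / ε) * (Real.exp ((τ + ε / 2) * ‖z‖) * Real.exp (ε / 2 * ‖z‖)) := by ring
      _ = _ := by rw [← Real.exp_add]; ring_nf
  · intro x
    have h1 : ∫ t in (0 : ℝ)..x, f t = F x - F 0 := by
      have := intervalIntegral.integral_eq_sub_of_hasDerivAt (a := (0 : ℝ)) (b := x)
        (f := fun t : ℝ => F t) (f' := fun t : ℝ => f t)
        (fun t _ => (hF' t).comp_ofReal) (hint.intervalIntegrable)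
      simpa using this
    rw [hF0, sub_zero] at h1
    rw [← h1]
    refine (intervalIntegral.norm_integral_le_integral_norm_uIoc).trans ?_
    exact setIntegral_le_integral hint.norm (Eventually.of_forall fun t => norm_nonneg _)

theorem one_sub_I_mul_ne_zero {ε : ℝ} (hε : 0 ≤ ε) {z : ℂ} (hz : 0 ≤ z.im) :
    1 - Complex.I * ε * z ≠ 0 := by
  intro h
  have := congrArg Complex.re h
  simp at this
  nlinarith [mul_nonneg hε hz]

/-- The factor (1 - iεz)⁻² has its pole at -i/ε in the lower half-plane. On the closed upper
half-plane it decays quadratically, as contour shifting needs, and it is at most 1 uniformly in ε,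
as dominated convergence needs. -/
theorem norm_one_sub_I_mul_sq_ge {ε : ℝ} (hε : 0 ≤ ε) (hε1 : ε ≤ 1) {z : ℂ} (hz : 0 ≤ z.im) :
    ε ^ 2 * (1 + ‖z‖ ^ 2) ≤ ‖1 - Complex.I * ε * z‖ ^ 2 ∧ 1 ≤ ‖1 - Complex.I * ε * z‖ := by
  have e : ‖1 - Complex.I * ε * z‖ ^ 2 = (1 + ε * z.im) ^ 2 + (ε * z.re) ^ 2 := by
    rw [Complex.sq_norm, Complex.normSq_apply]; simp; ring
  have h2 : ‖z‖ ^ 2 = z.re ^ 2 + z.im ^ 2 := by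
    rw [Complex.sq_norm, Complex.normSq_apply]; ring
  have h3 := mul_nonneg hε hz
  constructor
  · rw [e, h2]; nlinarith
  · have : 1 ≤ ‖1 - Complex.I * ε * z‖ ^ 2 := by rw [e]; nlinarith [sq_nonneg (ε * z.re)]
    nlinarith [norm_nonneg (1 - Complex.I * ε * z)]

/-- Damped form of the vanishing of the Fourier transform beyond the exponential type. -/
theorem integral_mul_damped_exp_eq_zero {f : ℂ → ℂ} {τ μ ε : ℝ} (hτ : 0 ≤ τ) (hμ : τ < μ)
    (hε : 0 < ε) (hε1 : ε ≤ 1) (hd : Differentiable ℂ f)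
    (ht : HasExpTypeAtMost f τ) (hint : Integrable fun x : ℝ => f x) :
    ∫ x : ℝ, f x * (Complex.exp (Complex.I * μ * x) / (1 - Complex.I * ε * x) ^ 2) = 0 := by
  obtain ⟨F, hF, hFt, A, hA⟩ := exists_primitive_bounded hτ hd ht hint
  have hFd : Differentiable ℂ F := fun z => (hF z).differentiableAt
  have hA0 : 0 ≤ A := (norm_nonneg _).trans (hA 0)
  -- The gap μ - τ serves as the slack in the type: |F| ≤ A e^{μ Im z}, which the modulus of e^{iμz}
  -- cancels exactly.
  have hFC := hFt (μ - τ) (by linarith)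
  rw [show τ + (μ - τ) = μ by ring] at hFC
  have hFb : ∀ z : ℂ, 0 ≤ z.im → ‖F z‖ ≤ A * Real.exp (μ * z.im) := fun z hz =>
    norm_le_exp_of_bounded_real hFd hFC hA hz
  set φ : ℂ → ℂ := fun z => Complex.exp (Complex.I * μ * z) / (1 - Complex.I * ε * z) ^ 2 with hφ
  set φ' : ℂ → ℂ := fun z => Complex.exp (Complex.I * μ * z) *
    ((Complex.I * μ) / (1 - Complex.I * ε * z) ^ 2 +
      2 * (Complex.I * ε) / (1 - Complex.I * ε * z) ^ 3) with hφ'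
  have hφd : ∀ z : ℂ, 0 ≤ z.im → HasDerivAt φ (φ' z) z := by
    intro z hz
    have hne := one_sub_I_mul_ne_zero hε.le hz
    have h1 : HasDerivAt (fun z : ℂ => Complex.exp (Complex.I * μ * z))
        (Complex.exp (Complex.I * μ * z) * (Complex.I * μ * 1)) z :=
      ((hasDerivAt_id z).const_mul (Complex.I * μ)).cexp
    have h2 : HasDerivAt (fun z : ℂ => (1 - Complex.I * ε * z) ^ 2)
        (2 * (1 - Complex.I * ε * z) ^ 1 * (-(Complex.I * ε * 1))) z := by
      simpa using (((hasDerivAt_id z).const_mul (Complex.I * ε)).const_sub 1).fun_pow 2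
    refine (h1.fun_div h2 (pow_ne_zero 2 hne)).congr_deriv ?_
    simp only [hφ']
    field_simp
    ring
  have hexp : ∀ z : ℂ, ‖Complex.exp (Complex.I * μ * z)‖ = Real.exp (-(μ * z.im)) := by
    intro z; rw [Complex.norm_exp]; simp
  have hφb : ∀ z : ℂ, 0 ≤ z.im →
      ‖φ z‖ ≤ Real.exp (-(μ * z.im)) * (ε⁻¹ ^ 2 / (1 + ‖z‖ ^ 2)) := by
    intro z hz
    obtain ⟨h1, h2⟩ := norm_one_sub_I_mul_sq_ge hε.le hε1 hz
    rw [hφ]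
    simp only [norm_div, norm_pow, hexp]
    rw [div_eq_mul_inv]
    gcongr
    rw [inv_pow, ← one_div, ← one_div, div_div]
    gcongr
  have hφ'b : ∀ z : ℂ, 0 ≤ z.im →
      ‖φ' z‖ ≤ Real.exp (-(μ * z.im)) * ((μ + 2) * ε⁻¹ ^ 2 / (1 + ‖z‖ ^ 2)) := by
    intro z hz
    obtain ⟨h1, h2⟩ := norm_one_sub_I_mul_sq_ge hε.le hε1 hz
    have hμ0 : 0 ≤ μ := by linarith
    simp only [hφ', norm_mul, hexp]
    gcongr
    refine (norm_add_le _ _).trans ?_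
    simp only [norm_div, norm_pow, norm_mul, Complex.norm_I, Complex.norm_real, one_mul,
      Real.norm_of_nonneg hμ0, Real.norm_of_nonneg hε.le, Complex.norm_ofNat]
    set D := ‖1 - Complex.I * ε * z‖
    have hD : 0 < D := by linarith
    calc μ / D ^ 2 + 2 * ε / D ^ 3 ≤ μ / D ^ 2 + 2 * 1 / D ^ 2 := by
          gcongr
          · norm_num
      _ = (μ + 2) / D ^ 2 := by ring
      _ ≤ (μ + 2) / (ε ^ 2 * (1 + ‖z‖ ^ 2)) := by gcongr
      _ = _ := by rw [inv_pow]; field_simp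
  have hzero : ∫ x : ℝ, F x * φ' x = 0 := by
    refine integral_eq_zero_of_upper_decay (H := fun z => F z * φ' z)
      (A := A * ((μ + 2) * ε⁻¹ ^ 2)) ?_ ?_
    · refine hFd.differentiableOn.mul ?_
      intro z hz
      have hne := one_sub_I_mul_ne_zero hε.le hz
      refine DifferentiableAt.differentiableWithinAt ?_
      simp only [hφ']
      fun_prop (disch := simpa using hne)
    · intro z hz
      rw [norm_mul]
      calc ‖F z‖ * ‖φ' z‖ ≤ (A * Real.exp (μ * z.im)) *
            (Real.exp (-(μ * z.im)) * ((μ + 2) * ε⁻¹ ^ 2 / (1 + ‖z‖ ^ 2))) := by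
            gcongr
            · exact hFb z hz
            · exact hφ'b z hz
        _ = A * ((μ + 2) * ε⁻¹ ^ 2) / (1 + ‖z‖ ^ 2) *
            (Real.exp (μ * z.im) * Real.exp (-(μ * z.im))) := by ring
        _ = _ := by rw [← Real.exp_add]; simp
  have hcF : Continuous fun x : ℝ => F x := hFd.continuous.comp Complex.continuous_ofReal
  have hcφ : Continuous fun x : ℝ => φ x := by
    rw [continuous_iff_continuousAt]
    exact fun x => (hφd x (by simp)).comp_ofReal.continuousAt
  have hcφ' : Continuous fun x : ℝ => φ' x := by
    have : ∀ x : ℝ, 1 - Complex.I * ε * x ≠ 0 := fun x =>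
      one_sub_I_mul_ne_zero hε.le (by simp)
    simp only [hφ']
    fun_prop (disch := simpa using this)
  have hlor : ∀ B : ℝ, Integrable fun x : ℝ => B / (1 + ‖(x : ℂ)‖ ^ 2) := by
    intro B
    simpa [div_eq_mul_inv] using integrable_inv_one_add_sq.const_mul B
  have hφi : ∀ x : ℝ, ‖φ x‖ ≤ ε⁻¹ ^ 2 / (1 + ‖(x : ℂ)‖ ^ 2) := fun x => by
    simpa using hφb x (by simp)
  have hφ'i : ∀ x : ℝ, ‖φ' x‖ ≤ (μ + 2) * ε⁻¹ ^ 2 / (1 + ‖(x : ℂ)‖ ^ 2) := fun x => by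
    simpa using hφ'b x (by simp)
  -- Integrability of f gives no pointwise bound on ℝ at this stage, but it makes the primitive F
  -- bounded; integration by parts lets F take the place of f.
  have hparts := integral_mul_deriv_eq_deriv_mul_of_integrable
    (u := fun x : ℝ => F x) (v := fun x : ℝ => φ x) (u' := fun x : ℝ => f x)
    (v' := fun x : ℝ => φ' x)
    (fun x _ => (hF x).comp_ofReal) (fun x _ => (hφd x (by simp)).comp_ofReal)
    (((hlor _).const_mul A).mono'
      (hcF.mul hcφ').aestronglyMeasurable (Eventually.of_forall fun x => by
        simp only [Pi.mul_apply, norm_mul]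
        exact mul_le_mul (hA x) (hφ'i x) (norm_nonneg _) hA0))
    (hint.mul_bdd (c := ε⁻¹ ^ 2) hcφ.aestronglyMeasurable (Eventually.of_forall fun x =>
      (hφi x).trans (div_le_self (by positivity) (by nlinarith [norm_nonneg (x : ℂ)]))))
    (((hlor _).const_mul A).mono'
      (hcF.mul hcφ).aestronglyMeasurable (Eventually.of_forall fun x => by
        simp only [Pi.mul_apply, norm_mul]
        exact mul_le_mul (hA x) (hφi x) (norm_nonneg _) hA0))
  have : ∫ x : ℝ, f x * φ x = 0 := by
    rw [hzero] at hparts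
    exact neg_eq_zero.mp hparts.symm
  exact this

/-- The damping is removed by letting ε = 1/(n+1) tend to 0, with |f| as dominating function. -/
theorem integral_mul_exp_eq_zero_of_lt {f : ℂ → ℂ} {τ μ : ℝ} (hτ : 0 ≤ τ) (hμ : τ < μ)
    (hd : Differentiable ℂ f) (ht : HasExpTypeAtMost f τ) (hint : Integrable fun x : ℝ => f x) :
    ∫ x : ℝ, f x * Complex.exp (Complex.I * μ * x) = 0 := by
  have hlim : Tendsto (fun n : ℕ => ∫ x : ℝ, f x *
      (Complex.exp (Complex.I * μ * x) / (1 - Complex.I * ((1 / ((n : ℝ) + 1) : ℝ) : ℂ) * x) ^ 2))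
      atTop (𝓝 (∫ x : ℝ, f x * Complex.exp (Complex.I * μ * x))) := by
    refine tendsto_integral_of_dominated_convergence (fun x : ℝ => ‖f x‖) ?_ hint.norm ?_ ?_
    · intro n
      have : ∀ x : ℝ, 1 - Complex.I * ((1 / ((n : ℝ) + 1) : ℝ) : ℂ) * x ≠ 0 := fun x =>
        one_sub_I_mul_ne_zero (by positivity) (by simp)
      refine hint.aestronglyMeasurable.mul (Continuous.aestronglyMeasurable ?_)
      refine Continuous.div (by fun_prop) (by fun_prop) (fun x => pow_ne_zero 2 (this x))
    · intro n
      refine Eventually.of_forall fun x => ?_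
      rw [norm_mul]
      refine mul_le_of_le_one_right (norm_nonneg _) ?_
      have h := (norm_one_sub_I_mul_sq_ge (ε := 1 / ((n : ℝ) + 1)) (by positivity)
        (by rw [div_le_one (by positivity)]; linarith [(Nat.cast_nonneg n : (0 : ℝ) ≤ n)])
        (z := (x : ℂ)) (by simp)).2
      rw [norm_div, norm_pow, Complex.norm_exp]
      refine div_le_one_of_le₀ ?_ (by positivity)
      simp only [Complex.mul_re, Complex.I_re, Complex.I_im, Complex.ofReal_re, Complex.ofReal_im,
        Complex.mul_im, mul_zero, zero_mul, one_mul, sub_self, Real.exp_zero]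
      exact one_le_pow₀ h
    · refine Eventually.of_forall fun x => ?_
      have h0 : Tendsto (fun n : ℕ => ((1 / ((n : ℝ) + 1) : ℝ) : ℂ)) atTop (𝓝 0) := by
        have := (Complex.continuous_ofReal.tendsto 0).comp
          (tendsto_one_div_add_atTop_nhds_zero_nat (𝕜 := ℝ))
        simpa [Function.comp_def] using this
      have h1 : Tendsto (fun n : ℕ =>
          (1 - Complex.I * ((1 / ((n : ℝ) + 1) : ℝ) : ℂ) * x) ^ 2) atTop (𝓝 1) := by
        have := ((((h0.const_mul Complex.I).mul_const (x : ℂ)).const_sub 1)).pow 2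
        simpa using this
      have h2 := ((tendsto_const_nhds (x := Complex.exp (Complex.I * μ * x))).div h1
        one_ne_zero).const_mul (f x)
      simpa only [div_one, Pi.div_apply] using h2
  refine tendsto_nhds_unique hlim (tendsto_const_nhds.congr fun n => ?_)
  exact (integral_mul_damped_exp_eq_zero hτ hμ (by positivity)
    (by rw [div_le_one (by positivity)]; linarith [(Nat.cast_nonneg n : (0 : ℝ) ≤ n)])
    hd ht hint).symm

/-- Continuity in the frequency extends the vanishing from μ > τ to the endpoint μ = τ, the case
used later with cos πx, sin πx and cos 2πx. -/
theorem continuous_integral_mul_exp {f : ℝ → ℂ} (hint : Integrable f) :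
    Continuous fun μ : ℝ => ∫ x : ℝ, f x * Complex.exp (Complex.I * μ * x) := by
  refine continuous_of_dominated (bound := fun x => ‖f x‖) ?_ ?_ hint.norm ?_
  · intro μ
    exact hint.aestronglyMeasurable.mul (Continuous.aestronglyMeasurable (by fun_prop))
  · intro μ
    refine Eventually.of_forall fun x => ?_
    rw [norm_mul, Complex.norm_exp]
    simp
  · exact Eventually.of_forall fun x => by fun_prop

/-- Paley–Wiener for integrable functions: the Fourier transform vanishes beyond the type. -/
theorem integral_mul_exp_eq_zero {f : ℂ → ℂ} {τ μ : ℝ} (hτ : 0 ≤ τ) (hμ : τ ≤ |μ|)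
    (hd : Differentiable ℂ f) (ht : HasExpTypeAtMost f τ) (hint : Integrable fun x : ℝ => f x) :
    ∫ x : ℝ, f x * Complex.exp (Complex.I * μ * x) = 0 := by
  have pos : ∀ (f : ℂ → ℂ), Differentiable ℂ f → HasExpTypeAtMost f τ →
      Integrable (fun x : ℝ => f x) → ∀ μ, τ ≤ μ →
      ∫ x : ℝ, f x * Complex.exp (Complex.I * μ * x) = 0 := by
    intro f hd ht hint μ hμ
    have hc := (continuous_integral_mul_exp hint).continuousAt (x := μ)
    have : Tendsto (fun μ : ℝ => ∫ x : ℝ, f x * Complex.exp (Complex.I * μ * x)) (𝓝[>] μ) (𝓝 0) :=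
      tendsto_const_nhds.congr' (eventually_nhdsWithin_of_forall fun ν hν =>
        (integral_mul_exp_eq_zero_of_lt hτ (lt_of_le_of_lt hμ hν) hd ht hint).symm)
    exact tendsto_nhds_unique (hc.tendsto.mono_left nhdsWithin_le_nhds) this
  rcases le_abs.mp hμ with h | h
  · exact pos f hd ht hint μ h
  · have h1 := pos (fun z => f (-z)) (hd.comp differentiable_neg) (fun ε hε => by
      obtain ⟨C, hC, h⟩ := ht ε hε
      exact ⟨C, hC, fun z => by simpa using h (-z)⟩)
      (by simpa using hint.comp_neg) (-μ) h
    rw [← integral_neg_eq_self] at h1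
    simpa using h1

/-! ### The weight and the entire sinc function. -/

theorem weight_nonneg (x : ℝ) : 0 ≤ weight x := by
  have := Real.abs_sinc_le_one (Real.pi * x)
  rw [weight, sub_nonneg]
  exact (sq_le_one_iff_abs_le_one _).mpr this

theorem weight_le_one (x : ℝ) : weight x ≤ 1 := by
  rw [weight]; nlinarith [sq_nonneg (Real.sinc (Real.pi * x))]

theorem continuous_weight : Continuous weight := by
  unfold weight
  exact continuous_const.sub ((Real.continuous_sinc.comp (by fun_prop)).pow 2)

theorem weight_neg (x : ℝ) : weight (-x) = weight x := by
  simp [weight, Real.sinc_neg]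

/-- The entire function `sin w / w`. -/
def csinc (w : ℂ) : ℂ := dslope Complex.sin 0 w

theorem mul_csinc (w : ℂ) : w * csinc w = Complex.sin w := by
  have := sub_smul_dslope Complex.sin 0 w
  simpa [csinc] using this

theorem csinc_zero : csinc 0 = 1 := by
  simp [csinc, dslope_same]

theorem differentiable_csinc : Differentiable ℂ csinc := by
  have h := (Complex.differentiableOn_dslope (f := Complex.sin) (c := 0) univ_mem).mpr
    Complex.differentiable_sin.differentiableOn
  exact differentiableOn_univ.mp h

theorem csinc_of_ne_zero {w : ℂ} (hw : w ≠ 0) : csinc w = Complex.sin w / w := by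
  rw [eq_div_iff hw, mul_comm, mul_csinc]

theorem csinc_neg (w : ℂ) : csinc (-w) = csinc w := by
  rcases eq_or_ne w 0 with rfl | hw
  · simp
  · rw [csinc_of_ne_zero hw, csinc_of_ne_zero (neg_ne_zero.mpr hw), Complex.sin_neg, neg_div_neg_eq]

theorem csinc_ofReal (x : ℝ) : csinc x = (Real.sinc x : ℝ) := by
  rcases eq_or_ne x 0 with rfl | hx
  · simp [csinc_zero]
  · rw [csinc_of_ne_zero (by exact_mod_cast hx), Real.sinc_of_ne_zero hx]
    push_cast; rfl

theorem norm_sin_le (w : ℂ) : ‖Complex.sin w‖ ≤ Real.exp |w.im| := by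
  rw [Complex.sin]
  rw [norm_div, norm_mul, Complex.norm_I, mul_one, Complex.norm_ofNat, div_le_iff₀ two_pos]
  refine (norm_sub_le _ _).trans ?_
  rw [Complex.norm_exp, Complex.norm_exp]
  have h1 : (-w * Complex.I).re ≤ |w.im| := by simpa using le_abs_self _
  have h2 : (w * Complex.I).re ≤ |w.im| := by simpa using neg_le_abs _
  have := Real.exp_le_exp.mpr h1
  have := Real.exp_le_exp.mpr h2
  linarith

theorem norm_cos_le (w : ℂ) : ‖Complex.cos w‖ ≤ Real.exp |w.im| := by
  rw [Complex.cos]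
  rw [norm_div, Complex.norm_ofNat, div_le_iff₀ two_pos]
  refine (norm_add_le _ _).trans ?_
  rw [Complex.norm_exp, Complex.norm_exp]
  have h1 : (-w * Complex.I).re ≤ |w.im| := by simpa using le_abs_self _
  have h2 : (w * Complex.I).re ≤ |w.im| := by simpa using neg_le_abs _
  have := Real.exp_le_exp.mpr h1
  have := Real.exp_le_exp.mpr h2
  linarith

/-- Compactness handles the unit disc; outside it, w·`csinc` w = sin w supplies the decay. -/
theorem exists_norm_csinc_le :
    ∃ K : ℝ, 0 < K ∧ ∀ w : ℂ, ‖csinc w‖ ≤ K * Real.exp |w.im| / (1 + ‖w‖) := by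
  obtain ⟨K₀, hK₀⟩ := (isCompact_closedBall (0 : ℂ) 1).exists_bound_of_continuousOn
    differentiable_csinc.continuous.continuousOn
  refine ⟨2 * (max K₀ 1), by positivity, fun w => ?_⟩
  have hexp : 1 ≤ Real.exp |w.im| := Real.one_le_exp (abs_nonneg _)
  have hmax : 1 ≤ max K₀ 1 := le_max_right _ _
  rw [le_div_iff₀ (by positivity)]
  rcases le_total ‖w‖ 1 with h | h
  · have h1 : ‖csinc w‖ ≤ max K₀ 1 := (hK₀ w (by simpa using h)).trans (le_max_left _ _)
    calc ‖csinc w‖ * (1 + ‖w‖) ≤ max K₀ 1 * 2 := by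
          gcongr; linarith
      _ = 2 * max K₀ 1 * 1 := by ring
      _ ≤ _ := by gcongr
  · have h1 : ‖w‖ * ‖csinc w‖ ≤ Real.exp |w.im| := by
      rw [← norm_mul, mul_csinc]; exact norm_sin_le w
    calc ‖csinc w‖ * (1 + ‖w‖) ≤ 2 * (‖w‖ * ‖csinc w‖) := by nlinarith [norm_nonneg (csinc w)]
      _ ≤ 2 * 1 * Real.exp |w.im| := by linarith
      _ ≤ _ := by gcongr

/-! ### The extremal function and its denominator-free form. -/

/-- The angle `1 / √2`. -/
def theta : ℝ := (√2)⁻¹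

theorem theta_pos : 0 < theta := by unfold theta; positivity

theorem theta_sq : theta ^ 2 = 1 / 2 := by
  rw [theta, inv_pow, Real.sq_sqrt (by norm_num)]; norm_num

theorem sqrt_two_eq : √2 = 2 * theta := by
  have h := Real.mul_self_sqrt (show (0 : ℝ) ≤ 2 by norm_num)
  have : √2 ≠ 0 := by positivity
  rw [theta]; field_simp; linarith

theorem theta_lt_one : theta < 1 := by nlinarith [theta_sq, theta_pos]

theorem sin_theta_pos : 0 < Real.sin theta :=
  Real.sin_pos_of_pos_of_lt_pi theta_pos (by linarith [theta_lt_one, Real.pi_gt_three])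

theorem cos_theta_pos : 0 < Real.cos theta :=
  Real.cos_pos_of_mem_Ioo ⟨by linarith [theta_pos, Real.pi_gt_three],
    by linarith [theta_lt_one, Real.pi_gt_three]⟩

/-- The constant `√2 cot (1 / √2)`. -/
def robin : ℝ := √2 * Real.cot theta

theorem robin_eq : robin = 2 * theta * Real.cos theta / Real.sin theta := by
  rw [robin, sqrt_two_eq, Real.cot_eq_cos_div_sin]; ring

theorem robin_pos : 0 < robin := by
  rw [robin_eq]
  have := theta_pos; have := sin_theta_pos; have := cos_theta_pos
  positivity

/-- The function `cos πz - √2 cot(1/√2) πz sin πz`, whose zeros are the quadrature nodes. -/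
def robinCos (z : ℂ) : ℂ :=
  Complex.cos (Real.pi * z) - robin * (Real.pi * z) * Complex.sin (Real.pi * z)

theorem differentiable_robinCos : Differentiable ℂ robinCos := by
  unfold robinCos; fun_prop

theorem robinCos_neg (z : ℂ) : robinCos (-z) = robinCos z := by
  simp [robinCos]

/-- The extremal function `(cos πz - √2 cot(1/√2) πz sin πz) / (1 - 2π²z²)`. -/
def extremal (z : ℂ) : ℂ :=
  ((theta / (2 * Real.sin theta) : ℝ) : ℂ) *
    (csinc (Real.pi * z + theta) + csinc (Real.pi * z - theta))

theorem differentiable_extremal : Differentiable ℂ extremal := by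
  unfold extremal
  exact ((differentiable_csinc.comp (by fun_prop)).add
    (differentiable_csinc.comp (by fun_prop))).const_mul _

theorem extremal_neg (z : ℂ) : extremal (-z) = extremal z := by
  unfold extremal
  rw [← csinc_neg (Real.pi * -z + theta), ← csinc_neg (Real.pi * -z - theta),
    show -((Real.pi : ℂ) * -z + theta) = Real.pi * z - theta by ring,
    show -((Real.pi : ℂ) * -z - theta) = Real.pi * z + theta by ring, add_comm (csinc _)]

theorem extremal_zero : extremal 0 = 1 := by
  unfold extremal
  have h : ((2 * Real.sin theta : ℝ) : ℂ) ≠ 0 := by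
    exact_mod_cast (mul_pos two_pos sin_theta_pos).ne'
  rw [mul_zero, zero_add, zero_sub, csinc_neg, csinc_ofReal, Real.sinc_of_ne_zero theta_pos.ne']
  norm_cast
  have := theta_pos.ne'; have := sin_theta_pos.ne'
  field_simp
  norm_num

/-- Two shifted sincs make the function visibly entire. Their common denominator is (πz + θ)(πz - θ)
= -(1 - 2π²z²)/2 because θ² = 1/2, and the addition formulas for sine turn the numerator into
`robinCos`. -/
theorem extremal_mul (z : ℂ) : extremal z * (1 - 2 * Real.pi ^ 2 * z ^ 2) = robinCos z := by
  have h1 := mul_csinc (Real.pi * z + theta)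
  have h2 := mul_csinc (Real.pi * z - theta)
  rw [Complex.sin_add] at h1
  rw [Complex.sin_sub] at h2
  have hθ : (theta : ℂ) ^ 2 = 1 / 2 := by
    have := congrArg ((↑) : ℝ → ℂ) theta_sq
    push_cast at this
    exact this
  have hs : Complex.sin theta ≠ 0 := by
    rw [← Complex.ofReal_sin]; exact_mod_cast sin_theta_pos.ne'
  have ha : (robin : ℂ) = 2 * theta * Complex.cos theta / Complex.sin theta := by
    rw [robin_eq]; push_cast; rfl
  unfold extremal robinCos
  rw [ha]
  push_cast
  set p := csinc (Real.pi * z + theta)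
  set q := csinc (Real.pi * z - theta)
  have e : (1 : ℂ) - 2 * Real.pi ^ 2 * z ^ 2 =
      -2 * ((Real.pi * z + theta) * (Real.pi * z - theta)) := by
    linear_combination -2 * hθ
  rw [e]
  field_simp
  linear_combination (-(Real.pi * z - theta) * theta) * h1 - ((Real.pi * z + theta) * theta) * h2
    + 2 * Complex.cos (Real.pi * z) * Complex.sin theta * hθ

theorem extremal_ofReal (x : ℝ) : extremal x = ((theta / (2 * Real.sin theta) *
    (Real.sinc (Real.pi * x + theta) + Real.sinc (Real.pi * x - theta)) : ℝ) : ℂ) := by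
  unfold extremal
  rw [show (Real.pi : ℂ) * x + theta = ((Real.pi * x + theta : ℝ) : ℂ) by push_cast; ring,
    show (Real.pi : ℂ) * x - theta = ((Real.pi * x - theta : ℝ) : ℂ) by push_cast; ring,
    csinc_ofReal, csinc_ofReal]
  push_cast; rfl

theorem extremal_ofReal_re (x : ℝ) : (((extremal x).re : ℝ) : ℂ) = extremal x := by
  rw [extremal_ofReal, Complex.ofReal_re]

theorem sinc_pos {y : ℝ} (h1 : -Real.pi < y) (h2 : y < Real.pi) : 0 < Real.sinc y := by
  rcases lt_trichotomy y 0 with h | h | h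
  · rw [← Real.sinc_neg, Real.sinc_of_ne_zero (by linarith)]
    exact div_pos (Real.sin_pos_of_pos_of_lt_pi (by linarith) (by linarith)) (by linarith)
  · simp [h]
  · rw [Real.sinc_of_ne_zero h.ne']
    exact div_pos (Real.sin_pos_of_pos_of_lt_pi h h2) h

/-- For |x| ≤ 1/2 both πx ± θ lie in (-π, π), where sinc is positive. So the only zeros of
`robinCos` in [-1/2, 1/2] are those of 1 - 2π²z². -/
theorem extremal_re_pos {x : ℝ} (h1 : |x| ≤ 1 / 2) : 0 < (extremal x).re := by
  rw [extremal_ofReal, Complex.ofReal_re]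
  obtain ⟨ha, hb⟩ := abs_le.mp h1
  have hπ := Real.pi_gt_three
  have := theta_pos; have := theta_lt_one; have := sin_theta_pos
  have e1 : Real.pi * x ≤ Real.pi * (1 / 2) := by gcongr
  have e2 : Real.pi * (-(1 / 2)) ≤ Real.pi * x := by gcongr
  have p1 := sinc_pos (y := Real.pi * x + theta) (by linarith) (by linarith)
  have p2 := sinc_pos (y := Real.pi * x - theta) (by linarith) (by linarith)
  positivity

theorem exists_norm_extremal_le :
    ∃ K : ℝ, 0 < K ∧ ∀ z : ℂ, ‖extremal z‖ ≤ K * Real.exp (Real.pi * |z.im|) / (1 + ‖z‖) := by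
  obtain ⟨K, hK, h⟩ := exists_norm_csinc_le
  have hc : 0 < theta / (2 * Real.sin theta) := by
    have := theta_pos; have := sin_theta_pos; positivity
  refine ⟨theta / (2 * Real.sin theta) * (4 * K), by positivity, fun z => ?_⟩
  have key : ∀ t : ℝ, |t| ≤ 1 → ‖csinc (Real.pi * z + t)‖ ≤
      2 * K * Real.exp (Real.pi * |z.im|) / (1 + ‖z‖) := by
    intro t ht
    refine (h _).trans ?_
    have him : |(Real.pi * z + t : ℂ).im| = Real.pi * |z.im| := by
      simp [abs_mul, abs_of_pos Real.pi_pos]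
    rw [him]
    have hn : Real.pi * ‖z‖ ≤ ‖(Real.pi * z + t : ℂ)‖ + 1 := by
      have := norm_sub_le (Real.pi * z + t : ℂ) t
      rw [add_sub_cancel_right, norm_mul, Complex.norm_real, Complex.norm_real,
        Real.norm_of_nonneg Real.pi_pos.le, Real.norm_eq_abs] at this
      linarith
    have hz := norm_nonneg z
    have hπ := Real.pi_gt_three
    rw [div_le_div_iff₀ (by positivity) (by positivity)]
    have : 1 + ‖z‖ ≤ 2 * (1 + ‖(Real.pi * z + t : ℂ)‖) := by
      have := norm_nonneg (Real.pi * z + t : ℂ)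
      nlinarith
    calc K * Real.exp (Real.pi * |z.im|) * (1 + ‖z‖)
        ≤ K * Real.exp (Real.pi * |z.im|) * (2 * (1 + ‖(Real.pi * z + t : ℂ)‖)) := by gcongr
      _ = _ := by ring
  have k1 := key theta (by rw [abs_of_pos theta_pos]; exact theta_lt_one.le)
  have k2 := key (-theta) (by rw [abs_neg, abs_of_pos theta_pos]; exact theta_lt_one.le)
  rw [Complex.ofReal_neg, ← sub_eq_add_neg] at k2
  unfold extremal
  rw [norm_mul, Complex.norm_real, Real.norm_of_nonneg hc.le, mul_assoc, mul_div_assoc]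
  refine mul_le_mul_of_nonneg_left ((norm_add_le _ _).trans ((add_le_add k1 k2).trans_eq ?_)) hc.le
  ring

/-! ### Operations on functions of exponential type. -/

theorem HasExpTypeAtMost.of_le {f : ℂ → ℂ} {τ K : ℝ} (hτ : 0 ≤ τ) (hK : 0 < K)
    (h : ∀ z : ℂ, ‖f z‖ ≤ K * Real.exp (τ * |z.im|)) : HasExpTypeAtMost f τ := by
  intro ε hε
  refine ⟨K, hK, fun z => (h z).trans ?_⟩
  gcongr
  · linarith
  · exact Complex.abs_im_le_norm z

theorem HasExpTypeAtMost.mul {f g : ℂ → ℂ} {σ τ : ℝ} (hf : HasExpTypeAtMost f σ)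
    (hg : HasExpTypeAtMost g τ) : HasExpTypeAtMost (fun z => f z * g z) (σ + τ) := by
  intro ε hε
  obtain ⟨C, hC, h1⟩ := hf (ε / 2) (by positivity)
  obtain ⟨D, hD, h2⟩ := hg (ε / 2) (by positivity)
  refine ⟨C * D, by positivity, fun z => ?_⟩
  rw [norm_mul]
  calc ‖f z‖ * ‖g z‖ ≤ (C * Real.exp ((σ + ε / 2) * ‖z‖)) * (D * Real.exp ((τ + ε / 2) * ‖z‖)) := by
        gcongr
        · exact h1 z
        · exact h2 z
    _ = C * D * (Real.exp ((σ + ε / 2) * ‖z‖) * Real.exp ((τ + ε / 2) * ‖z‖)) := by ring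
    _ = _ := by rw [← Real.exp_add]; ring_nf

theorem HasExpTypeAtMost.add {f g : ℂ → ℂ} {τ : ℝ} (hf : HasExpTypeAtMost f τ)
    (hg : HasExpTypeAtMost g τ) : HasExpTypeAtMost (fun z => f z + g z) τ := by
  intro ε hε
  obtain ⟨C, hC, h1⟩ := hf ε hε
  obtain ⟨D, hD, h2⟩ := hg ε hε
  refine ⟨C + D, by positivity, fun z => ?_⟩
  rw [add_mul]
  exact (norm_add_le _ _).trans (add_le_add (h1 z) (h2 z))

theorem HasExpTypeAtMost.const_mul {f : ℂ → ℂ} {τ : ℝ} (hf : HasExpTypeAtMost f τ) (c : ℂ) :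
    HasExpTypeAtMost (fun z => c * f z) τ := by
  intro ε hε
  obtain ⟨C, hC, h1⟩ := hf ε hε
  refine ⟨(‖c‖ + 1) * C, by positivity, fun z => ?_⟩
  rw [norm_mul, mul_assoc]
  have := h1 z
  gcongr
  linarith

theorem HasExpTypeAtMost.comp_neg {f : ℂ → ℂ} {τ : ℝ} (hf : HasExpTypeAtMost f τ) :
    HasExpTypeAtMost (fun z => f (-z)) τ := by
  intro ε hε
  obtain ⟨C, hC, h⟩ := hf ε hε
  exact ⟨C, hC, fun z => by simpa using h (-z)⟩

/-- Dividing out a zero at the origin keeps the exponential type. -/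
theorem HasExpTypeAtMost.of_mul_id {f : ℂ → ℂ} {τ : ℝ} (hτ : 0 ≤ τ) (hc : Continuous f)
    (hf : HasExpTypeAtMost (fun z => z * f z) τ) : HasExpTypeAtMost f τ := by
  intro ε hε
  obtain ⟨C, hC, h⟩ := hf ε hε
  obtain ⟨K, hK⟩ := (isCompact_closedBall (0 : ℂ) 1).exists_bound_of_continuousOn hc.continuousOn
  refine ⟨max K C, lt_max_of_lt_right hC, fun z => ?_⟩
  rcases le_total ‖z‖ 1 with h1 | h1
  · have e : 1 ≤ Real.exp ((τ + ε) * ‖z‖) := Real.one_le_exp (by positivity)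
    have := (hK z (by simpa using h1)).trans (le_max_left K C)
    nlinarith [(norm_nonneg _).trans this]
  · have := h z
    rw [norm_mul] at this
    calc ‖f z‖ ≤ ‖z‖ * ‖f z‖ := le_mul_of_one_le_left (norm_nonneg _) h1
      _ ≤ _ := this
      _ ≤ _ := by gcongr; exact le_max_right _ _

/-! ### Integrability of the squared extremal function. -/

theorem one_add_sq_le {x : ℝ} : 1 + x ^ 2 ≤ (1 + |x|) ^ 2 := by
  nlinarith [sq_abs x, abs_nonneg x]

theorem exists_extremal_sq_le : ∃ K : ℝ, 0 < K ∧ ∀ x : ℝ, ‖extremal x‖ ^ 2 ≤ K * (1 + x ^ 2)⁻¹ := by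
  obtain ⟨K, hK, h⟩ := exists_norm_extremal_le
  refine ⟨K ^ 2, by positivity, fun x => ?_⟩
  have := h x
  simp only [Complex.ofReal_im, abs_zero, mul_zero, Real.exp_zero, mul_one, Complex.norm_real,
    Real.norm_eq_abs] at this
  calc ‖extremal x‖ ^ 2 ≤ (K / (1 + |x|)) ^ 2 := by gcongr
    _ = K ^ 2 / (1 + |x|) ^ 2 := by rw [div_pow]
    _ ≤ K ^ 2 / (1 + x ^ 2) := by gcongr; exact one_add_sq_le
    _ = _ := by rw [div_eq_mul_inv]

theorem continuous_extremal_ofReal : Continuous fun x : ℝ => extremal x :=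
  differentiable_extremal.continuous.comp Complex.continuous_ofReal

theorem integrable_extremal_norm_sq : Integrable fun x : ℝ => ‖extremal x‖ ^ 2 := by
  obtain ⟨K, hK, h⟩ := exists_extremal_sq_le
  refine (integrable_inv_one_add_sq.const_mul K).mono'
    (continuous_extremal_ofReal.norm.pow 2).aestronglyMeasurable (Eventually.of_forall fun x => ?_)
  rw [Real.norm_of_nonneg (by positivity)]
  exact h x

theorem integrable_extremal_sq : Integrable fun x : ℝ => extremal x ^ 2 := by
  refine integrable_extremal_norm_sq.mono' (continuous_extremal_ofReal.pow 2).aestronglyMeasurable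
    (Eventually.of_forall fun x => ?_)
  rw [norm_pow]

theorem hasExpType_extremal : HasExpTypeAtMost extremal Real.pi := by
  obtain ⟨K, hK, h⟩ := exists_norm_extremal_le
  refine HasExpTypeAtMost.of_le Real.pi_pos.le hK fun z => (h z).trans ?_
  exact div_le_self (by positivity) (by linarith [norm_nonneg z])

theorem memH_extremal : MemH extremal where
  entire := differentiable_extremal
  expType := hasExpType_extremal
  sqIntegrable := integrable_extremal_norm_sq.mul_bdd (c := 1)
    continuous_weight.aestronglyMeasurable (Eventually.of_forall fun x => by
      rw [Real.norm_of_nonneg (weight_nonneg x)]; exact weight_le_one x)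

/-! ### Division by zeros, and integrability of the quotients. -/

theorem exists_entire_div_at {f : ℂ → ℂ} (hf : Differentiable ℂ f) (c : ℂ) :
    ∃ g : ℂ → ℂ, Differentiable ℂ g ∧ (∀ z, f z = f c + (z - c) * g z) ∧ g c = deriv f c := by
  refine ⟨dslope f c, ?_, fun z => ?_, dslope_same f c⟩
  · rw [← differentiableOn_univ]
    exact (Complex.differentiableOn_dslope univ_mem).mpr hf.differentiableOn
  · have := sub_smul_dslope f c z
    rw [smul_eq_mul] at this
    rw [this]; ring

theorem exists_entire_div {f : ℂ → ℂ} (hf : Differentiable ℂ f) (h0 : f 0 = 0) :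
    ∃ g : ℂ → ℂ, Differentiable ℂ g ∧ (∀ z, f z = z * g z) ∧ g 0 = deriv f 0 := by
  simpa [h0] using exists_entire_div_at hf 0

theorem deriv_zero_of_even {d : ℂ → ℂ} (hd : Differentiable ℂ d) (he : ∀ z, d (-z) = d z) :
    deriv d 0 = 0 := by
  have h1 : HasDerivAt d (deriv d 0) 0 := (hd 0).hasDerivAt
  have h2 : HasDerivAt (fun z => d (-z)) (-(deriv d 0)) 0 := by
    have h1' : HasDerivAt d (deriv d 0) (-0) := by simpa using h1
    simpa [Function.comp_def] using h1'.scomp (0 : ℂ) (hasDerivAt_neg (0 : ℂ))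
  rw [show (fun z => d (-z)) = d from funext he] at h2
  have := h1.unique h2
  linear_combination this / 2

/-- Evenness kills the derivative at 0, so one zero there is automatically double. -/
theorem exists_div_sq_of_even {d : ℂ → ℂ} (hd : Differentiable ℂ d) (he : ∀ z, d (-z) = d z)
    (h0 : d 0 = 0) : ∃ g : ℂ → ℂ, Differentiable ℂ g ∧ ∀ z, d z = z * (z * g z) := by
  obtain ⟨g, hg, hdg, hg0⟩ := exists_entire_div hd h0
  obtain ⟨g', hg', hgg', -⟩ := exists_entire_div hg (hg0.trans (deriv_zero_of_even hd he))
  exact ⟨g', hg', fun z => by rw [hdg, hgg']⟩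

/-- Meant for quotients by x or x²: they compare with the original function only for |x| ≥ 1, and
continuity handles the rest. -/
theorem integrable_of_bound_outside {h : ℝ → ℂ} {b : ℝ → ℝ} (hc : Continuous h)
    (hb : Integrable b) (hb0 : ∀ x, 0 ≤ b x) (hle : ∀ x, 1 ≤ |x| → ‖h x‖ ≤ b x) :
    Integrable h := by
  obtain ⟨K, hK⟩ := (isCompact_Icc (a := (-1 : ℝ)) (b := 1)).exists_bound_of_continuousOn
    hc.continuousOn
  have hi : Integrable ((Icc (-1 : ℝ) 1).indicator fun _ => |K|) :=
    (integrable_indicator_iff measurableSet_Icc).mpr (by simp)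
  refine (hi.add hb).mono' hc.aestronglyMeasurable (Eventually.of_forall fun x => ?_)
  rw [Pi.add_apply]
  by_cases hx : x ∈ Icc (-1 : ℝ) 1
  · rw [indicator_of_mem hx]
    linarith [(hK x hx).trans (le_abs_self K), hb0 x]
  · rw [indicator_of_notMem hx, zero_add]
    refine hle x ?_
    by_contra hlt
    exact hx (abs_le.mp (not_le.mp hlt).le)

/-! ### The weight against double zeros at the origin. -/

/-- Multiplication by x² clears the denominator of the squared sinc and leaves a polynomial plus a
cosine of frequency 2π, exactly the frequency that type 2π cannot see. -/
theorem mul_weight (x : ℝ) :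
    x ^ 2 * weight x = x ^ 2 - (1 - Real.cos (2 * Real.pi * x)) / (2 * Real.pi ^ 2) := by
  have hc : Real.cos (2 * Real.pi * x) = 1 - 2 * Real.sin (Real.pi * x) ^ 2 := by
    rw [mul_assoc, Real.cos_two_mul]; nlinarith [Real.sin_sq_add_cos_sq (Real.pi * x)]
  have hπ := Real.pi_ne_zero
  rcases eq_or_ne x 0 with rfl | hx
  · simp
  · rw [hc, weight, Real.sinc_of_ne_zero (mul_ne_zero hπ hx)]
    field_simp
    ring

theorem weight_ge_half {x : ℝ} (hx : 1 ≤ |x|) : 1 / 2 ≤ weight x := by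
  have h := mul_weight x
  have hx2 : 1 ≤ x ^ 2 := (one_le_sq_iff_one_le_abs _).mpr hx
  have hπ := Real.pi_gt_three
  have h1 : (1 - Real.cos (2 * Real.pi * x)) / (2 * Real.pi ^ 2) ≤ 1 / 2 := by
    rw [div_le_iff₀ (by positivity)]
    nlinarith [Real.neg_one_le_cos (2 * Real.pi * x)]
  have h2 : x ^ 2 * (1 / 2) ≤ x ^ 2 * weight x := by rw [h]; linarith
  exact le_of_mul_le_mul_left h2 (by linarith)

theorem MemH.continuous_ofReal {f : ℂ → ℂ} (hf : MemH f) : Continuous fun x : ℝ => f x :=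
  hf.entire.continuous.comp Complex.continuous_ofReal

/-- The weight degenerates only near the origin, where an entire function is bounded anyway;
membership in 𝓗 thus yields ordinary square integrability. -/
theorem MemH.integrable_sq {f : ℂ → ℂ} (hf : MemH f) : Integrable fun x : ℝ => ‖f x‖ ^ 2 := by
  have : Integrable fun x : ℝ => ((‖f x‖ ^ 2 : ℝ) : ℂ) := by
    refine integrable_of_bound_outside
      (Complex.continuous_ofReal.comp (hf.continuous_ofReal.norm.pow 2))
      (hf.sqIntegrable.const_mul 2) (fun x => ?_) (fun x hx => ?_)
    · have := weight_nonneg x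
      positivity
    · rw [Complex.norm_real, Real.norm_of_nonneg (by positivity)]
      nlinarith [weight_ge_half hx, sq_nonneg ‖f x‖]
  exact this.re

theorem integral_mul_cos_eq_zero {f : ℂ → ℂ} {τ : ℝ} (hτ : 0 ≤ τ)
    (hd : Differentiable ℂ f) (ht : HasExpTypeAtMost f τ) (hint : Integrable fun x : ℝ => f x) :
    (Integrable fun x : ℝ => f x * Complex.cos (τ * x)) ∧
      ∫ x : ℝ, f x * Complex.cos (τ * x) = 0 := by
  have hi : ∀ μ : ℝ, Integrable fun x : ℝ => f x * Complex.exp (Complex.I * μ * x) := fun μ =>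
    hint.mul_bdd (c := 1) (Continuous.aestronglyMeasurable (by fun_prop))
      (Eventually.of_forall fun x => by rw [Complex.norm_exp]; simp)
  have e : (fun x : ℝ => f x * Complex.cos (τ * x)) = fun x : ℝ =>
      2⁻¹ * (f x * Complex.exp (Complex.I * τ * x) +
        f x * Complex.exp (Complex.I * ((-τ : ℝ) : ℂ) * x)) := by
    funext x
    rw [Complex.cos]
    push_cast
    ring_nf
  rw [e]
  refine ⟨((hi τ).add (hi (-τ))).const_mul _, ?_⟩
  rw [integral_const_mul, integral_add (hi τ) (hi (-τ)),
    integral_mul_exp_eq_zero hτ (le_abs_self τ) hd ht hint,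
    integral_mul_exp_eq_zero hτ (by rw [abs_neg]; exact le_abs_self τ) hd ht hint]
  simp

theorem integral_mul_sin_eq_zero {f : ℂ → ℂ} {τ : ℝ} (hτ : 0 ≤ τ)
    (hd : Differentiable ℂ f) (ht : HasExpTypeAtMost f τ) (hint : Integrable fun x : ℝ => f x) :
    (Integrable fun x : ℝ => f x * Complex.sin (τ * x)) ∧
      ∫ x : ℝ, f x * Complex.sin (τ * x) = 0 := by
  have hi : ∀ μ : ℝ, Integrable fun x : ℝ => f x * Complex.exp (Complex.I * μ * x) := fun μ =>
    hint.mul_bdd (c := 1) (Continuous.aestronglyMeasurable (by fun_prop))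
      (Eventually.of_forall fun x => by rw [Complex.norm_exp]; simp)
  have e : (fun x : ℝ => f x * Complex.sin (τ * x)) = fun x : ℝ =>
      (Complex.I / 2) * (f x * Complex.exp (Complex.I * ((-τ : ℝ) : ℂ) * x) -
        f x * Complex.exp (Complex.I * τ * x)) := by
    funext x
    rw [Complex.sin]
    push_cast
    ring_nf
  rw [e]
  refine ⟨((hi (-τ)).sub (hi τ)).const_mul _, ?_⟩
  rw [integral_const_mul, integral_sub (hi (-τ)) (hi τ),
    integral_mul_exp_eq_zero hτ (le_abs_self τ) hd ht hint,
    integral_mul_exp_eq_zero hτ (by rw [abs_neg]; exact le_abs_self τ) hd ht hint]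
  simp

/-- Weighted integral of a function of type `2π` with a double zero at the origin. -/
theorem integral_sq_mul_weight {g : ℂ → ℂ} (hd : Differentiable ℂ g)
    (ht : HasExpTypeAtMost g (2 * Real.pi)) (hint : Integrable fun x : ℝ => g x)
    (hint2 : Integrable fun x : ℝ => ((x : ℂ) ^ 2 - 1 / (2 * Real.pi ^ 2)) * g x) :
    ∫ x : ℝ, (x : ℂ) ^ 2 * g x * (weight x : ℂ) =
      ∫ x : ℝ, ((x : ℂ) ^ 2 - 1 / (2 * Real.pi ^ 2)) * g x := by
  obtain ⟨h1, h2⟩ := integral_mul_cos_eq_zero (by positivity) hd ht hint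
  have e : (fun x : ℝ => (x : ℂ) ^ 2 * g x * (weight x : ℂ)) = fun x : ℝ =>
      ((x : ℂ) ^ 2 - 1 / (2 * Real.pi ^ 2)) * g x +
        (1 / (2 * Real.pi ^ 2)) * (g x * Complex.cos (((2 * Real.pi : ℝ) : ℂ) * x)) := by
    funext x
    have h := congrArg ((↑) : ℝ → ℂ) (mul_weight x)
    push_cast at h ⊢
    have hπ : (Real.pi : ℂ) ≠ 0 := by exact_mod_cast Real.pi_ne_zero
    linear_combination g x * h
  rw [e, integral_add hint2 (h1.const_mul _), integral_const_mul, h2, mul_zero, add_zero]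

/-- After the weight is traded for x² - 1/(2π²), this factor combines with `extremal` into a
multiple of `robinCos`. What remains is ∫ g cos πx and ∫ xg sin πx, both zero because g and zg have
type π. -/
theorem integral_mul_extremal_of_double_zero {f g : ℂ → ℂ} (hf : MemH f) (hg : Differentiable ℂ g)
    (hfg : ∀ z, f z = z * (z * g z)) :
    ∫ x : ℝ, f x * extremal x * (weight x : ℂ) = 0 := by
  have hπ : (Real.pi : ℂ) ≠ 0 := by exact_mod_cast Real.pi_ne_zero
  have hzg : Differentiable ℂ fun z => z * g z := differentiable_id.mul hg
  have ht1 : HasExpTypeAtMost (fun z => z * g z) Real.pi := by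
    refine HasExpTypeAtMost.of_mul_id Real.pi_pos.le hzg.continuous ?_
    have := hf.expType
    rwa [show f = fun z => z * (z * g z) from funext hfg] at this
  have ht0 : HasExpTypeAtMost g Real.pi :=
    HasExpTypeAtMost.of_mul_id Real.pi_pos.le hg.continuous ht1
  have hcg : Continuous fun x : ℝ => g x := hg.continuous.comp Complex.continuous_ofReal
  have hbint : Integrable fun x : ℝ => ‖f x‖ ^ 2 + 2 * (1 + x ^ 2)⁻¹ :=
    hf.integrable_sq.add (integrable_inv_one_add_sq.const_mul 2)
  -- Here |xg| = |f|/|x| is at most |f|² + 1/x² by the arithmetic–geometric mean inequality: square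
  -- integrability of f becomes integrability of xg.
  have hb : ∀ x : ℝ, 1 ≤ |x| → ‖(x : ℂ) * g x‖ ≤ ‖f x‖ ^ 2 + 2 * (1 + x ^ 2)⁻¹ := by
    intro x hx
    have hx2 : 1 ≤ x ^ 2 := (one_le_sq_iff_one_le_abs _).mpr hx
    have hxx : |x| * |x|⁻¹ = 1 := mul_inv_cancel₀ (by linarith)
    have h1 : ‖f x‖ = |x| * ‖(x : ℂ) * g x‖ := by
      rw [hfg, norm_mul, Complex.norm_real, Real.norm_eq_abs]
    have h2 : (|x|⁻¹) ^ 2 ≤ 2 * (1 + x ^ 2)⁻¹ := by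
      rw [inv_pow, sq_abs, ← div_eq_mul_inv, ← one_div, div_le_div_iff₀ (by positivity)
        (by positivity)]
      linarith
    have h3 : ‖(x : ℂ) * g x‖ = |x|⁻¹ * ‖f x‖ := by
      rw [h1, ← mul_assoc, mul_comm |x|⁻¹, hxx, one_mul]
    rw [h3]
    nlinarith [sq_nonneg (|x|⁻¹ - ‖f x‖), sq_nonneg ‖f x‖, sq_nonneg |x|⁻¹]
  have hi1 : Integrable fun x : ℝ => (x : ℂ) * g x :=
    integrable_of_bound_outside (Complex.continuous_ofReal.mul hcg) hbint
      (fun x => by positivity) hb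
  have hi0 : Integrable fun x : ℝ => g x :=
    integrable_of_bound_outside hcg hbint (fun x => by positivity) fun x hx =>
      le_trans (by
        rw [norm_mul, Complex.norm_real, Real.norm_eq_abs]
        exact le_mul_of_one_le_left (norm_nonneg _) hx) (hb x hx)
  obtain ⟨hc1, hc2⟩ := integral_mul_cos_eq_zero Real.pi_pos.le hg ht0 hi0
  obtain ⟨hs1, hs2⟩ := integral_mul_sin_eq_zero Real.pi_pos.le hzg ht1 hi1
  obtain ⟨K, hK, hKb⟩ := exists_norm_extremal_le
  have hgk : Integrable fun x : ℝ => g x * extremal x :=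
    hi0.mul_bdd (c := K) continuous_extremal_ofReal.aestronglyMeasurable
      (Eventually.of_forall fun x => (hKb x).trans (by
        simp only [Complex.ofReal_im, abs_zero, mul_zero, Real.exp_zero, mul_one]
        exact div_le_self hK.le (by linarith [norm_nonneg (x : ℂ)])))
  have e : (fun x : ℝ => ((x : ℂ) ^ 2 - 1 / (2 * Real.pi ^ 2)) * (g x * extremal x)) = fun x : ℝ =>
      (-1 / (2 * Real.pi ^ 2)) * (g x * Complex.cos (Real.pi * x) -
        (robin * Real.pi) * (x * g x * Complex.sin (Real.pi * x))) := by
    funext x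
    have h := extremal_mul x
    rw [robinCos] at h
    have h' : extremal x * ((x : ℂ) ^ 2 - 1 / (2 * Real.pi ^ 2)) =
        (-1 / (2 * Real.pi ^ 2)) * (extremal x * (1 - 2 * Real.pi ^ 2 * x ^ 2)) := by
      field_simp
      ring
    linear_combination g x * h' + (-1 / (2 * Real.pi ^ 2)) * g x * h
  have h2 := integral_sq_mul_weight (g := fun z => g z * extremal z)
    (hg.mul differentiable_extremal)
    (by rw [two_mul]; exact ht0.mul hasExpType_extremal) hgk
    (by
      rw [e]
      exact (hc1.sub (hs1.const_mul _)).const_mul _)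
  rw [e, integral_const_mul, integral_sub hc1 (hs1.const_mul _), integral_const_mul, hc2, hs2] at h2
  simp only [mul_zero, sub_zero] at h2
  rw [← h2]
  refine integral_congr_ae (Eventually.of_forall fun x => ?_)
  simp only [hfg]
  ring

/-! ### Fourier transforms of the triangle and of the Fejér function. -/

/-- The multiplication formula `∫ f̂ g = ∫ f ĝ`. -/
theorem integral_fourier_mul_eq {f g : ℝ → ℂ} (hf : Integrable f) (hg : Integrable g) :
    ∫ x, 𝓕 f x * g x = ∫ x, f x * 𝓕 g x := by
  have := VectorFourier.integral_fourierIntegral_smul_eq_flip (L := innerₗ ℝ)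
    (μ := volume) (ν := volume) Real.continuous_fourierChar continuous_inner hf hg
  rw [flip_innerₗ] at this
  simp only [smul_eq_mul] at this
  exact this

theorem fourier_eq_integral_exp (f : ℝ → ℂ) (y : ℝ) :
    𝓕 f y = ∫ t : ℝ, f t * Complex.exp (((-2 * Real.pi * y : ℝ) : ℂ) * Complex.I * t) := by
  rw [Real.fourier_real_eq_integral_exp_smul]
  refine integral_congr_ae (Eventually.of_forall fun t => ?_)
  simp only [smul_eq_mul]
  rw [mul_comm]
  push_cast
  ring_nf

/-- The triangle function `max (1 - |t|) 0`. -/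
def triangle (t : ℝ) : ℂ := ((max (1 - |t|) 0 : ℝ) : ℂ)

theorem continuous_triangle : Continuous triangle := by
  unfold triangle; fun_prop

theorem triangle_neg (t : ℝ) : triangle (-t) = triangle t := by simp [triangle]

theorem triangle_of_abs_le {t : ℝ} (h : |t| ≤ 1) : triangle t = 1 - ((|t| : ℝ) : ℂ) := by
  rw [triangle, max_eq_left (by linarith)]; push_cast; rfl

theorem triangle_of_one_le {t : ℝ} (h : 1 ≤ |t|) : triangle t = 0 := by
  rw [triangle, max_eq_right (by linarith)]; simp

theorem hasCompactSupport_triangle : HasCompactSupport triangle :=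
  HasCompactSupport.intro (isCompact_Icc (a := (-1 : ℝ)) (b := 1)) fun t ht =>
    triangle_of_one_le (by
      by_contra h
      exact ht (abs_le.mp (not_le.mp h).le))

theorem integrable_triangle : Integrable triangle :=
  continuous_triangle.integrable_of_hasCompactSupport hasCompactSupport_triangle

theorem integral_triangle_mul {g : ℝ → ℂ} (hg : Continuous g) :
    ∫ t, triangle t * g t =
      (∫ t in (-1 : ℝ)..0, (1 + t : ℂ) * g t) + ∫ t in (0 : ℝ)..1, (1 - t : ℂ) * g t := by
  have h1 : ∫ t, triangle t * g t = ∫ t in (-1 : ℝ)..1, triangle t * g t := by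
    rw [intervalIntegral.integral_of_le (by norm_num), setIntegral_eq_integral_of_forall_compl_eq_zero]
    intro t ht
    rw [triangle_of_one_le, zero_mul]
    by_contra h
    obtain ⟨h2, h3⟩ := abs_lt.mp (not_le.mp h)
    exact ht ⟨h2, h3.le⟩
  have hc : Continuous fun t => triangle t * g t := continuous_triangle.mul hg
  rw [h1, ← intervalIntegral.integral_add_adjacent_intervals (b := (0 : ℝ))
    (hc.intervalIntegrable _ _) (hc.intervalIntegrable _ _)]
  congr 1
  · refine intervalIntegral.integral_congr fun t ht => ?_
    rw [uIcc_of_le (by norm_num)] at ht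
    rw [triangle_of_abs_le (abs_le.mpr ⟨ht.1, by linarith [ht.2]⟩), abs_of_nonpos ht.2]
    push_cast; ring
  · refine intervalIntegral.integral_congr fun t ht => ?_
    rw [uIcc_of_le (by norm_num)] at ht
    rw [triangle_of_abs_le (abs_le.mpr ⟨by linarith [ht.1], ht.2⟩), abs_of_nonneg ht.1]

/-- This is what makes multiplication by 1 - `weight` a convolution with the triangle on the Fourier
side. -/
theorem fourier_triangle (x : ℝ) : 𝓕 triangle x = csinc (Real.pi * x) ^ 2 := by
  rw [fourier_eq_integral_exp, integral_triangle_mul (by fun_prop)]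
  rcases eq_or_ne x 0 with rfl | hx
  · have h1 : ∫ t in (-1 : ℝ)..0, (1 + (t : ℂ)) = 1 / 2 := by
      have : (fun t : ℝ => (1 + (t : ℂ))) = fun t : ℝ => ((1 + t : ℝ) : ℂ) := by
        funext t; push_cast; rfl
      rw [this, intervalIntegral.integral_ofReal, intervalIntegral.integral_add (by simp) (by simp)]
      simp; norm_num
    have h2 : ∫ t in (0 : ℝ)..1, (1 - (t : ℂ)) = 1 / 2 := by
      have : (fun t : ℝ => (1 - (t : ℂ))) = fun t : ℝ => ((1 - t : ℝ) : ℂ) := by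
        funext t; push_cast; rfl
      rw [this, intervalIntegral.integral_ofReal, intervalIntegral.integral_sub (by simp) (by simp)]
      simp; norm_num
    simp only [mul_zero, Complex.ofReal_zero, zero_mul, Complex.exp_zero, mul_one]
    rw [h1, h2, csinc_zero]; norm_num
  have hπ : (Real.pi : ℂ) ≠ 0 := by exact_mod_cast Real.pi_ne_zero
  have hx' : (x : ℂ) ≠ 0 := by exact_mod_cast hx
  set c : ℂ := ((-2 * Real.pi * x : ℝ) : ℂ) * Complex.I with hcdef
  have hc : c ≠ 0 := by
    rw [hcdef]; push_cast
    exact mul_ne_zero (mul_ne_zero (mul_ne_zero (by norm_num) hπ) hx') Complex.I_ne_zero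
  have hE : ∀ t : ℝ, HasDerivAt (fun t : ℝ => Complex.exp (c * t)) (Complex.exp (c * t) * c) t := by
    intro t
    have := ((hasDerivAt_id (t : ℂ)).const_mul c).cexp.comp_ofReal
    simpa using this
  have hid : ∀ t : ℝ, HasDerivAt (fun t : ℝ => (t : ℂ)) 1 t := fun t =>
    (hasDerivAt_id (t : ℂ)).comp_ofReal
  have h1 : ∫ t in (-1 : ℝ)..0, (1 + t : ℂ) * Complex.exp (c * t) =
      1 / c - 1 / c ^ 2 + Complex.exp (-c) / c ^ 2 := by
    rw [intervalIntegral.integral_eq_sub_of_hasDerivAt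
      (f := fun t : ℝ => (1 + (t : ℂ)) * Complex.exp (c * t) / c - Complex.exp (c * t) / c ^ 2)]
    · push_cast
      rw [mul_zero, Complex.exp_zero, mul_neg, mul_one]
      field_simp
      ring
    · intro t _
      refine ((((hid t).const_add 1).fun_mul (hE t)).div_const c).fun_sub
        ((hE t).div_const (c ^ 2)) |>.congr_deriv ?_
      field_simp
      ring
    · exact Continuous.intervalIntegrable (by fun_prop) _ _
  have h2 : ∫ t in (0 : ℝ)..1, (1 - t : ℂ) * Complex.exp (c * t) =
      Complex.exp c / c ^ 2 - 1 / c - 1 / c ^ 2 := by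
    rw [intervalIntegral.integral_eq_sub_of_hasDerivAt
      (f := fun t : ℝ => (1 - (t : ℂ)) * Complex.exp (c * t) / c + Complex.exp (c * t) / c ^ 2)]
    · push_cast
      rw [mul_zero, Complex.exp_zero, mul_one]
      field_simp
      ring
    · intro t _
      refine ((((hid t).const_sub 1).fun_mul (hE t)).div_const c).fun_add
        ((hE t).div_const (c ^ 2)) |>.congr_deriv ?_
      field_simp
      ring
    · exact Continuous.intervalIntegrable (by fun_prop) _ _
  rw [h1, h2, csinc_of_ne_zero (mul_ne_zero hπ hx')]
  have hsq : Complex.exp c + Complex.exp (-c) = 2 - 4 * Complex.sin (Real.pi * x) ^ 2 := by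
    have hcos : Complex.cos (2 * (Real.pi * x)) = 1 - 2 * Complex.sin (Real.pi * x) ^ 2 := by
      rw [Complex.cos_two_mul]
      linear_combination 2 * Complex.sin_sq_add_cos_sq ((Real.pi : ℂ) * x)
    have : Complex.exp c + Complex.exp (-c) = 2 * Complex.cos (2 * (Real.pi * x)) := by
      rw [Complex.cos, hcdef]
      push_cast
      ring_nf
    rw [this, hcos]; ring
  have hc2 : c ^ 2 = -(4 * (Real.pi * x) ^ 2) := by
    rw [hcdef]; push_cast; linear_combination 4 * (Real.pi : ℂ) ^ 2 * x ^ 2 * Complex.I_sq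
  have e : 1 / c - 1 / c ^ 2 + Complex.exp (-c) / c ^ 2 +
      (Complex.exp c / c ^ 2 - 1 / c - 1 / c ^ 2) =
      (Complex.exp c + Complex.exp (-c) - 2) / c ^ 2 := by ring
  rw [e, hsq, hc2]
  field_simp
  ring

/-- A narrow triangle, the Fourier transform of `(sin (πx/2) / (πx/2))²`. -/
def narrowTriangle (t : ℝ) : ℂ := 2 * triangle (2 * t)

theorem integrable_narrowTriangle : Integrable narrowTriangle :=
  (integrable_triangle.comp_mul_left' two_ne_zero).const_mul 2

theorem continuous_narrowTriangle : Continuous narrowTriangle :=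
  (continuous_triangle.comp (by fun_prop)).const_mul 2

theorem fourier_narrowTriangle (x : ℝ) :
    𝓕 narrowTriangle x = csinc (Real.pi * (x / 2)) ^ 2 := by
  have h := fourier_triangle (x / 2)
  push_cast at h
  rw [← h, fourier_eq_integral_exp, fourier_eq_integral_exp]
  have := Measure.integral_comp_mul_left (fun t : ℝ => triangle t *
    Complex.exp (((-2 * Real.pi * (x / 2) : ℝ) : ℂ) * Complex.I * t)) 2
  have e : (fun t : ℝ => narrowTriangle t *
      Complex.exp (((-2 * Real.pi * x : ℝ) : ℂ) * Complex.I * t)) = fun t : ℝ => 2 *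
      (triangle (2 * t) *
      Complex.exp (((-2 * Real.pi * (x / 2) : ℝ) : ℂ) * Complex.I * ((2 * t : ℝ) : ℂ))) := by
    funext t
    rw [narrowTriangle]
    push_cast
    ring_nf
  rw [e, integral_const_mul, this, abs_of_pos (by norm_num)]
  rw [Complex.real_smul]
  push_cast
  ring

/-- The test function `(sin (πz/2) / (πz/2))²`. -/
def fejer (z : ℂ) : ℂ := csinc (Real.pi * (z / 2)) ^ 2

theorem exists_fejer_le : ∃ K : ℝ, 0 < K ∧
    ∀ z : ℂ, ‖fejer z‖ ≤ K * Real.exp (Real.pi * |z.im|) / (1 + ‖z‖) ^ 2 := by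
  obtain ⟨K, hK, h⟩ := exists_norm_csinc_le
  refine ⟨K ^ 2, by positivity, fun z => ?_⟩
  have h1 := h (Real.pi * (z / 2))
  have him : |((Real.pi : ℂ) * (z / 2)).im| = Real.pi * |z.im| / 2 := by
    simp [abs_mul, abs_of_pos Real.pi_pos, abs_div]
    ring
  have hn : ‖(Real.pi : ℂ) * (z / 2)‖ = Real.pi * ‖z‖ / 2 := by
    simp [abs_of_pos Real.pi_pos]; ring
  rw [him, hn] at h1
  have h2 : ‖z‖ ≤ Real.pi * ‖z‖ / 2 := by nlinarith [norm_nonneg z, Real.pi_gt_three]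
  rw [fejer, norm_pow]
  calc ‖csinc (Real.pi * (z / 2))‖ ^ 2 ≤ (K * Real.exp (Real.pi * |z.im| / 2) / (1 + ‖z‖)) ^ 2 := by
        gcongr
        refine h1.trans ?_
        gcongr
    _ = K ^ 2 * (Real.exp (Real.pi * |z.im| / 2)) ^ 2 / (1 + ‖z‖) ^ 2 := by rw [div_pow, mul_pow]
    _ = _ := by rw [← Real.exp_nat_mul]; push_cast; ring_nf

theorem differentiable_fejer : Differentiable ℂ fejer := by
  unfold fejer
  exact (differentiable_csinc.comp (by fun_prop)).pow 2

theorem fejer_zero : fejer 0 = 1 := by simp [fejer, csinc_zero]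

theorem fejer_neg (z : ℂ) : fejer (-z) = fejer z := by
  rw [fejer, fejer, ← csinc_neg]; ring_nf

theorem exists_fejer_real_le :
    ∃ K : ℝ, 0 < K ∧ ∀ x : ℝ, ‖fejer x‖ ≤ K ∧ ‖fejer x‖ ≤ K * (1 + x ^ 2)⁻¹ := by
  obtain ⟨K, hK, h⟩ := exists_fejer_le
  refine ⟨K, hK, fun x => ?_⟩
  have h1 := h x
  simp only [Complex.ofReal_im, abs_zero, mul_zero, Real.exp_zero, mul_one, Complex.norm_real,
    Real.norm_eq_abs] at h1
  have h2 := one_add_sq_le (x := x)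
  refine ⟨h1.trans (div_le_self hK.le (by nlinarith [sq_nonneg x])), h1.trans ?_⟩
  rw [div_eq_mul_inv]
  gcongr

theorem continuous_fejer_ofReal : Continuous fun x : ℝ => fejer x :=
  differentiable_fejer.continuous.comp Complex.continuous_ofReal

theorem integrable_fejer : Integrable fun x : ℝ => fejer x := by
  obtain ⟨K, hK, h⟩ := exists_fejer_real_le
  exact (integrable_inv_one_add_sq.const_mul K).mono' continuous_fejer_ofReal.aestronglyMeasurable
    (Eventually.of_forall fun x => (h x).2)

theorem memH_fejer : MemH fejer where
  entire := differentiable_fejer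
  expType := by
    obtain ⟨K, hK, h⟩ := exists_fejer_le
    refine HasExpTypeAtMost.of_le Real.pi_pos.le hK fun z => (h z).trans ?_
    exact div_le_self (by positivity) (one_le_pow₀ (by linarith [norm_nonneg z]))
  sqIntegrable := by
    obtain ⟨K, hK, h⟩ := exists_fejer_real_le
    refine (integrable_inv_one_add_sq.const_mul (K * K)).mono'
      ((continuous_fejer_ofReal.norm.pow 2).mul continuous_weight).aestronglyMeasurable
      (Eventually.of_forall fun x => ?_)
    have hw := weight_nonneg x
    rw [Real.norm_of_nonneg (by positivity)]
    calc ‖fejer x‖ ^ 2 * weight x ≤ ‖fejer x‖ ^ 2 * 1 := by gcongr; exact weight_le_one x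
      _ = ‖fejer x‖ * ‖fejer x‖ := by ring
      _ ≤ K * (K * (1 + x ^ 2)⁻¹) := by
        gcongr
        · exact (h x).1
        · exact (h x).2
      _ = _ := by ring

/-- Fourier inversion for the continuous narrow triangle, followed by evenness. The support in
[-1/2, 1/2] is what matters later. -/
theorem fourier_fejer (t : ℝ) : 𝓕 (fun x : ℝ => fejer x) t = narrowTriangle t := by
  have e : (fun x : ℝ => fejer x) = 𝓕 narrowTriangle := by
    funext x; rw [fourier_narrowTriangle, fejer]
  have h := continuous_narrowTriangle.fourierInv_fourier_eq integrable_narrowTriangle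
    (by rw [← e]; exact integrable_fejer)
  have h2 := congrFun h (-t)
  rw [Real.fourierInv_eq_fourier_neg, neg_neg, ← e] at h2
  rw [h2, narrowTriangle, narrowTriangle, mul_neg, triangle_neg]

/-! ### The pairing of the Fejér function with the extremal function. -/

/-- The constant `2^{-1/2} cot(2^{-1/2}) - 1/2`. -/
def gapConst : ℝ := (√2)⁻¹ * Real.cot (√2)⁻¹ - 1 / 2

theorem gapConst_eq : gapConst =
    (Real.cos theta - theta * Real.sin theta) * (theta / Real.sin theta) := by
  have h := theta_sq
  have hs := sin_theta_pos.ne'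
  rw [gapConst, ← theta, Real.cot_eq_cos_div_sin]
  field_simp
  linear_combination Real.sin theta * 2 * h

/-- The truncated cosine whose Fourier transform is a multiple of the extremal function. -/
def truncCos : ℝ → ℂ :=
  (Ioc (-(1 / 2 : ℝ)) (1 / 2)).indicator fun s => ((Real.cos (2 * theta * s) : ℝ) : ℂ)

theorem integrable_truncCos : Integrable truncCos := by
  refine (integrable_indicator_iff measurableSet_Ioc).mpr ?_
  exact (Continuous.integrableOn_Icc (by fun_prop)).mono_set Ioc_subset_Icc_self

theorem integral_truncCos_mul (g : ℝ → ℂ) : ∫ s, truncCos s * g s =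
    ∫ s in (-(1 / 2) : ℝ)..(1 / 2), ((Real.cos (2 * theta * s) : ℝ) : ℂ) * g s := by
  rw [intervalIntegral.integral_of_le (by norm_num), ← integral_indicator measurableSet_Ioc]
  congr 1
  funext s
  by_cases hs : s ∈ Ioc (-(1 / 2) : ℝ) (1 / 2)
  · simp only [truncCos, indicator_of_mem hs]
  · simp only [truncCos, indicator_of_notMem hs, zero_mul]

theorem integral_exp_symm (y : ℝ) :
    ∫ s in (-(1 / 2) : ℝ)..(1 / 2), Complex.exp (((2 * y : ℝ) : ℂ) * Complex.I * s) = csinc y := by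
  rcases eq_or_ne y 0 with rfl | hy
  · simp [csinc_zero]; norm_num
  · have hy' : (y : ℂ) ≠ 0 := by exact_mod_cast hy
    have hc : ((2 * y : ℝ) : ℂ) * Complex.I ≠ 0 := by
      push_cast
      exact mul_ne_zero (mul_ne_zero two_ne_zero hy') Complex.I_ne_zero
    rw [integral_exp_mul_complex hc, csinc_of_ne_zero hy', Complex.sin]
    push_cast
    have e1 : 2 * (y : ℂ) * Complex.I * (1 / 2) = y * Complex.I := by ring
    have e2 : 2 * (y : ℂ) * Complex.I * (-(1 / 2)) = -y * Complex.I := by ring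
    rw [e1, e2]
    field_simp
    linear_combination (Complex.exp (y * Complex.I) - Complex.exp (-(y * Complex.I))) * Complex.I_sq

/-- Writing the cosine as a half-sum of two exponentials shifts the frequency by ±θ, which yields
the two shifted sincs. -/
theorem fourier_truncCos (x : ℝ) :
    𝓕 truncCos x = ((Real.sin theta / theta : ℝ) : ℂ) * extremal x := by
  rw [fourier_eq_integral_exp, integral_truncCos_mul]
  have e : (fun s : ℝ => ((Real.cos (2 * theta * s) : ℝ) : ℂ) *
      Complex.exp (((-2 * Real.pi * x : ℝ) : ℂ) * Complex.I * s)) = fun s : ℝ =>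
      2⁻¹ * (Complex.exp (((2 * (-(Real.pi * x - theta)) : ℝ) : ℂ) * Complex.I * s) +
        Complex.exp (((2 * (-(Real.pi * x + theta)) : ℝ) : ℂ) * Complex.I * s)) := by
    funext s
    push_cast
    rw [Complex.cos, div_eq_mul_inv, mul_comm _ (2⁻¹ : ℂ), mul_assoc, add_mul,
      ← Complex.exp_add, ← Complex.exp_add]
    ring_nf
  have hi : ∀ c : ℂ, IntervalIntegrable (fun s : ℝ => Complex.exp (c * s)) volume
      (-(1 / 2)) (1 / 2) := fun c => Continuous.intervalIntegrable (by fun_prop) _ _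
  rw [e, intervalIntegral.integral_const_mul, intervalIntegral.integral_add (hi _) (hi _),
    integral_exp_symm, integral_exp_symm, Complex.ofReal_neg, Complex.ofReal_neg,
    csinc_neg, csinc_neg, extremal]
  have h1 : (theta : ℂ) ≠ 0 := by exact_mod_cast theta_pos.ne'
  have h2 : Complex.sin theta ≠ 0 := by
    rw [← Complex.ofReal_sin]; exact_mod_cast sin_theta_pos.ne'
  push_cast
  field_simp
  ring

/-- For u and s in [-1/2, 1/2] the kernel 1 - |u - s| is the triangle, and its second derivative in
u is -2δ. So φ minus its convolution has second derivative φ'' + 2φ, which vanishes for φ(s) =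
cos(2θs) since (2θ)² = 2. Symmetry leaves only a constant; its value comes from explicit primitives
on either side of u. -/
theorem integral_cos_mul_triangle {u : ℝ} (hu : |u| ≤ 1 / 2) :
    ∫ s in (-(1 / 2) : ℝ)..(1 / 2), Real.cos (2 * theta * s) * (1 - |u - s|) =
      Real.cos (2 * theta * u) - (Real.cos theta - theta * Real.sin theta) := by
  obtain ⟨hu1, hu2⟩ := abs_le.mp hu
  have hθ := theta_sq
  have hθ0 := theta_pos.ne'
  have hc : Continuous fun s : ℝ => Real.cos (2 * theta * s) * (1 - |u - s|) := by fun_prop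
  have hS : ∀ s : ℝ, HasDerivAt (fun s : ℝ => Real.sin (2 * theta * s))
      (Real.cos (2 * theta * s) * (2 * theta)) s := fun s => by
    simpa using ((hasDerivAt_id s).const_mul (2 * theta)).sin
  have hC : ∀ s : ℝ, HasDerivAt (fun s : ℝ => Real.cos (2 * theta * s))
      (-Real.sin (2 * theta * s) * (2 * theta)) s := fun s => by
    simpa using ((hasDerivAt_id s).const_mul (2 * theta)).cos
  rw [← intervalIntegral.integral_add_adjacent_intervals (b := u)
    (hc.intervalIntegrable _ _) (hc.intervalIntegrable _ _)]
  have h1 : ∫ s in (-(1 / 2) : ℝ)..u, Real.cos (2 * theta * s) * (1 - |u - s|) =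
      ∫ s in (-(1 / 2) : ℝ)..u, Real.cos (2 * theta * s) * (1 - u + s) := by
    refine intervalIntegral.integral_congr fun s hs => ?_
    rw [uIcc_of_le hu1] at hs
    simp only [abs_of_nonneg (sub_nonneg.mpr hs.2)]
    ring
  have h2 : ∫ s in u..(1 / 2), Real.cos (2 * theta * s) * (1 - |u - s|) =
      ∫ s in u..(1 / 2), Real.cos (2 * theta * s) * (1 + u - s) := by
    refine intervalIntegral.integral_congr fun s hs => ?_
    rw [uIcc_of_le hu2] at hs
    simp only [abs_of_nonpos (sub_nonpos.mpr hs.1)]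
    ring
  have d1 : ∀ s : ℝ, HasDerivAt (fun s : ℝ => theta * ((1 - u + s) * Real.sin (2 * theta * s)) +
      Real.cos (2 * theta * s) / 2) (Real.cos (2 * theta * s) * (1 - u + s)) s := fun s => by
    refine ((((hasDerivAt_id s).const_add (1 - u)).fun_mul (hS s)).const_mul theta).fun_add
      ((hC s).div_const 2) |>.congr_deriv ?_
    simp only [id]
    linear_combination 2 * (1 - u + s) * Real.cos (2 * theta * s) * hθ
  have d2 : ∀ s : ℝ, HasDerivAt (fun s : ℝ => theta * ((1 + u - s) * Real.sin (2 * theta * s)) -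
      Real.cos (2 * theta * s) / 2) (Real.cos (2 * theta * s) * (1 + u - s)) s := fun s => by
    refine ((((hasDerivAt_id s).const_sub (1 + u)).fun_mul (hS s)).const_mul theta).fun_sub
      ((hC s).div_const 2) |>.congr_deriv ?_
    simp only [id]
    linear_combination 2 * (1 + u - s) * Real.cos (2 * theta * s) * hθ
  rw [h1, h2, intervalIntegral.integral_eq_sub_of_hasDerivAt (fun s _ => d1 s)
    (Continuous.intervalIntegrable (by fun_prop) _ _),
    intervalIntegral.integral_eq_sub_of_hasDerivAt (fun s _ => d2 s)
    (Continuous.intervalIntegrable (by fun_prop) _ _)]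
  rw [show 2 * theta * (1 / 2) = theta by ring, show 2 * theta * (-(1 / 2)) = -theta by ring,
    Real.sin_neg, Real.cos_neg]
  ring

open scoped Convolution in
-- By the multiplication formula the integral moves to the Fourier side. There `extremal`·`weight`
-- corresponds to the truncated cosine minus its convolution with the triangle, which equals the
-- constant κ on (-1/2, 1/2); the transform of `fejer` lives there and has total mass 1.
theorem integral_fejer_mul_extremal :
    ∫ x : ℝ, fejer x * extremal x * (weight x : ℂ) = gapConst := by
  set L := ContinuousLinearMap.mul ℂ ℂ
  set q := truncCos ⋆[L] triangle with hq
  have hqi : Integrable q := integrable_truncCos.integrable_convolution L integrable_triangle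
  have hqF : ∀ x, 𝓕 q x = 𝓕 truncCos x * 𝓕 triangle x := fun x =>
    Real.fourier_mul_convolution_eq integrable_truncCos integrable_triangle x
  have hθ0 : ((Real.sin theta / theta : ℝ) : ℂ) ≠ 0 := by
    exact_mod_cast (div_pos sin_theta_pos theta_pos).ne'
  set κ : ℝ := Real.cos theta - theta * Real.sin theta with hκ
  have hqu : ∀ u : ℝ, |u| < 1 / 2 → truncCos u - q u = κ := by
    intro u hu
    obtain ⟨hu1, hu2⟩ := abs_lt.mp hu
    have e1 : truncCos u = ((Real.cos (2 * theta * u) : ℝ) : ℂ) :=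
      indicator_of_mem (show u ∈ Ioc (-(1 / 2) : ℝ) (1 / 2) from ⟨hu1, hu2.le⟩) _
    have e2 : q u = ((∫ s in (-(1 / 2) : ℝ)..(1 / 2),
        Real.cos (2 * theta * s) * (1 - |u - s|) : ℝ) : ℂ) := by
      rw [hq, convolution_def]
      simp only [L, ContinuousLinearMap.mul_apply']
      rw [integral_truncCos_mul, ← intervalIntegral.integral_ofReal]
      refine intervalIntegral.integral_congr fun s hs => ?_
      rw [uIcc_of_le (by norm_num)] at hs
      rw [triangle_of_abs_le (abs_le.mpr ⟨by linarith [hs.2], by linarith [hs.1]⟩)]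
      push_cast
      rfl
    rw [e1, e2, integral_cos_mul_triangle hu.le, hκ]
    push_cast
    ring
  have hflip := integral_fourier_mul_eq integrable_fejer (integrable_truncCos.sub hqi)
  have hL : ∫ x : ℝ, 𝓕 (fun x : ℝ => fejer x) x * (truncCos - q) x = κ := by
    have h1 : (fun x : ℝ => 𝓕 (fun x : ℝ => fejer x) x * (truncCos - q) x) =
        fun x => narrowTriangle x * κ := by
      funext x
      rw [fourier_fejer, Pi.sub_apply]
      rcases lt_or_ge |x| (1 / 2) with hx | hx
      · rw [hqu x hx]
      · rw [narrowTriangle, triangle_of_one_le (by rw [abs_mul, abs_of_pos two_pos]; linarith)]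
        simp
    rw [h1, integral_mul_const]
    have h2 := fourier_narrowTriangle 0
    rw [fourier_eq_integral_exp] at h2
    simp only [mul_zero, Complex.ofReal_zero, zero_mul, Complex.exp_zero, mul_one, zero_div,
      csinc_zero, one_pow] at h2
    rw [h2, one_mul]
  have hR : ∫ x : ℝ, fejer x * 𝓕 (truncCos - q) x =
      ((Real.sin theta / theta : ℝ) : ℂ) * ∫ x : ℝ, fejer x * extremal x * (weight x : ℂ) := by
    rw [← integral_const_mul]
    refine integral_congr_ae (Eventually.of_forall fun x => ?_)
    have h1 : 𝓕 (truncCos - q) x = 𝓕 truncCos x - 𝓕 q x := by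
      have hm : ∀ f : ℝ → ℂ, Integrable f → Integrable fun t : ℝ =>
          f t * Complex.exp (((-2 * Real.pi * x : ℝ) : ℂ) * Complex.I * t) := fun f hf =>
        hf.mul_bdd (c := 1) (Continuous.aestronglyMeasurable (by fun_prop))
          (Eventually.of_forall fun t => by rw [Complex.norm_exp]; simp)
      simp only [fourier_eq_integral_exp, Pi.sub_apply, sub_mul]
      exact integral_sub (hm _ integrable_truncCos) (hm _ hqi)
    simp only
    rw [h1, hqF, fourier_truncCos, fourier_triangle]
    have hw : (weight x : ℂ) = 1 - csinc (Real.pi * x) ^ 2 := by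
      rw [weight, ← Complex.ofReal_mul, csinc_ofReal]
      push_cast; rfl
    rw [hw]
    ring
  rw [hL, hR] at hflip
  have : ((Real.sin theta / theta : ℝ) : ℂ) * ((gapConst : ℝ) : ℂ) = κ := by
    rw [gapConst_eq, ← hκ]
    norm_cast
    have := theta_pos.ne'; have := sin_theta_pos.ne'
    field_simp
  exact mul_left_cancel₀ hθ0 (hflip.symm.trans this.symm)

/-! ### Linear structure of 𝓗 and evaluation at the origin. -/

theorem conj_extremal_ofReal (x : ℝ) : conj (extremal x) = extremal x := by
  rw [← extremal_ofReal_re, Complex.conj_ofReal]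

theorem MemH.add {f g : ℂ → ℂ} (hf : MemH f) (hg : MemH g) : MemH fun z => f z + g z where
  entire := hf.entire.add hg.entire
  expType := hf.expType.add hg.expType
  sqIntegrable := by
    refine ((hf.sqIntegrable.const_mul 2).add (hg.sqIntegrable.const_mul 2)).mono'
      (((hf.continuous_ofReal.add hg.continuous_ofReal).norm.pow 2).mul
        continuous_weight).aestronglyMeasurable (Eventually.of_forall fun x => ?_)
    have hw := weight_nonneg x
    rw [Real.norm_of_nonneg (by positivity), Pi.add_apply]
    have h1 := norm_add_le (f x) (g x)
    have h2 : ‖f x + g x‖ ^ 2 ≤ 2 * ‖f x‖ ^ 2 + 2 * ‖g x‖ ^ 2 := by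
      nlinarith [sq_nonneg (‖f x‖ - ‖g x‖), norm_nonneg (f x + g x)]
    nlinarith

theorem MemH.const_mul {f : ℂ → ℂ} (hf : MemH f) (c : ℂ) : MemH fun z => c * f z where
  entire := hf.entire.const_mul c
  expType := hf.expType.const_mul c
  sqIntegrable := by
    refine (hf.sqIntegrable.const_mul (‖c‖ ^ 2)).congr (Eventually.of_forall fun x => ?_)
    simp only [norm_mul]; ring

theorem MemH.comp_neg {f : ℂ → ℂ} (hf : MemH f) : MemH fun z => f (-z) where
  entire := hf.entire.comp differentiable_neg
  expType := hf.expType.comp_neg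
  sqIntegrable := by
    have := hf.sqIntegrable.comp_neg
    simpa [weight_neg] using this

theorem MemH.integrable_mul {f g : ℂ → ℂ} (hf : MemH f) (hg : MemH g) :
    Integrable fun x : ℝ => f x * conj (g x) * (weight x : ℂ) := by
  refine (hf.sqIntegrable.add hg.sqIntegrable).mono'
    (((hf.continuous_ofReal.mul (Complex.continuous_conj.comp hg.continuous_ofReal)).mul
      (Complex.continuous_ofReal.comp continuous_weight)).aestronglyMeasurable)
    (Eventually.of_forall fun x => ?_)
  have hw := weight_nonneg x
  rw [norm_mul, norm_mul, RCLike.norm_conj, Complex.norm_real, Real.norm_of_nonneg hw, Pi.add_apply]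
  nlinarith [sq_nonneg (‖f x‖ - ‖g x‖), sq_nonneg (‖f x‖ + ‖g x‖)]

theorem MemH.integrable_mul_extremal {f : ℂ → ℂ} (hf : MemH f) :
    Integrable fun x : ℝ => f x * extremal x * (weight x : ℂ) := by
  simpa only [conj_extremal_ofReal] using hf.integrable_mul memH_extremal

/-- The extremal function represents evaluation at the origin, up to the factor `gapConst`. -/
theorem integral_mul_extremal {f : ℂ → ℂ} (hf : MemH f) :
    ∫ x : ℝ, f x * extremal x * (weight x : ℂ) = gapConst * f 0 := by
  -- The integral sees only the even part, since `extremal` and the weight are even. Subtracting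
  -- 2f(0)·`fejer` makes the even function d vanish at 0, hence doubly.
  set d : ℂ → ℂ := fun z => (f z + f (-z)) + (-(2 * f 0)) * fejer z with hd
  have hdH : MemH d := (hf.add hf.comp_neg).add (memH_fejer.const_mul _)
  have hdneg : ∀ z, d (-z) = d z := fun z => by
    simp only [hd, neg_neg, fejer_neg]; ring
  have hd0 : d 0 = 0 := by simp only [hd, neg_zero, fejer_zero]; ring
  obtain ⟨g, hg, hdg⟩ := exists_div_sq_of_even hdH.entire hdneg hd0
  have h0 := integral_mul_extremal_of_double_zero hdH hg hdg
  have hneg : ∫ x : ℝ, f (-x) * extremal x * (weight x : ℂ) =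
      ∫ x : ℝ, f x * extremal x * (weight x : ℂ) := by
    rw [← integral_neg_eq_self]
    refine integral_congr_ae (Eventually.of_forall fun x => ?_)
    simp only [Complex.ofReal_neg, neg_neg, weight_neg, extremal_neg]
  have e : (fun x : ℝ => d x * extremal x * (weight x : ℂ)) = fun x : ℝ =>
      (f x * extremal x * (weight x : ℂ) + f (-x) * extremal x * (weight x : ℂ)) +
        (-(2 * f 0)) * (fejer x * extremal x * (weight x : ℂ)) := by
    funext x; simp only [hd]; ring
  have i1 := hf.integrable_mul_extremal
  have i2 := hf.comp_neg.integrable_mul_extremal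
  have i3 : Integrable fun x : ℝ =>
      f x * extremal x * (weight x : ℂ) + f (-x) * extremal x * (weight x : ℂ) := i1.add i2
  rw [e, integral_add i3 (memH_fejer.integrable_mul_extremal.const_mul _),
    integral_add i1 i2, integral_const_mul, integral_fejer_mul_extremal, hneg] at h0
  linear_combination h0 / 2

/-! ### Functions without frequencies beyond 2π. -/

/-- Integrable functions on the line whose Fourier transform vanishes at frequencies `≥ 2π`. -/
structure FreqVanish (P : ℝ → ℂ) : Prop where
  integrable : Integrable P
  integral_eq_zero : ∀ l : ℝ, 2 * Real.pi ≤ l →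
    ∫ x : ℝ, P x * Complex.exp (Complex.I * l * x) = 0

theorem FreqVanish.of_entire {f : ℂ → ℂ} (hd : Differentiable ℂ f)
    (ht : HasExpTypeAtMost f (2 * Real.pi)) (hint : Integrable fun x : ℝ => f x) :
    FreqVanish fun x : ℝ => f x :=
  ⟨hint, fun l hl => integral_mul_exp_eq_zero (by positivity) (hl.trans (le_abs_self l)) hd ht hint⟩

theorem resolvent_ne_zero {β : ℝ} (hβ : 0 < β) (b x : ℝ) : (β : ℂ) - Complex.I * b * x ≠ 0 := by
  intro h
  have := congrArg Complex.re h
  simp at this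
  linarith

/-- The resolvent 1/(β - ibx) is the integral over s > 0 of e^{-βs}e^{ibsx}, a superposition of
nonnegative frequencies when b ≥ 0. It only raises the frequency l, so the vanishing for all larger
frequencies survives by Fubini. -/
theorem FreqVanish.mul_resolvent {P : ℝ → ℂ} (hP : FreqVanish P) {β b : ℝ} (hβ : 0 < β)
    (hb : 0 ≤ b) : FreqVanish fun x => P x * (1 / (β - Complex.I * b * x)) := by
  have hne := resolvent_ne_zero hβ b
  have hc : Continuous fun x : ℝ => 1 / ((β : ℂ) - Complex.I * b * x) :=
    continuous_const.div (by fun_prop) hne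
  refine ⟨hP.integrable.mul_bdd (c := 1 / β) hc.aestronglyMeasurable
    (Eventually.of_forall fun x => ?_), fun l hl => ?_⟩
  · rw [norm_div, norm_one]
    gcongr
    have := Complex.re_le_norm ((β : ℂ) - Complex.I * b * x)
    simpa using this
  · have hinner : ∀ x : ℝ, 1 / ((β : ℂ) - Complex.I * b * x) =
        ∫ s in Ioi (0 : ℝ), Complex.exp (-((β : ℂ) - Complex.I * b * x) * s) := by
      intro x
      rw [integral_exp_mul_complex_Ioi (by simpa using hβ)]
      simp only [Complex.ofReal_zero, mul_zero, Complex.exp_zero, neg_div_neg_eq]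
    have e1 : ∀ x : ℝ, P x * (1 / ((β : ℂ) - Complex.I * b * x)) * Complex.exp (Complex.I * l * x) =
        ∫ s in Ioi (0 : ℝ), P x * Complex.exp (Complex.I * l * x) *
          Complex.exp (-((β : ℂ) - Complex.I * b * x) * s) := by
      intro x
      rw [integral_const_mul, hinner]
      ring
    simp_rw [e1]
    rw [integral_integral_swap]
    · rw [← integral_zero ℝ ℂ (μ := volume.restrict (Ioi 0))]
      refine setIntegral_congr_fun measurableSet_Ioi fun s hs => ?_
      have hs0 : 0 ≤ s := le_of_lt hs
      have e2 : (fun x : ℝ => P x * Complex.exp (Complex.I * l * x) *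
          Complex.exp (-((β : ℂ) - Complex.I * b * x) * s)) = fun x : ℝ =>
          Complex.exp (-β * s) * (P x * Complex.exp (Complex.I * ((l + b * s : ℝ) : ℂ) * x)) := by
        funext x
        have : Complex.exp (Complex.I * l * x) * Complex.exp (-((β : ℂ) - Complex.I * b * x) * s) =
            Complex.exp (-β * s) * Complex.exp (Complex.I * ((l + b * s : ℝ) : ℂ) * x) := by
          rw [← Complex.exp_add, ← Complex.exp_add]
          congr 1
          push_cast
          ring
        linear_combination P x * this
      simp only [e2]
      rw [integral_const_mul, hP.integral_eq_zero _ (by nlinarith [mul_nonneg hb hs0]), mul_zero]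
    · have h1 : Integrable (fun s : ℝ => ((Real.exp (-β * s) : ℝ) : ℂ))
          (volume.restrict (Ioi 0)) :=
        (integrableOn_exp_mul_Ioi (by linarith) 0).ofReal
      have h2 := hP.integrable.mul_prod h1
      refine (h2.mul_bdd (c := 1)
        (g := fun p : ℝ × ℝ => Complex.exp (Complex.I * ((l + b * p.2 : ℝ) : ℂ) * p.1))
        (Continuous.aestronglyMeasurable (by fun_prop))
        (Eventually.of_forall fun p => by rw [Complex.norm_exp]; simp)).congr
        (Eventually.of_forall fun p => ?_)
      simp only [Function.uncurry]
      have : Complex.exp ((-β * p.2 : ℝ) : ℂ) *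
          Complex.exp (Complex.I * ((l + b * p.2 : ℝ) : ℂ) * p.1) =
          Complex.exp (Complex.I * l * p.1) *
            Complex.exp (-((β : ℂ) - Complex.I * b * p.1) * p.2) := by
        rw [← Complex.exp_add, ← Complex.exp_add]
        congr 1
        push_cast
        ring
      rw [Complex.ofReal_exp]
      linear_combination P p.1 * this

theorem FreqVanish.const_mul {P : ℝ → ℂ} (hP : FreqVanish P) (c : ℂ) :
    FreqVanish fun x => c * P x :=
  ⟨hP.integrable.const_mul c, fun l hl => by
    have e : (fun x : ℝ => c * P x * Complex.exp (Complex.I * l * x)) =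
        fun x : ℝ => c * (P x * Complex.exp (Complex.I * l * x)) := by
      funext x; ring
    rw [e, integral_const_mul, hP.integral_eq_zero l hl, mul_zero]⟩

theorem FreqVanish.add {P Q : ℝ → ℂ} (hP : FreqVanish P) (hQ : FreqVanish Q) :
    FreqVanish fun x => P x + Q x := by
  refine ⟨hP.integrable.add hQ.integrable, fun l hl => ?_⟩
  have h : ∀ P : ℝ → ℂ, Integrable P → Integrable fun x : ℝ =>
      P x * Complex.exp (Complex.I * l * x) := fun P hP =>
    hP.mul_bdd (c := 1) (Continuous.aestronglyMeasurable (by fun_prop))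
      (Eventually.of_forall fun x => by rw [Complex.norm_exp]; simp)
  simp only [add_mul]
  rw [integral_add (h P hP.integrable) (h Q hQ.integrable), hP.integral_eq_zero l hl,
    hQ.integral_eq_zero l hl, add_zero]

theorem FreqVanish.mul_exp {P : ℝ → ℂ} (hP : FreqVanish P) :
    FreqVanish (fun x => P x * Complex.exp (Complex.I * (2 * Real.pi : ℝ) * x)) ∧
      ∫ x, P x * Complex.exp (Complex.I * (2 * Real.pi : ℝ) * x) = 0 := by
  refine ⟨⟨hP.integrable.mul_bdd (c := 1) (Continuous.aestronglyMeasurable (by fun_prop))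
      (Eventually.of_forall fun x => by rw [Complex.norm_exp]; simp), fun l hl => ?_⟩,
    hP.integral_eq_zero _ le_rfl⟩
  have := hP.integral_eq_zero (2 * Real.pi + l) (by linarith [Real.pi_pos])
  rw [← this]
  refine integral_congr_ae (Eventually.of_forall fun x => ?_)
  simp only
  rw [mul_assoc, ← Complex.exp_add]
  push_cast
  ring_nf

/-! ### The inner function attached to the nodes. -/

/-- Numerator of the inner function `innerFun`. -/
def outerU (z : ℂ) : ℂ :=
  Complex.exp (Complex.I * (Real.pi * z)) * (1 + Complex.I * robin * (Real.pi * z))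

/-- Denominator of the inner function `innerFun`. -/
def outerV (z : ℂ) : ℂ :=
  Complex.exp (-(Complex.I * (Real.pi * z))) * (1 - Complex.I * robin * (Real.pi * z))

/-- This ties the zeros of `robinCos` to the points where U/V = -1. -/
theorem outerU_add_outerV (z : ℂ) : outerU z + outerV z = 2 * robinCos z := by
  rw [outerU, outerV, robinCos, Complex.cos, Complex.sin]
  ring_nf

theorem normSq_outerU (x y : ℝ) : ‖outerU (x + y * Complex.I)‖ ^ 2 =
    Real.exp (-(2 * Real.pi * y)) *
      ((1 - robin * Real.pi * y) ^ 2 + (robin * Real.pi * x) ^ 2) := by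
  rw [outerU, norm_mul, mul_pow, Complex.norm_exp, ← Real.exp_nat_mul, Complex.sq_norm,
    Complex.normSq_apply]
  congr 1
  · simp; ring
  · simp; ring

theorem normSq_outerV (x y : ℝ) : ‖outerV (x + y * Complex.I)‖ ^ 2 =
    Real.exp (2 * Real.pi * y) *
      ((1 + robin * Real.pi * y) ^ 2 + (robin * Real.pi * x) ^ 2) := by
  rw [outerV, norm_mul, mul_pow, Complex.norm_exp, ← Real.exp_nat_mul, Complex.sq_norm,
    Complex.normSq_apply]
  congr 1
  · simp; ring_nf
  · simp; ring

/-- A quantitative Hermite–Biehler inequality. Both polynomial factors may be compared with the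
larger one, which is at least 1, and the exponentials contribute 2 sinh(2πy) ≥ 4πy. -/
theorem normSq_outerV_sub_ge (x : ℝ) {y : ℝ} (hy : 0 ≤ y) :
    4 * Real.pi * y ≤ ‖outerV (x + y * Complex.I)‖ ^ 2 - ‖outerU (x + y * Complex.I)‖ ^ 2 := by
  rw [normSq_outerU, normSq_outerV]
  have hb : 0 ≤ robin * Real.pi * y := by have := robin_pos; positivity
  have h1 := Real.add_one_le_exp (2 * Real.pi * y)
  have h2 := Real.one_sub_le_exp_neg (2 * Real.pi * y)
  have hE : Real.exp (-(2 * Real.pi * y)) ≤ 1 := Real.exp_le_one_iff.mpr (by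
    have := Real.pi_pos; nlinarith [mul_nonneg this.le hy])
  have h3 : Real.exp (2 * Real.pi * y) * Real.exp (-(2 * Real.pi * y)) = 1 := by
    rw [← Real.exp_add]; simp
  have hpos := Real.exp_pos (-(2 * Real.pi * y))
  have hyp : 0 ≤ 2 * Real.pi * y := by positivity
  set E := Real.exp (2 * Real.pi * y)
  set F := Real.exp (-(2 * Real.pi * y))
  set t := 2 * Real.pi * y
  have hEF : 2 * t ≤ E - F := by
    have hsinh : t ≤ Real.sinh t := Real.self_le_sinh_iff.mpr hyp
    rw [Real.sinh_eq] at hsinh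
    linarith
  set N := (1 + robin * Real.pi * y) ^ 2 + (robin * Real.pi * x) ^ 2 with hN
  have hN1 : 1 ≤ N := by nlinarith [sq_nonneg (robin * Real.pi * x)]
  have hM : F * ((1 - robin * Real.pi * y) ^ 2 + (robin * Real.pi * x) ^ 2) ≤ F * N := by
    gcongr
    nlinarith
  have : 2 * t * 1 ≤ (E - F) * N := mul_le_mul hEF hN1 zero_le_one (by linarith)
  simp only [t] at this ⊢
  nlinarith

theorem exists_normSq_outerV_sub_le : ∃ K : ℝ, 0 < K ∧ ∀ x y : ℝ, 0 ≤ y → y ≤ 1 →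
    ‖outerV (x + y * Complex.I)‖ ^ 2 - ‖outerU (x + y * Complex.I)‖ ^ 2 ≤ K * y * (1 + x ^ 2) := by
  have hr := robin_pos
  have hπ := Real.pi_pos
  set b := robin * Real.pi with hb
  have hb0 : 0 < b := by positivity
  set Q := Real.exp (2 * Real.pi) with hQ
  have hQ1 : 1 ≤ Q := Real.one_le_exp (by positivity)
  refine ⟨4 * Real.pi * Q * (b ^ 2 + 1) + 4 * b * Q, by positivity, fun x y hy hy1 => ?_⟩
  rw [normSq_outerU, normSq_outerV, ← hb]
  have hty : 0 ≤ 2 * Real.pi * y := by positivity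
  have hE : Real.exp (2 * Real.pi * y) ≤ Q := Real.exp_le_exp.mpr (by nlinarith)
  have hF : Real.exp (-(2 * Real.pi * y)) ≤ Q :=
    (Real.exp_le_one_iff.mpr (by linarith)).trans hQ1
  have h2 := Real.one_sub_le_exp_neg (2 * Real.pi * y)
  have h3 : Real.exp (2 * Real.pi * y) * Real.exp (-(2 * Real.pi * y)) = 1 := by
    rw [← Real.exp_add]; simp
  have hE0 := Real.exp_pos (2 * Real.pi * y)
  set E := Real.exp (2 * Real.pi * y)
  set F := Real.exp (-(2 * Real.pi * y))
  have hE1 : E - 1 ≤ 2 * Real.pi * y * Q := by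
    have : E * (1 - 2 * Real.pi * y) ≤ 1 := by
      calc E * (1 - 2 * Real.pi * y) ≤ E * F := by gcongr
        _ = 1 := h3
    nlinarith
  have hF1 : 1 - F ≤ 2 * Real.pi * y * Q := by nlinarith
  have hEF : E - F ≤ 4 * Real.pi * Q * y := by linarith
  have e : E * ((1 + b * y) ^ 2 + (b * x) ^ 2) - F * ((1 - b * y) ^ 2 + (b * x) ^ 2) =
      (E - F) * (1 + b ^ 2 * y ^ 2 + b ^ 2 * x ^ 2) + 2 * b * y * (E + F) := by ring
  rw [e]
  have hy2 : y ^ 2 ≤ 1 := by nlinarith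
  have hx2 : 0 ≤ x ^ 2 := sq_nonneg x
  have h4 : (E - F) * (1 + b ^ 2 * y ^ 2 + b ^ 2 * x ^ 2) ≤
      (4 * Real.pi * Q * y) * ((b ^ 2 + 1) * (1 + x ^ 2)) := by
    apply mul_le_mul hEF _ (by positivity) (by positivity)
    nlinarith [mul_nonneg (sq_nonneg b) (sub_nonneg.mpr hy2)]
  have h5 : 2 * b * y * (E + F) ≤ (2 * b * y * (2 * Q)) * (1 + x ^ 2) := by
    have h6 : 2 * b * y * (E + F) ≤ 2 * b * y * (2 * Q) := by gcongr; linarith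
    have h7 : 0 ≤ 2 * b * y * (2 * Q) := by positivity
    nlinarith
  linarith

theorem norm_outerU_lt (x : ℝ) {y : ℝ} (hy : 0 < y) :
    ‖outerU (x + y * Complex.I)‖ < ‖outerV (x + y * Complex.I)‖ := by
  have h := normSq_outerV_sub_ge x hy.le
  have : 0 < 4 * Real.pi * y := by have := Real.pi_pos; positivity
  exact lt_of_pow_lt_pow_left₀ 2 (norm_nonneg _) (by linarith)

theorem outerV_ne_zero (x : ℝ) {y : ℝ} (hy : 0 < y) : outerV (x + y * Complex.I) ≠ 0 := by
  have := (norm_nonneg _).trans_lt (norm_outerU_lt x hy)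
  exact norm_pos_iff.mp this

/-- The inner function `e^{2πiz} (1 + iaπz) / (1 - iaπz)` of the upper half-plane. -/
def innerFun (z : ℂ) : ℂ := outerU z / outerV z

theorem norm_innerFun_le (x : ℝ) {y : ℝ} (hy : 0 < y) :
    ‖innerFun (x + y * Complex.I)‖ ≤ Real.exp (-(2 * Real.pi * y)) := by
  rw [innerFun, norm_div, div_le_iff₀ (norm_pos_iff.mpr (outerV_ne_zero x hy))]
  refine le_of_sq_le_sq ?_ (by positivity)
  rw [mul_pow, normSq_outerU, normSq_outerV, ← mul_assoc, ← Real.exp_nat_mul, ← Real.exp_add]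
  have hb : 0 ≤ robin * Real.pi * y := by have := robin_pos; positivity
  have : ((2 : ℕ) : ℝ) * -(2 * Real.pi * y) + 2 * Real.pi * y = -(2 * Real.pi * y) := by
    push_cast; ring
  rw [this]
  refine mul_le_mul_of_nonneg_left ?_ (Real.exp_pos _).le
  nlinarith

theorem norm_innerFun_lt_one (x : ℝ) {y : ℝ} (hy : 0 < y) :
    ‖innerFun (x + y * Complex.I)‖ < 1 :=
  (norm_innerFun_le x hy).trans_lt (Real.exp_lt_one_iff.mpr (by
    have := mul_pos Real.pi_pos hy; linarith))

/-- On a horizontal line B is a constant times e^{2πix} times an affine function of a resolvent, and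
each factor preserves `FreqVanish`. The affine form arises because the numerator of B is 2 minus its
denominator. -/
theorem innerFun_eq (x : ℝ) {y : ℝ} (hy : 0 < y) : innerFun (x + y * Complex.I) =
    (Real.exp (-(2 * Real.pi * y)) : ℝ) * (Complex.exp (Complex.I * (2 * Real.pi : ℝ) * x) *
      (-1 + 2 * (1 / (((1 + robin * Real.pi * y : ℝ) : ℂ) -
        Complex.I * ((robin * Real.pi : ℝ) : ℂ) * x)))) := by
  have hr := robin_pos
  have hπ := Real.pi_pos
  have hne := resolvent_ne_zero (β := 1 + robin * Real.pi * y) (by positivity) (robin * Real.pi) x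
  have e1 : (1 : ℂ) - Complex.I * robin * (Real.pi * (x + y * Complex.I)) =
      ((1 + robin * Real.pi * y : ℝ) : ℂ) - Complex.I * ((robin * Real.pi : ℝ) : ℂ) * x := by
    push_cast
    linear_combination -(robin : ℂ) * Real.pi * y * Complex.I_sq
  have e2 : (1 : ℂ) + Complex.I * robin * (Real.pi * (x + y * Complex.I)) =
      2 - (((1 + robin * Real.pi * y : ℝ) : ℂ) - Complex.I * ((robin * Real.pi : ℝ) : ℂ) * x) := by
    rw [← e1]; ring
  have e3 : Complex.exp (Complex.I * (Real.pi * (x + y * Complex.I))) /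
      Complex.exp (-(Complex.I * (Real.pi * (x + y * Complex.I)))) =
      (Real.exp (-(2 * Real.pi * y)) : ℝ) * Complex.exp (Complex.I * (2 * Real.pi : ℝ) * x) := by
    rw [← Complex.exp_sub, Complex.ofReal_exp, ← Complex.exp_add]
    congr 1
    push_cast
    linear_combination 2 * Real.pi * y * Complex.I_sq
  rw [innerFun, outerU, outerV, mul_div_mul_comm, e3, e1, e2]
  generalize ((1 + robin * Real.pi * y : ℝ) : ℂ) - Complex.I * ((robin * Real.pi : ℝ) : ℂ) * x = D
    at hne
  rw [sub_div, div_self hne]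
  ring

theorem FreqVanish.mul_innerFun {P : ℝ → ℂ} (hP : FreqVanish P) {y : ℝ} (hy : 0 < y) :
    FreqVanish (fun x => P x * innerFun (x + y * Complex.I)) ∧
      ∫ x, P x * innerFun (x + y * Complex.I) = 0 := by
  have hr := robin_pos
  have hπ := Real.pi_pos
  have h1 := (((hP.mul_resolvent (β := 1 + robin * Real.pi * y) (by positivity)
    (mul_pos hr hπ).le).const_mul 2).add (hP.const_mul (-1))).const_mul
      (Real.exp (-(2 * Real.pi * y)) : ℝ)
  obtain ⟨h2, h3⟩ := h1.mul_exp
  have e : (fun x : ℝ => P x * innerFun (x + y * Complex.I)) = fun x : ℝ =>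
      ((Real.exp (-(2 * Real.pi * y)) : ℝ) : ℂ) * (2 * (P x *
        (1 / (((1 + robin * Real.pi * y : ℝ) : ℂ) - Complex.I * ((robin * Real.pi : ℝ) : ℂ) * x)))
        + -1 * P x) * Complex.exp (Complex.I * (2 * Real.pi : ℝ) * x) := by
    funext x
    rw [innerFun_eq x hy]
    ring
  rw [e]
  exact ⟨h2, h3⟩

theorem FreqVanish.mul_innerFun_pow {P : ℝ → ℂ} (hP : FreqVanish P) {y : ℝ} (hy : 0 < y) (n : ℕ) :
    FreqVanish (fun x => P x * innerFun (x + y * Complex.I) ^ n) ∧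
      ∫ x, P x * innerFun (x + y * Complex.I) ^ (n + 1) = 0 := by
  have h : FreqVanish (fun x => P x * innerFun (x + y * Complex.I) ^ n) := by
    induction n with
    | zero => simpa using hP
    | succ n ih =>
      have := (ih.mul_innerFun hy).1
      simpa only [mul_assoc, ← pow_succ] using this
  refine ⟨h, ?_⟩
  have := (h.mul_innerFun hy).2
  simpa only [mul_assoc, ← pow_succ] using this

/-- Expand B/(1 + B) in powers of B. Each power integrates to zero against P, and |B| ≤ e^{-2πy} < 1
makes the series summable in L¹. -/
theorem FreqVanish.integral_geometric {P : ℝ → ℂ} (hP : FreqVanish P) {y : ℝ} (hy : 0 < y) :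
    ∫ x, P x * (innerFun (x + y * Complex.I) / (1 + innerFun (x + y * Complex.I))) = 0 := by
  set B : ℝ → ℂ := fun x => innerFun (x + y * Complex.I) with hB
  set q := Real.exp (-(2 * Real.pi * y)) with hq
  have hq1 : q < 1 := Real.exp_lt_one_iff.mpr (by have := mul_pos Real.pi_pos hy; linarith)
  have hq0 : 0 < q := Real.exp_pos _
  have hpow := fun n => hP.mul_innerFun_pow hy n
  have hF : ∀ n : ℕ, Integrable fun x => (-1) ^ n * (P x * B x ^ (n + 1)) := fun n =>
    ((hpow (n + 1)).1.integrable).const_mul _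
  have hsum : Summable fun n : ℕ => ∫ x, ‖(-1) ^ n * (P x * B x ^ (n + 1))‖ := by
    refine Summable.of_nonneg_of_le (fun n => integral_nonneg fun x => norm_nonneg _)
      (fun n => ?_) ((summable_geometric_of_lt_one hq0.le hq1).mul_right (∫ x, ‖P x‖))
    rw [← integral_const_mul]
    refine integral_mono (hF n).norm (hP.integrable.norm.const_mul _) fun x => ?_
    simp only [norm_mul, norm_pow, norm_neg, norm_one, one_pow, one_mul]
    rw [mul_comm]
    gcongr
    calc ‖B x‖ ^ (n + 1) ≤ q ^ (n + 1) := by gcongr; exact norm_innerFun_le x hy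
      _ ≤ q ^ n := pow_le_pow_of_le_one hq0.le hq1.le (Nat.le_succ n)
  have h := hasSum_integral_of_summable_integral_norm hF hsum
  have hz : ∀ n : ℕ, ∫ x, (-1) ^ n * (P x * B x ^ (n + 1)) = 0 := fun n => by
    rw [integral_const_mul, (hpow n).2, mul_zero]
  simp only [hz] at h
  have h0 := h.unique hasSum_zero
  rw [← h0]
  refine integral_congr_ae (Eventually.of_forall fun x => ?_)
  simp only
  have hlt : ‖-(B x)‖ < 1 := by rw [norm_neg]; exact norm_innerFun_lt_one x hy
  have e : ∀ n : ℕ, (-1) ^ n * (P x * B x ^ (n + 1)) = (P x * B x) * (-(B x)) ^ n := fun n => by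
    rw [neg_pow]; ring
  simp only [e]
  rw [tsum_mul_left, tsum_geometric_of_norm_lt_one hlt, sub_neg_eq_add, div_eq_mul_inv, mul_assoc]

/-! ### The positive kernels concentrating at the nodes. -/

/-- The positive kernel `Re (1 - B) / (1 + B)` on the line `Im z = y`, with `B` the inner function;
as `y → 0` it concentrates on the zeros of `robinCos`. -/
def nodeKernel (y x : ℝ) : ℝ :=
  ((1 - innerFun (x + y * Complex.I)) / (1 + innerFun (x + y * Complex.I))).re

theorem one_add_innerFun_ne_zero (x : ℝ) {y : ℝ} (hy : 0 < y) :
    1 + innerFun (x + y * Complex.I) ≠ 0 := by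
  intro h
  have h1 : innerFun (x + y * Complex.I) = -1 := by linear_combination h
  have := norm_innerFun_lt_one x hy
  rw [h1] at this
  simp at this

theorem continuous_innerFun_line {y : ℝ} (hy : 0 < y) :
    Continuous fun x : ℝ => innerFun (x + y * Complex.I) := by
  unfold innerFun
  refine Continuous.div ?_ ?_ fun x => outerV_ne_zero x hy
  · unfold outerU; fun_prop
  · unfold outerV; fun_prop

theorem continuous_nodeKernel {y : ℝ} (hy : 0 < y) : Continuous (nodeKernel y) := by
  unfold nodeKernel
  refine Complex.continuous_re.comp (Continuous.div ?_ ?_ fun x => one_add_innerFun_ne_zero x hy)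
  · exact continuous_const.sub (continuous_innerFun_line hy)
  · exact continuous_const.add (continuous_innerFun_line hy)

/-- In this form positivity is the Hermite–Biehler inequality. The numerator is of order y for
bounded x, so mass can survive as y → 0 only near zeros of `robinCos`. -/
theorem nodeKernel_eq (x : ℝ) {y : ℝ} (hy : 0 < y) : nodeKernel y x =
    (‖outerV (x + y * Complex.I)‖ ^ 2 - ‖outerU (x + y * Complex.I)‖ ^ 2) /
      (4 * ‖robinCos (x + y * Complex.I)‖ ^ 2) := by
  have hV := outerV_ne_zero x hy
  have hUV := outerU_add_outerV (x + y * Complex.I)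
  have h1 : (1 - innerFun (x + y * Complex.I)) / (1 + innerFun (x + y * Complex.I)) =
      (outerV (x + y * Complex.I) - outerU (x + y * Complex.I)) /
        (2 * robinCos (x + y * Complex.I)) := by
    rw [← hUV, innerFun, one_sub_div hV, one_add_div hV, div_div_div_cancel_right₀ hV,
      add_comm (outerU _)]
  rw [nodeKernel, h1, ← hUV]
  set U := outerU (x + y * Complex.I)
  set V := outerV (x + y * Complex.I)
  have h4 : 4 * ‖robinCos (x + y * Complex.I)‖ ^ 2 = ‖U + V‖ ^ 2 := by
    rw [hUV, norm_mul, mul_pow]; norm_num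
  rw [h4, Complex.div_re, Complex.sq_norm, Complex.sq_norm, Complex.sq_norm, ← add_div]
  congr 1
  simp [Complex.normSq_apply]
  ring

theorem robinCos_ne_zero (x : ℝ) {y : ℝ} (hy : 0 < y) : robinCos (x + y * Complex.I) ≠ 0 := by
  intro h
  have hUV := outerU_add_outerV (x + y * Complex.I)
  rw [h, mul_zero] at hUV
  have := norm_outerU_lt x hy
  rw [eq_neg_of_add_eq_zero_left hUV, norm_neg] at this
  exact lt_irrefl _ this

theorem nodeKernel_ge (x : ℝ) {y : ℝ} (hy : 0 < y) :
    Real.pi * y / ‖robinCos (x + y * Complex.I)‖ ^ 2 ≤ nodeKernel y x := by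
  have hC := norm_pos_iff.mpr (robinCos_ne_zero x hy)
  rw [nodeKernel_eq x hy, div_le_div_iff₀ (by positivity) (by positivity)]
  nlinarith [normSq_outerV_sub_ge x hy.le, mul_le_mul_of_nonneg_right (normSq_outerV_sub_ge x hy.le)
    (sq_nonneg ‖robinCos (x + y * Complex.I)‖)]

theorem nodeKernel_nonneg (x : ℝ) {y : ℝ} (hy : 0 < y) : 0 ≤ nodeKernel y x :=
  le_trans (by have := Real.pi_pos; positivity) (nodeKernel_ge x hy)

theorem exists_nodeKernel_mul_le : ∃ K : ℝ, 0 < K ∧ ∀ x y : ℝ, 0 < y → y ≤ 1 →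
    ‖robinCos (x + y * Complex.I)‖ ^ 2 * nodeKernel y x ≤ K * y * (1 + x ^ 2) := by
  obtain ⟨K, hK, h⟩ := exists_normSq_outerV_sub_le
  refine ⟨K, hK, fun x y hy hy1 => ?_⟩
  have hC := norm_pos_iff.mpr (robinCos_ne_zero x hy)
  have h1 := h x y hy.le hy1
  have h2 := normSq_outerV_sub_ge x hy.le
  have h3 : 0 ≤ 4 * Real.pi * y := by have := Real.pi_pos; positivity
  rw [nodeKernel_eq x hy]
  have : ‖robinCos (x + y * Complex.I)‖ ^ 2 *
      ((‖outerV (x + y * Complex.I)‖ ^ 2 - ‖outerU (x + y * Complex.I)‖ ^ 2) /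
        (4 * ‖robinCos (x + y * Complex.I)‖ ^ 2)) =
      (‖outerV (x + y * Complex.I)‖ ^ 2 - ‖outerU (x + y * Complex.I)‖ ^ 2) / 4 := by
    field_simp
  rw [this]
  linarith

theorem exists_nodeKernel_le : ∃ K : ℝ, 0 < K ∧ ∀ x y : ℝ, 0 < y → y ≤ 1 →
    nodeKernel y x ≤ K / y := by
  have hπ := Real.pi_pos
  refine ⟨2 * (1 + 2 * Real.pi) / (2 * Real.pi), by positivity, fun x y hy hy1 => ?_⟩
  set B := innerFun (x + y * Complex.I) with hB
  have hBq := norm_innerFun_le x hy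
  have ht : 0 < 2 * Real.pi * y := by positivity
  -- From e^{-t} ≤ 1/(1+t) = 1 - t/(1+t) and t = 2πy ≤ 2π. It keeps |1 + B| above a multiple of y.
  have hq : Real.exp (-(2 * Real.pi * y)) ≤ 1 - 2 * Real.pi * y / (1 + 2 * Real.pi) := by
    have h1 := Real.add_one_le_exp (2 * Real.pi * y)
    have h2 : Real.exp (-(2 * Real.pi * y)) ≤ 1 / (1 + 2 * Real.pi * y) := by
      rw [Real.exp_neg, ← one_div]
      gcongr
      linarith
    refine h2.trans ?_
    rw [div_le_iff₀ (by positivity)]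
    have : 2 * Real.pi * y / (1 + 2 * Real.pi) * (1 + 2 * Real.pi * y) ≤ 2 * Real.pi * y := by
      rw [div_mul_eq_mul_div, div_le_iff₀ (by positivity)]
      refine mul_le_mul_of_nonneg_left ?_ ht.le
      nlinarith
    nlinarith
  have hd : 2 * Real.pi * y / (1 + 2 * Real.pi) ≤ ‖1 + B‖ := by
    have := norm_sub_norm_le (1 : ℂ) (-B)
    rw [norm_neg, sub_neg_eq_add, norm_one] at this
    linarith
  have hn : ‖1 - B‖ ≤ 2 := by
    have := norm_sub_le (1 : ℂ) B
    rw [norm_one] at this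
    linarith [norm_innerFun_lt_one x hy]
  calc nodeKernel y x ≤ ‖(1 - B) / (1 + B)‖ := Complex.re_le_norm _
    _ = ‖1 - B‖ / ‖1 + B‖ := norm_div _ _
    _ ≤ 2 / (2 * Real.pi * y / (1 + 2 * Real.pi)) := by gcongr
    _ = _ := by field_simp

/-- The kernels reproduce the integral of functions of type `2π`. -/
theorem integral_mul_nodeKernel {p : ℝ → ℝ} (hP : FreqVanish fun x => (p x : ℂ)) {y : ℝ}
    (hy : 0 < y) (hy1 : y ≤ 1) :
    Integrable (fun x => p x * nodeKernel y x) ∧ ∫ x, p x * nodeKernel y x = ∫ x, p x := by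
  have hpi : Integrable p := hP.integrable.re
  constructor
  · obtain ⟨K, hK, h⟩ := exists_nodeKernel_le
    refine hpi.mul_bdd (c := K / y) (continuous_nodeKernel hy).aestronglyMeasurable
      (Eventually.of_forall fun x => ?_)
    rw [Real.norm_of_nonneg (nodeKernel_nonneg x hy)]
    exact h x y hy hy1
  · have h0 := hP.integral_geometric hy
    set B : ℝ → ℂ := fun x => innerFun (x + y * Complex.I) with hB
    have hBi : Integrable fun x : ℝ => (p x : ℂ) * (B x / (1 + B x)) := by
      obtain ⟨q, hq⟩ : ∃ q, q = Real.exp (-(2 * Real.pi * y)) := ⟨_, rfl⟩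
      have hq1 : q < 1 := by
        rw [hq]; exact Real.exp_lt_one_iff.mpr (by have := mul_pos Real.pi_pos hy; linarith)
      refine hP.integrable.mul_bdd (c := 1 / (1 - q)) (Continuous.aestronglyMeasurable
        ((continuous_innerFun_line hy).div (continuous_const.add (continuous_innerFun_line hy))
          fun x => one_add_innerFun_ne_zero x hy)) (Eventually.of_forall fun x => ?_)
      rw [norm_div]
      have h1 : ‖B x‖ ≤ q := by rw [hq]; exact norm_innerFun_le x hy
      have h2 : 1 - q ≤ ‖1 + B x‖ := by
        have := norm_sub_norm_le (1 : ℂ) (-(B x))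
        rw [norm_neg, sub_neg_eq_add, norm_one] at this
        linarith
      have : 0 < 1 - q := by linarith
      gcongr
      linarith
    -- The identity (1-B)/(1+B) = 1 - 2B/(1+B) separates the plain integral of p from the part
    -- killed by the geometric series.
    have e : (fun x => p x * nodeKernel y x) =
        fun x => ((p x : ℂ) - 2 * ((p x : ℂ) * (B x / (1 + B x)))).re := by
      funext x
      have hne : 1 + B x ≠ 0 := one_add_innerFun_ne_zero x hy
      have : (p x : ℂ) - 2 * ((p x : ℂ) * (B x / (1 + B x))) =
          (p x : ℂ) * ((1 - B x) / (1 + B x)) := by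
        field_simp
        ring
      rw [this, Complex.re_ofReal_mul]
      rfl
    have hre : ∀ f : ℝ → ℂ, Integrable f → ∫ x, (f x).re = (∫ x, f x).re := fun f hf =>
      integral_re hf
    have hi : Integrable fun x : ℝ => (p x : ℂ) - 2 * ((p x : ℂ) * (B x / (1 + B x))) :=
      hP.integrable.sub (hBi.const_mul 2)
    rw [e, hre _ hi,
      integral_sub hP.integrable (hBi.const_mul 2), integral_const_mul, h0, mul_zero, sub_zero]
    exact (hre _ hP.integrable).symm.trans (by simp)

theorem hasDerivAt_robinCos (z : ℂ) : HasDerivAt robinCos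
    (-(Real.pi * ((1 + robin) * Complex.sin (Real.pi * z) +
      robin * (Real.pi * z) * Complex.cos (Real.pi * z)))) z := by
  have h0 : HasDerivAt (fun z : ℂ => (Real.pi : ℂ) * z) Real.pi z := by
    simpa using (hasDerivAt_id z).const_mul (Real.pi : ℂ)
  refine (h0.ccos.fun_sub ((h0.const_mul (robin : ℂ)).fun_mul h0.csin)).congr_deriv ?_
  ring

theorem exists_robinCos_sub_le : ∃ K : ℝ, 0 < K ∧ ∀ x y : ℝ, 0 ≤ y → y ≤ 1 →
    ‖robinCos (x + y * Complex.I) - robinCos x‖ ≤ K * y * (1 + |x|) := by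
  have hr := robin_pos
  have hπ := Real.pi_pos
  set Q := Real.exp Real.pi with hQ
  refine ⟨Real.pi * ((1 + robin) * Q + robin * (Real.pi * 1) * Q), by positivity,
    fun x y hy hy1 => ?_⟩
  have hd : ∀ t ∈ Icc (0 : ℝ) y, HasDerivWithinAt (fun t : ℝ => robinCos (x + t * Complex.I))
      (-(Real.pi * ((1 + robin) * Complex.sin (Real.pi * (x + t * Complex.I)) +
      robin * (Real.pi * (x + t * Complex.I)) * Complex.cos (Real.pi * (x + t * Complex.I)))) *
        Complex.I) (Icc 0 y) t := by
    intro t _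
    have h1 : HasDerivAt (fun t : ℂ => (x : ℂ) + t * Complex.I) Complex.I (t : ℂ) := by
      simpa using ((hasDerivAt_id (t : ℂ)).mul_const Complex.I).const_add (x : ℂ)
    exact ((hasDerivAt_robinCos _).comp (t : ℂ) h1).comp_ofReal.hasDerivWithinAt
  have := norm_image_sub_le_of_norm_deriv_le_segment' hd
    (C := Real.pi * ((1 + robin) * Q + robin * (Real.pi * 1) * Q) * (1 + |x|)) ?_ y ⟨hy, le_rfl⟩
  · simp only [Complex.ofReal_zero, zero_mul, add_zero, sub_zero] at this
    linarith
  · intro t ht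
    have him : |((Real.pi : ℂ) * (x + t * Complex.I)).im| ≤ Real.pi := by
      have him0 : ((x : ℂ) + t * Complex.I).im = t := by simp
      rw [Complex.im_ofReal_mul, him0]
      rw [abs_mul, abs_of_pos hπ, abs_of_nonneg ht.1]
      have := ht.2
      nlinarith
    have hs := (norm_sin_le ((Real.pi : ℂ) * (x + t * Complex.I))).trans (Real.exp_le_exp.mpr him)
    have hc := (norm_cos_le ((Real.pi : ℂ) * (x + t * Complex.I))).trans (Real.exp_le_exp.mpr him)
    have hz : ‖(x : ℂ) + t * Complex.I‖ ≤ 1 + |x| := by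
      refine (norm_add_le _ _).trans ?_
      rw [norm_mul, Complex.norm_I, Complex.norm_real, Complex.norm_real, Real.norm_eq_abs,
        Real.norm_of_nonneg ht.1]
      have := ht.2
      linarith
    rw [norm_mul, Complex.norm_I, mul_one, norm_neg, norm_mul, Complex.norm_real,
      Real.norm_of_nonneg hπ.le, mul_assoc Real.pi]
    refine mul_le_mul_of_nonneg_left ?_ hπ.le
    refine (norm_add_le _ _).trans ?_
    have hr1 : ‖(1 + robin : ℂ)‖ = 1 + robin := by
      rw [show (1 + robin : ℂ) = ((1 + robin : ℝ) : ℂ) by push_cast; rfl, Complex.norm_real,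
        Real.norm_of_nonneg (by positivity)]
    simp only [norm_mul, hr1, Complex.norm_real, Real.norm_of_nonneg hr.le,
      Real.norm_of_nonneg hπ.le]
    have hx := abs_nonneg x
    refine (add_le_add (b := (1 + robin) * Q * (1 + |x|))
      (d := robin * (Real.pi * 1) * Q * (1 + |x|)) ?_ ?_).trans_eq (by ring)
    · calc (1 + robin) * ‖Complex.sin (Real.pi * (x + t * Complex.I))‖ ≤ (1 + robin) * Q := by
            gcongr
        _ ≤ (1 + robin) * Q * (1 + |x|) := le_mul_of_one_le_right (by positivity) (by linarith)
    · calc robin * (Real.pi * ‖(x : ℂ) + t * Complex.I‖) *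
            ‖Complex.cos (Real.pi * (x + t * Complex.I))‖ ≤ robin * (Real.pi * (1 + |x|)) * Q := by
            gcongr
        _ = _ := by ring

/-- Moving `robinCos` from x + iy to x changes it by O(y(1+|x|)). Squared and multiplied by the
crude kernel bound O(1/y), this error has the same order y(1+x²) as the main term. -/
theorem exists_robinCos_real_mul_nodeKernel_le : ∃ K : ℝ, 0 < K ∧ ∀ x y : ℝ, 0 < y → y ≤ 1 →
    ‖robinCos x‖ ^ 2 * nodeKernel y x ≤ K * y * (1 + x ^ 2) := by
  obtain ⟨K₁, hK₁, h1⟩ := exists_robinCos_sub_le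
  obtain ⟨K₂, hK₂, h2⟩ := exists_nodeKernel_mul_le
  obtain ⟨K₃, hK₃, h3⟩ := exists_nodeKernel_le
  refine ⟨2 * K₂ + 4 * K₁ ^ 2 * K₃, by positivity, fun x y hy hy1 => ?_⟩
  have hρ := nodeKernel_nonneg x hy
  have a1 := h1 x y hy.le hy1
  have a2 := h2 x y hy hy1
  have a3 := h3 x y hy hy1
  set C := robinCos (x + y * Complex.I)
  set D := robinCos x
  have hD : ‖D‖ ≤ ‖C‖ + ‖C - D‖ := by
    have := norm_sub_le C (C - D)
    rwa [sub_sub_cancel] at this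
  have hD2 : ‖D‖ ^ 2 ≤ 2 * ‖C‖ ^ 2 + 2 * ‖C - D‖ ^ 2 := by
    nlinarith [sq_nonneg (‖C‖ - ‖C - D‖), norm_nonneg D]
  have hx : (1 + |x|) ^ 2 ≤ 2 * (1 + x ^ 2) := by
    nlinarith [sq_abs x, sq_nonneg (1 - |x|)]
  have hdiff : ‖C - D‖ ^ 2 * nodeKernel y x ≤ 2 * K₁ ^ 2 * K₃ * y * (1 + x ^ 2) := by
    calc ‖C - D‖ ^ 2 * nodeKernel y x ≤ (K₁ * y * (1 + |x|)) ^ 2 * (K₃ / y) := by gcongr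
      _ = K₁ ^ 2 * K₃ * y * (1 + |x|) ^ 2 := by field_simp
      _ ≤ K₁ ^ 2 * K₃ * y * (2 * (1 + x ^ 2)) := by gcongr
      _ = _ := by ring
  calc ‖D‖ ^ 2 * nodeKernel y x ≤ (2 * ‖C‖ ^ 2 + 2 * ‖C - D‖ ^ 2) * nodeKernel y x := by gcongr
    _ = 2 * (‖C‖ ^ 2 * nodeKernel y x) + 2 * (‖C - D‖ ^ 2 * nodeKernel y x) := by ring
    _ ≤ 2 * (K₂ * y * (1 + x ^ 2)) + 2 * (2 * K₁ ^ 2 * K₃ * y * (1 + x ^ 2)) := by gcongr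
    _ = _ := by ring

/-! ### Quadrature inequalities by letting y → 0. -/

theorem hasExpType_extremal_sq : HasExpTypeAtMost (fun z => extremal z ^ 2) (2 * Real.pi) := by
  simp only [sq]
  rw [two_mul]
  exact hasExpType_extremal.mul hasExpType_extremal

theorem freqVanish_extremal_sq : FreqVanish fun x : ℝ => extremal x ^ 2 :=
  FreqVanish.of_entire (f := fun z => extremal z ^ 2) (differentiable_extremal.pow 2)
    hasExpType_extremal_sq integrable_extremal_sq

theorem exists_extremal_ge : ∃ m : ℝ, 0 < m ∧ ∀ x : ℝ, |x| ≤ 1 / 2 → m ≤ (extremal x).re := by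
  have hc : ContinuousOn (fun x : ℝ => (extremal x).re) (Icc (-(1 / 2)) (1 / 2)) :=
    (Complex.continuous_re.comp continuous_extremal_ofReal).continuousOn
  obtain ⟨x₀, hx₀, hmin⟩ := isCompact_Icc.exists_isMinOn (nonempty_Icc.mpr (by norm_num)) hc
  exact ⟨_, extremal_re_pos (abs_le.mpr hx₀), fun x hx => hmin (abs_le.mp hx)⟩

/-- Test the kernel against `extremal` squared: the total integral does not depend on y, the kernel
is nonnegative, and the square is bounded below on [-1/2, 1/2]. -/
theorem exists_integral_nodeKernel_le : ∃ K : ℝ, 0 < K ∧ ∀ y : ℝ, 0 < y → y ≤ 1 →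
    ∫ x in Icc (-(1 / 2) : ℝ) (1 / 2), nodeKernel y x ≤ K := by
  obtain ⟨m, hm, hmx⟩ := exists_extremal_ge
  have hre : (fun x : ℝ => ((((extremal x).re) ^ 2 : ℝ) : ℂ)) = fun x : ℝ => extremal x ^ 2 := by
    funext x; rw [Complex.ofReal_pow, extremal_ofReal_re]
  have hF : FreqVanish fun x : ℝ => ((((extremal x).re) ^ 2 : ℝ) : ℂ) := by
    rw [hre]; exact freqVanish_extremal_sq
  set J := ∫ x : ℝ, ((extremal x).re) ^ 2 with hJ
  have hJ0 : 0 ≤ J := integral_nonneg fun x => sq_nonneg _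
  refine ⟨J / m ^ 2 + 1, by positivity, fun y hy hy1 => ?_⟩
  obtain ⟨hi, he⟩ := integral_mul_nodeKernel hF hy hy1
  have h1 : ∫ x in Icc (-(1 / 2) : ℝ) (1 / 2), m ^ 2 * nodeKernel y x ≤
      ∫ x in Icc (-(1 / 2) : ℝ) (1 / 2), ((extremal x).re) ^ 2 * nodeKernel y x := by
    refine setIntegral_mono_on
      ((continuous_nodeKernel hy).integrableOn_Icc.const_mul _) hi.integrableOn
      measurableSet_Icc fun x hx => ?_
    have := hmx x (abs_le.mpr hx)
    have := nodeKernel_nonneg x hy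
    gcongr
  have h2 : ∫ x in Icc (-(1 / 2) : ℝ) (1 / 2), ((extremal x).re) ^ 2 * nodeKernel y x ≤ J := by
    rw [hJ, ← he]
    exact setIntegral_le_integral hi (Eventually.of_forall fun x =>
      mul_nonneg (sq_nonneg _) (nodeKernel_nonneg x hy))
  rw [integral_const_mul] at h1
  have : ∫ x in Icc (-(1 / 2) : ℝ) (1 / 2), nodeKernel y x ≤ J / m ^ 2 := by
    rw [le_div_iff₀ (by positivity)]; linarith
  linarith

/-- Lower estimate for the integral of a function of type `2π` that is essentially nonnegative at
the zeros of `robinCos`. -/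
theorem exists_integral_ge {p r : ℝ → ℝ} (hp : FreqVanish fun x => (p x : ℂ)) {L : ℝ} (hL : 0 ≤ L)
    (hr : ∀ y : ℝ, 0 < y → Integrable fun x => r x * nodeKernel y x)
    (h1 : ∀ x : ℝ, |x| ≤ 1 / 2 → r x - L * ‖robinCos x‖ ≤ p x)
    (h2 : ∀ x : ℝ, 1 / 2 ≤ |x| → r x - L * (‖robinCos x‖ ^ 2 / (1 + x ^ 2) ^ 2) ≤ p x) :
    ∃ K : ℝ, 0 < K ∧ ∀ y : ℝ, 0 < y → y ≤ 1 →
      ∫ x, r x * nodeKernel y x ≤ (∫ x, p x) + K * √y := by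
  obtain ⟨K₁, hK₁, hb⟩ := exists_robinCos_real_mul_nodeKernel_le
  obtain ⟨K₂, hK₂, hk⟩ := exists_integral_nodeKernel_le
  refine ⟨L * (K₂ + 2 * K₁ + K₁ * Real.pi) + 1, by have := Real.pi_pos; positivity,
    fun y hy hy1 => ?_⟩
  obtain ⟨hi, he⟩ := integral_mul_nodeKernel hp hy hy1
  have hsy : 0 < √y := Real.sqrt_pos.mpr hy
  have hss : √y * √y = y := Real.mul_self_sqrt hy.le
  have hsy1 : √y ≤ 1 := Real.sqrt_le_one.mpr hy1
  set I := Icc (-(1 / 2) : ℝ) (1 / 2) with hI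
  have hmI : MeasurableSet I := measurableSet_Icc
  -- An integrable majorant of the error terms, with integral O(√y): the indicator part serves the
  -- error linear in |C| near 0, the other part the error quadratic in |C| outside.
  set G : ℝ → ℝ := fun x => L * √y *
    (I.indicator (fun x => nodeKernel y x + 2 * K₁) x + K₁ * (1 + x ^ 2)⁻¹) with hG
  have hGI : IntegrableOn (fun x => nodeKernel y x + 2 * K₁) I :=
    ((continuous_nodeKernel hy).add continuous_const).integrableOn_Icc
  have hG1 : Integrable (I.indicator fun x => nodeKernel y x + 2 * K₁) :=
    (integrable_indicator_iff hmI).mpr hGI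
  have hG2 : Integrable fun x : ℝ => K₁ * (1 + x ^ 2)⁻¹ := integrable_inv_one_add_sq.const_mul K₁
  have hGi : Integrable G := (hG1.add hG2).const_mul _
  have hpt : ∀ x, r x * nodeKernel y x - G x ≤ p x * nodeKernel y x := by
    intro x
    have hρ := nodeKernel_nonneg x hy
    have hbx := hb x y hy hy1
    have hx0 : 0 ≤ K₁ * (1 + x ^ 2)⁻¹ := by positivity
    by_cases hx : |x| ≤ 1 / 2
    · have hxI : x ∈ I := abs_le.mp hx
      have hx2 : 1 + x ^ 2 ≤ 2 := by nlinarith [sq_abs x, abs_nonneg x]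
      simp only [hG, indicator_of_mem hxI]
      -- An error linear in |C| is not directly controlled by the bound on |C|²·kernel; the
      -- inequality |C|√y ≤ y + |C|² converts it, and this is the source of the rate √y.
      have hkey : ‖robinCos x‖ * nodeKernel y x ≤ √y * (nodeKernel y x + 2 * K₁) := by
        have hcs : ‖robinCos x‖ * √y ≤ √y * √y + ‖robinCos x‖ ^ 2 := by
          nlinarith [sq_nonneg (‖robinCos x‖ - √y), sq_nonneg ‖robinCos x‖, sq_nonneg √y]
        refine le_of_mul_le_mul_right (a := √y) ?_ hsy
        calc ‖robinCos x‖ * nodeKernel y x * √y = (‖robinCos x‖ * √y) * nodeKernel y x := by ring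
          _ ≤ (√y * √y + ‖robinCos x‖ ^ 2) * nodeKernel y x := by gcongr
          _ = √y * √y * nodeKernel y x + ‖robinCos x‖ ^ 2 * nodeKernel y x := by ring
          _ ≤ √y * √y * nodeKernel y x + K₁ * (√y * √y) * 2 := by
              rw [hss]
              have : K₁ * y * (1 + x ^ 2) ≤ K₁ * y * 2 := by gcongr
              linarith
          _ = _ := by ring
      have h3 := mul_le_mul_of_nonneg_right (h1 x hx) hρ
      have h4 := mul_le_mul_of_nonneg_left hkey hL
      have h5 : 0 ≤ L * √y * (K₁ * (1 + x ^ 2)⁻¹) := by positivity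
      nlinarith
    · have hx' := (not_le.mp hx).le
      have hxI : x ∉ I := fun h => hx (abs_le.mpr h)
      simp only [hG, indicator_of_notMem hxI, zero_add]
      have hkey : ‖robinCos x‖ ^ 2 / (1 + x ^ 2) ^ 2 * nodeKernel y x ≤
          √y * (K₁ * (1 + x ^ 2)⁻¹) := by
        have hyy : y ≤ √y := by nlinarith
        calc ‖robinCos x‖ ^ 2 / (1 + x ^ 2) ^ 2 * nodeKernel y x =
              (‖robinCos x‖ ^ 2 * nodeKernel y x) / (1 + x ^ 2) ^ 2 := by ring
          _ ≤ (K₁ * y * (1 + x ^ 2)) / (1 + x ^ 2) ^ 2 := by gcongr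
          _ = y * (K₁ * (1 + x ^ 2)⁻¹) := by
              field_simp
          _ ≤ _ := by gcongr
      have h3 := mul_le_mul_of_nonneg_right (h2 x hx') hρ
      have h4 := mul_le_mul_of_nonneg_left hkey hL
      nlinarith
  have hint := integral_mono ((hr y hy).sub hGi) hi hpt
  rw [he, integral_sub' (hr y hy) hGi] at hint
  have hGint : ∫ x, G x ≤ L * √y * (K₂ + 2 * K₁ + K₁ * Real.pi) := by
    simp only [hG]
    rw [integral_const_mul, integral_add hG1 hG2, integral_indicator hmI, integral_const_mul,
      integral_univ_inv_one_add_sq, integral_add (continuous_nodeKernel hy).integrableOn_Icc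
        continuous_const.integrableOn_Icc]
    have : ∫ _ in I, 2 * K₁ = 2 * K₁ := by
      rw [setIntegral_const]
      simp [hI, Measure.real]
      norm_num
    rw [this]
    have := hk y hy hy1
    gcongr
  nlinarith

theorem integral_nonneg_of_lower_bound {p : ℝ → ℝ} (hp : FreqVanish fun x => (p x : ℂ)) {L : ℝ}
    (hL : 0 ≤ L) (h1 : ∀ x : ℝ, |x| ≤ 1 / 2 → - (L * ‖robinCos x‖) ≤ p x)
    (h2 : ∀ x : ℝ, 1 / 2 ≤ |x| → - (L * (‖robinCos x‖ ^ 2 / (1 + x ^ 2) ^ 2)) ≤ p x) :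
    0 ≤ ∫ x, p x := by
  obtain ⟨K, hK, h⟩ := exists_integral_ge (r := fun _ => 0) hp hL (fun y hy => by simp)
    (by simpa using h1) (by simpa using h2)
  have hlim : Tendsto (fun y : ℝ => (∫ x, p x) + K * √y) (𝓝[>] 0) (𝓝 ((∫ x, p x) + K * √0)) := by
    refine Tendsto.mono_left (Continuous.tendsto ?_ 0) nhdsWithin_le_nhds
    fun_prop
  rw [Real.sqrt_zero, mul_zero, add_zero] at hlim
  refine ge_of_tendsto hlim ?_
  filter_upwards [Ioc_mem_nhdsGT (show (0 : ℝ) < 1 by norm_num)] with y hy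
  simpa using h y hy.1 hy.2

/-- Each node carries positive mass. `robinCos` is Lipschitz near ξ, so it is O(y) on the window |x
- ξ| ≤ y at height y; there the kernel is at least a constant over y, and the window has length 2y.
-/
theorem exists_integral_near_node_ge {ξ s : ℝ} (hξ : robinCos ξ = 0) :
    ∃ κ : ℝ, 0 < κ ∧ ∀ y : ℝ, 0 < y → y ≤ 1 → y ≤ s →
      κ ≤ ∫ x in Icc (ξ - s) (ξ + s), nodeKernel y x := by
  have hπ := Real.pi_pos
  obtain ⟨K, hK⟩ := (isCompact_closedBall (ξ : ℂ) 2).exists_bound_of_continuousOn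
    (f := deriv robinCos) differentiable_robinCos.deriv.continuous.continuousOn
  set K' := max K 1 with hK'
  have hK'0 : 0 < K' := lt_max_of_lt_right one_pos
  refine ⟨Real.pi / K' ^ 2, by positivity, fun y hy hy1 hys => ?_⟩
  have hlow : ∀ x ∈ Icc (ξ - y) (ξ + y), Real.pi / (2 * K' ^ 2 * y) ≤ nodeKernel y x := by
    intro x hx
    refine le_trans ?_ (nodeKernel_ge x hy)
    have hC0 := norm_pos_iff.mpr (robinCos_ne_zero x hy)
    have hdist : ‖(x : ℂ) + y * Complex.I - ξ‖ ^ 2 ≤ 2 * y ^ 2 := by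
      rw [Complex.sq_norm, Complex.normSq_apply]
      simp only [Complex.sub_re, Complex.add_re, Complex.ofReal_re, Complex.mul_re, Complex.I_re,
        mul_zero, Complex.ofReal_im, Complex.I_im, mul_one, sub_self, add_zero, Complex.sub_im,
        Complex.add_im, Complex.mul_im, zero_add, sub_zero]
      nlinarith [hx.1, hx.2, mul_nonneg (sub_nonneg.mpr hx.1) (sub_nonneg.mpr hx.2)]
    have hmem : (x : ℂ) + y * Complex.I ∈ Metric.closedBall (ξ : ℂ) 2 := by
      rw [mem_closedBall_iff_norm]
      nlinarith [norm_nonneg ((x : ℂ) + y * Complex.I - ξ)]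
    have hCle : ‖robinCos (x + y * Complex.I)‖ ≤ K' * ‖(x : ℂ) + y * Complex.I - ξ‖ := by
      have := (convex_closedBall (ξ : ℂ) 2).norm_image_sub_le_of_norm_deriv_le
        (f := robinCos) (C := K') (fun z _ => differentiable_robinCos z)
        (fun z hz => (hK z hz).trans (le_max_left _ _))
        (Metric.mem_closedBall_self (by norm_num)) hmem
      rwa [hξ, sub_zero] at this
    have hC2 : ‖robinCos (x + y * Complex.I)‖ ^ 2 ≤ K' ^ 2 * (2 * y ^ 2) := by
      calc _ ≤ (K' * ‖(x : ℂ) + y * Complex.I - ξ‖) ^ 2 := by gcongr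
        _ = K' ^ 2 * ‖(x : ℂ) + y * Complex.I - ξ‖ ^ 2 := by ring
        _ ≤ _ := by gcongr
    calc Real.pi / (2 * K' ^ 2 * y) = Real.pi * y / (K' ^ 2 * (2 * y ^ 2)) := by field_simp
      _ ≤ _ := by gcongr
  have hsub : Icc (ξ - y) (ξ + y) ⊆ Icc (ξ - s) (ξ + s) :=
    Icc_subset_Icc (by linarith) (by linarith)
  calc Real.pi / K' ^ 2 = ∫ _ in Icc (ξ - y) (ξ + y), Real.pi / (2 * K' ^ 2 * y) := by
        rw [setIntegral_const, Real.volume_real_Icc_of_le (by linarith), smul_eq_mul]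
        field_simp
        ring
    _ ≤ ∫ x in Icc (ξ - y) (ξ + y), nodeKernel y x :=
        setIntegral_mono_on (by simp) (continuous_nodeKernel hy).integrableOn_Icc
          measurableSet_Icc hlow
    _ ≤ _ := setIntegral_mono_set (continuous_nodeKernel hy).integrableOn_Icc
          (Eventually.of_forall fun x => nodeKernel_nonneg x hy) hsub.eventuallyLE

/-- Strict version for the equality case: p stays above a positive constant near one node, up to the
admissible errors, and the mass of that node bounds ∫ p away from 0. -/
theorem integral_pos_of_lower_bound {p : ℝ → ℝ} (hp : FreqVanish fun x => (p x : ℂ)) {L : ℝ}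
    (hL : 0 ≤ L) {ξ s δ : ℝ} (hξ : robinCos ξ = 0) (hs : 0 < s) (hδ : 0 < δ)
    (h1 : ∀ x : ℝ, |x| ≤ 1 / 2 →
      (Icc (ξ - s) (ξ + s)).indicator (fun _ => δ) x - (L * ‖robinCos x‖) ≤ p x)
    (h2 : ∀ x : ℝ, 1 / 2 ≤ |x| → (Icc (ξ - s) (ξ + s)).indicator (fun _ => δ) x -
      (L * (‖robinCos x‖ ^ 2 / (1 + x ^ 2) ^ 2)) ≤ p x) :
    0 < ∫ x, p x := by
  set J := Icc (ξ - s) (ξ + s) with hJ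
  have hJm : MeasurableSet J := measurableSet_Icc
  have e : ∀ y, (fun x => J.indicator (fun _ => δ) x * nodeKernel y x) =
      J.indicator fun x => δ * nodeKernel y x := fun y => by
    funext x
    by_cases hx : x ∈ J <;> simp [hx]
  obtain ⟨K, hK, h⟩ := exists_integral_ge (r := J.indicator fun _ => δ) hp hL (fun y hy => by
    rw [e, integrable_indicator_iff hJm]
    exact (continuous_nodeKernel hy).integrableOn_Icc.const_mul _) h1 h2
  obtain ⟨κ, hκ, hk⟩ := exists_integral_near_node_ge (s := s) hξ
  have hlim : Tendsto (fun y : ℝ => (∫ x, p x) + K * √y) (𝓝[>] 0) (𝓝 ((∫ x, p x) + K * √0)) := by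
    refine Tendsto.mono_left (Continuous.tendsto ?_ 0) nhdsWithin_le_nhds
    fun_prop
  rw [Real.sqrt_zero, mul_zero, add_zero] at hlim
  refine lt_of_lt_of_le (mul_pos hδ hκ) (ge_of_tendsto hlim ?_)
  filter_upwards [Ioc_mem_nhdsGT (lt_min (show (0 : ℝ) < 1 by norm_num) hs)] with y hy
  have hy1 := hy.2.trans (min_le_left _ _)
  refine le_trans ?_ (h y hy.1 hy1)
  rw [e, integral_indicator hJm, integral_const_mul]
  gcongr
  exact hk y hy.1 hy1 (hy.2.trans (min_le_right _ _))

/-! ### The lower bound with remainder. -/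

theorem integrable_mul_weight {f : ℝ → ℂ} (hf : Integrable f) :
    Integrable fun x => f x * (weight x : ℂ) :=
  hf.mul_bdd (c := 1) (Complex.continuous_ofReal.comp continuous_weight).aestronglyMeasurable
    (Eventually.of_forall fun x => by
      rw [Complex.norm_real, Real.norm_of_nonneg (weight_nonneg x)]; exact weight_le_one x)

theorem integral_extremal_sq_mul_weight :
    ∫ x : ℝ, extremal x ^ 2 * (weight x : ℂ) = gapConst := by
  have := integral_mul_extremal memH_extremal
  rw [extremal_zero, mul_one] at this
  simpa only [sq] using this

/-- The linear extremal inequality, with remainder `I`, and its case of equality. -/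
theorem exists_M_eq_add {R : ℂ → ℂ} (hd : Differentiable ℂ R)
    (ht : HasExpTypeAtMost R (2 * Real.pi)) (hint : Integrable fun x : ℝ => R x)
    (hpos : ∀ x : ℝ, 0 ≤ R x) :
    ∃ I : ℝ, 0 ≤ I ∧ M R = gapConst * R 0 + I ∧
      (I = 0 → ∀ ξ : ℝ, robinCos ξ = 0 → 1 / 2 < |ξ| → R ξ = 0) := by
  have hπ := Real.pi_pos
  have hπ3 := Real.pi_gt_three
  have hπc : (Real.pi : ℂ) ≠ 0 := by exact_mod_cast Real.pi_ne_zero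
  have hRre : ∀ x : ℝ, R x = ((R x).re : ℂ) := fun x => by
    have := (Complex.nonneg_iff.mp (hpos x)).2
    exact Complex.ext (by simp) (by simp [← this])
  have hRnn : ∀ x : ℝ, 0 ≤ (R x).re := fun x => (Complex.nonneg_iff.mp (hpos x)).1
  set ρ := (R 0).re with hρ
  have hρ0 : 0 ≤ ρ := by simpa using hRnn 0
  have hR0 : R 0 = (ρ : ℂ) := by simpa using hRre 0
  have hRc : Continuous fun x : ℝ => R x := hd.continuous.comp Complex.continuous_ofReal
  have hRrc : Continuous fun x : ℝ => (R x).re := Complex.continuous_re.comp hRc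
  -- Symmetrizing costs nothing in M and makes the zero at the origin double.
  set S : ℂ → ℂ := fun z => (R z + R (-z)) + (-(2 * ρ)) * extremal z ^ 2 with hS
  have hSd : Differentiable ℂ S :=
    (hd.add (hd.comp differentiable_neg)).add ((differentiable_extremal.pow 2).const_mul _)
  have hSt : HasExpTypeAtMost S (2 * Real.pi) :=
    (ht.add ht.comp_neg).add (hasExpType_extremal_sq.const_mul _)
  have hRneg : Integrable fun x : ℝ => R (-x) := by simpa using hint.comp_neg
  have hSi : Integrable fun x : ℝ => S x :=
    (hint.add hRneg).add (integrable_extremal_sq.const_mul _)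
  obtain ⟨S₂, hS₂d, hSS⟩ := exists_div_sq_of_even hSd
    (fun z => by simp only [hS, neg_neg, extremal_neg]; ring)
    (by simp only [hS, neg_zero, extremal_zero, hR0]; ring)
  have hS₂c : Continuous fun x : ℝ => S₂ x := hS₂d.continuous.comp Complex.continuous_ofReal
  have hzS₂ : Differentiable ℂ fun z => z * S₂ z := differentiable_id.mul hS₂d
  have hS₂t : HasExpTypeAtMost S₂ (2 * Real.pi) := by
    refine HasExpTypeAtMost.of_mul_id (by positivity) hS₂d.continuous
      (HasExpTypeAtMost.of_mul_id (by positivity) hzS₂.continuous ?_)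
    rwa [show S = fun z => z * (z * S₂ z) from funext hSS] at hSt
  have hS₂i : Integrable fun x : ℝ => S₂ x :=
    integrable_of_bound_outside hS₂c hSi.norm (fun x => norm_nonneg _) fun x hx => by
      rw [hSS, norm_mul, norm_mul, Complex.norm_real, Real.norm_eq_abs]
      nlinarith [norm_nonneg (S₂ x), mul_le_mul hx hx zero_le_one (abs_nonneg x)]
  -- P is the function that replaces S·`weight` under the integral sign; it still has type 2π, so
  -- the node kernels apply to it.
  set P : ℂ → ℂ := fun z => (z ^ 2 - 1 / (2 * Real.pi ^ 2)) * S₂ z with hP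
  have hPS : ∀ z, P z = S z + (-1 / (2 * Real.pi ^ 2)) * S₂ z := fun z => by
    simp only [hP]
    rw [hSS]; ring
  have hPd : Differentiable ℂ P := by
    rw [show P = _ from funext hPS]
    exact hSd.add (hS₂d.const_mul _)
  have hPt : HasExpTypeAtMost P (2 * Real.pi) := by
    rw [show P = _ from funext hPS]
    exact hSt.add (hS₂t.const_mul _)
  have hPi : Integrable fun x : ℝ => P x := by
    simp only [hPS]
    exact hSi.add (hS₂i.const_mul _)
  have hMP : ∫ x : ℝ, S x * (weight x : ℂ) = ∫ x : ℝ, P x := by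
    rw [← integral_sq_mul_weight hS₂d hS₂t hS₂i hPi]
    refine integral_congr_ae (Eventually.of_forall fun x => ?_)
    simp only
    rw [hSS]; ring
  have hMS : ∫ x : ℝ, S x * (weight x : ℂ) = 2 * M R - 2 * ρ * gapConst := by
    have e : (fun x : ℝ => S x * (weight x : ℂ)) = fun x : ℝ =>
        (R x * (weight x : ℂ) + R (-x) * (weight x : ℂ)) +
          (-(2 * ρ)) * (extremal x ^ 2 * (weight x : ℂ)) := by
      funext x; simp only [hS]; ring
    have i1 := integrable_mul_weight hint
    have i2 := integrable_mul_weight hRneg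
    have i3 : Integrable fun x : ℝ => R x * (weight x : ℂ) + R (-x) * (weight x : ℂ) := i1.add i2
    have hneg : ∫ x : ℝ, R (-x) * (weight x : ℂ) = M R := by
      rw [M, ← integral_neg_eq_self]
      refine integral_congr_ae (Eventually.of_forall fun x => ?_)
      simp only [Complex.ofReal_neg, neg_neg, weight_neg]
    rw [e, integral_add i3 ((integrable_mul_weight integrable_extremal_sq).const_mul _),
      integral_add i1 i2, integral_const_mul, integral_extremal_sq_mul_weight, hneg, ← M]
    ring
  set k : ℝ → ℝ := fun x => (extremal x).re with hk
  have hkC : ∀ x : ℝ, extremal x = (k x : ℂ) := fun x => (extremal_ofReal_re x).symm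
  have hSre : ∀ x : ℝ, S x = (((R x).re + (R (-x)).re - 2 * ρ * k x ^ 2 : ℝ) : ℂ) := fun x => by
    simp only [hS]
    have h1 := hRre x
    have h2 := hRre (-x)
    push_cast at h2
    rw [h1, h2, hkC]
    push_cast
    rw [Complex.ofReal_re, Complex.ofReal_re]
    ring
  -- Division by x² shows that S₂ is real away from 0; density and continuity supply the origin.
  have hS₂re : ∀ x : ℝ, S₂ x = ((S₂ x).re : ℂ) := by
    refine congrFun (Continuous.ext_on (dense_compl_singleton (0 : ℝ)) hS₂c
      (Complex.continuous_ofReal.comp (Complex.continuous_re.comp hS₂c)) fun x hx => ?_)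
    have hx0 : (x : ℂ) ≠ 0 := by exact_mod_cast hx
    have h1 : S₂ x = ((((R x).re + (R (-x)).re - 2 * ρ * k x ^ 2) / x ^ 2 : ℝ) : ℂ) := by
      have := hSS x
      rw [hSre] at this
      push_cast at this ⊢
      field_simp
      linear_combination -this
    simp only [h1, Complex.ofReal_re]
  set s₂ : ℝ → ℝ := fun x => (S₂ x).re with hs₂
  set p : ℝ → ℝ := fun x => (x ^ 2 - 1 / (2 * Real.pi ^ 2)) * s₂ x with hp
  have hPp : ∀ x : ℝ, P x = (p x : ℂ) := fun x => by
    simp only [hP, hp]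
    rw [hS₂re]; push_cast; rfl
  have hsS : ∀ x : ℝ, x ^ 2 * s₂ x = (R x).re + (R (-x)).re - 2 * ρ * k x ^ 2 := fun x => by
    have := hSS x
    rw [hSre, hS₂re] at this
    have : (((R x).re + (R (-x)).re - 2 * ρ * k x ^ 2 : ℝ) : ℂ) =
        ((x * (x * s₂ x) : ℝ) : ℂ) := by rw [this]; push_cast; rfl
    have := Complex.ofReal_injective this
    rw [this]; ring
  have hFV : FreqVanish fun x : ℝ => (p x : ℂ) := by
    have := FreqVanish.of_entire hPd hPt hPi
    simpa only [hPp] using this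
  have hIp : ∫ x : ℝ, P x = ((∫ x, p x : ℝ) : ℂ) := by
    simp only [hPp]; exact integral_ofReal
  have hCk : ∀ x : ℝ, ‖robinCos x‖ = |k x * (1 - 2 * Real.pi ^ 2 * x ^ 2)| := fun x => by
    rw [← extremal_mul, hkC, ← Real.norm_eq_abs, ← Complex.norm_real]
    push_cast; rfl
  obtain ⟨m, hm, hmk⟩ := exists_extremal_ge
  obtain ⟨K, hK⟩ := (isCompact_Icc (a := (-(1 / 2) : ℝ)) (b := 1 / 2)).exists_bound_of_continuousOn
    hS₂c.continuousOn
  -- The first summand dominates the error inside [-1/2, 1/2], the second the k² term outside.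
  set L := |K| / m + 2 * ρ with hL
  have hL0 : 0 ≤ L := by positivity
  -- Inside, 1 - 2π²x² is C divided by k ≥ m, so P is O(|C|) whatever its sign.
  have hin : ∀ x : ℝ, |x| ≤ 1 / 2 → -(L * ‖robinCos x‖) ≤ p x := by
    intro x hx
    have h1 : |p x| ≤ L * ‖robinCos x‖ := by
      have hs : |s₂ x| ≤ |K| := by
        have h2 := (hK x (abs_le.mp hx)).trans (le_abs_self K)
        exact (Complex.abs_re_le_norm _).trans h2
      have hkm := hmk x hx
      have hk0 : 0 < k x := lt_of_lt_of_le hm hkm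
      have hA : |x ^ 2 - 1 / (2 * Real.pi ^ 2)| ≤ ‖robinCos x‖ / m := by
        rw [hCk, abs_mul, abs_of_pos hk0, le_div_iff₀ hm]
        have e : 1 - 2 * Real.pi ^ 2 * x ^ 2 =
            -(2 * Real.pi ^ 2) * (x ^ 2 - 1 / (2 * Real.pi ^ 2)) := by field_simp; ring
        rw [e, abs_mul, abs_neg, abs_of_pos (by positivity : 0 < 2 * Real.pi ^ 2)]
        have h9 : 1 ≤ 2 * Real.pi ^ 2 := by nlinarith
        have := abs_nonneg (x ^ 2 - 1 / (2 * Real.pi ^ 2))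
        calc _ = m * (1 * |x ^ 2 - 1 / (2 * Real.pi ^ 2)|) := by ring
          _ ≤ k x * (2 * Real.pi ^ 2 * |x ^ 2 - 1 / (2 * Real.pi ^ 2)|) := by gcongr
      calc |p x| = |x ^ 2 - 1 / (2 * Real.pi ^ 2)| * |s₂ x| := abs_mul _ _
        _ ≤ ‖robinCos x‖ / m * |K| := by gcongr
        _ = |K| / m * ‖robinCos x‖ := by ring
        _ ≤ _ := by gcongr; rw [hL]; linarith
    exact (abs_le.mp h1).1
  -- Outside, 1 - 1/(2π²x²) ≥ 1/2, and 2π²x² - 1 ≥ 1 + x² turns k² into at most |C|²/(1+x²)². The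
  -- surviving term R/2 is what detects R(ξ) > 0.
  have hout : ∀ x : ℝ, 1 / 2 ≤ |x| →
      (R x).re / 2 - L * (‖robinCos x‖ ^ 2 / (1 + x ^ 2) ^ 2) ≤ p x := by
    intro x hx
    have hx2 : 1 / 4 ≤ x ^ 2 := by rw [← sq_abs]; nlinarith
    have hx0 : 0 < x ^ 2 := by linarith
    have hq : 1 / (2 * Real.pi ^ 2 * x ^ 2) ≤ 1 / 2 := by
      rw [div_le_div_iff₀ (by positivity) two_pos]
      nlinarith
    have hq0 : 0 ≤ 1 / (2 * Real.pi ^ 2 * x ^ 2) := by positivity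
    have hpe : p x = (1 - 1 / (2 * Real.pi ^ 2 * x ^ 2)) *
        ((R x).re + (R (-x)).re - 2 * ρ * k x ^ 2) := by
      rw [← hsS]; simp only [hp]
      have : x ≠ 0 := by rintro rfl; norm_num at hx0
      field_simp
    have hkle : k x ^ 2 ≤ ‖robinCos x‖ ^ 2 / (1 + x ^ 2) ^ 2 := by
      rw [hCk, sq_abs, mul_pow, le_div_iff₀ (by positivity)]
      have : (1 + x ^ 2) ^ 2 ≤ (1 - 2 * Real.pi ^ 2 * x ^ 2) ^ 2 := by
        have h18 : 1 + x ^ 2 ≤ 2 * Real.pi ^ 2 * x ^ 2 - 1 := by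
          have h9 : 9 ≤ Real.pi ^ 2 := by nlinarith [Real.pi_gt_three]
          nlinarith [mul_le_mul_of_nonneg_right h9 hx0.le]
        nlinarith
      gcongr
    rw [hpe]
    set q := 1 / (2 * Real.pi ^ 2 * x ^ 2)
    have h1 : (R x).re / 2 ≤ (1 - q) * ((R x).re + (R (-x)).re) := by
      have := hRnn (-x)
      push_cast at this
      nlinarith [hRnn x]
    have h2 : (1 - q) * (2 * ρ * k x ^ 2) ≤ 2 * ρ * k x ^ 2 :=
      mul_le_of_le_one_left (by positivity) (by linarith)
    have h3 : 2 * ρ * k x ^ 2 ≤ L * (‖robinCos x‖ ^ 2 / (1 + x ^ 2) ^ 2) := by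
      have hLρ : 2 * ρ ≤ L := by rw [hL]; have : 0 ≤ |K| / m := by positivity
                                 linarith
      gcongr
    nlinarith
  refine ⟨(∫ x, p x) / 2, ?_, ?_, ?_⟩
  · have := integral_nonneg_of_lower_bound hFV hL0 hin fun x hx => by
      have := hout x hx
      linarith [hRnn x]
    linarith
  · have : 2 * M R - 2 * ρ * gapConst = ((∫ x, p x : ℝ) : ℂ) := by rw [← hMS, hMP, hIp]
    rw [hR0]
    push_cast
    linear_combination this / 2
  · intro h0 ξ hξ hξ2
    by_contra hne
    have hpos : 0 < (R ξ).re := by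
      refine lt_of_le_of_ne (hRnn ξ) fun h => hne ?_
      rw [hRre, ← h, Complex.ofReal_zero]
    -- If R(ξ) > 0 at an outer node, R/2 stays above R(ξ)/4 on a small interval that avoids [-1/2,
    -- 1/2], which forces a strictly positive integral.
    have hev : ∀ᶠ x : ℝ in 𝓝 ξ, (R ξ).re / 2 < (R x).re ∧ 1 / 2 < |x| := by
      have h1 : Tendsto (fun x : ℝ => (R x).re) (𝓝 ξ) (𝓝 (R ξ).re) := hRrc.continuousAt
      have h2 : Tendsto (fun x : ℝ => |x|) (𝓝 ξ) (𝓝 |ξ|) := continuous_abs.continuousAt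
      exact (h1.eventually_const_lt (half_lt_self hpos)).and (h2.eventually_const_lt hξ2)
    obtain ⟨s, hs, hsx⟩ := Metric.nhds_basis_closedBall.eventually_iff.mp hev
    rw [Real.closedBall_eq_Icc] at hsx
    have := integral_pos_of_lower_bound hFV hL0 hξ hs (δ := (R ξ).re / 4) (by linarith)
      (fun x hx => by
        have hxJ : x ∉ Icc (ξ - s) (ξ + s) := fun h => by linarith [(hsx h).2]
        rw [indicator_of_notMem hxJ, zero_sub]
        exact hin x hx)
      (fun x hx => by
        have h1 := hout x hx
        by_cases hxJ : x ∈ Icc (ξ - s) (ξ + s)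
        · rw [indicator_of_mem hxJ]
          linarith [(hsx hxJ).1]
        · rw [indicator_of_notMem hxJ]
          linarith [hRnn x])
    linarith

/-! ### Growth and decay of admissible functions. -/

/-- The Fourier–Laplace transform of an integrable function supported in `[-1,1]` is entire. -/
theorem differentiable_integral_mul_cexp {g : ℝ → ℂ} (hg : Integrable g)
    (hs : Function.support g ⊆ Icc (-1) 1) :
    Differentiable ℂ fun z : ℂ => ∫ t : ℝ, g t * Complex.exp (2 * Real.pi * Complex.I * t * z) := by
  have hexp : ∀ z : ℂ, Continuous fun t : ℝ => Complex.exp (2 * Real.pi * Complex.I * t * z) :=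
    fun z => by fun_prop
  have hbd : ∀ z : ℂ, ∀ t : ℝ, ‖g t * Complex.exp (2 * Real.pi * Complex.I * t * z)‖ ≤
      Real.exp (2 * Real.pi * ‖z‖) * ‖g t‖ := by
    intro z t
    by_cases ht : g t = 0
    · simp [ht]
    rw [norm_mul, mul_comm, Complex.norm_exp]
    gcongr
    refine (Complex.re_le_norm _).trans ?_
    have h1 : |t| ≤ 1 := abs_le.mpr (hs ht)
    have := Real.pi_pos
    simp only [norm_mul, Complex.norm_real, Real.norm_eq_abs, Complex.norm_I, mul_one,
      abs_of_pos this, Complex.norm_ofNat]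
    calc 2 * Real.pi * |t| * ‖z‖ ≤ 2 * Real.pi * 1 * ‖z‖ := by gcongr
      _ = _ := by ring
  intro z₀
  have key := hasDerivAt_integral_of_dominated_loc_of_deriv_le (μ := volume) (𝕜 := ℂ)
    (F := fun z t => g t * Complex.exp (2 * Real.pi * Complex.I * t * z))
    (F' := fun z t => g t * (Complex.exp (2 * Real.pi * Complex.I * t * z) *
      (2 * Real.pi * Complex.I * t)))
    (x₀ := z₀) (s := Metric.ball z₀ 1)
    (bound := fun t => Real.exp (2 * Real.pi * (‖z₀‖ + 1)) * ‖g t‖ * (2 * Real.pi))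
    (Metric.ball_mem_nhds z₀ one_pos)
    (Eventually.of_forall fun z => hg.aestronglyMeasurable.mul (hexp z).aestronglyMeasurable)
    ((hg.norm.const_mul (Real.exp (2 * Real.pi * ‖z₀‖))).mono'
      (hg.aestronglyMeasurable.mul (hexp z₀).aestronglyMeasurable)
      (Eventually.of_forall (hbd z₀)))
    (hg.aestronglyMeasurable.mul (((hexp z₀).mul (by fun_prop)).aestronglyMeasurable))
    (Eventually.of_forall fun t z hz => ?_)
    ((hg.norm.const_mul _).mul_const _)
    (Eventually.of_forall fun t z hz => ?_)
  · exact key.2.differentiableAt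
  · have hz' : ‖z‖ ≤ ‖z₀‖ + 1 := by
      have h2 := norm_sub_norm_le z z₀
      rw [Metric.mem_ball, dist_eq_norm] at hz
      linarith
    by_cases ht : g t = 0
    · simp [ht]
    rw [← mul_assoc, norm_mul]
    have h1 : |t| ≤ 1 := abs_le.mpr (hs ht)
    have hπ := Real.pi_pos
    gcongr
    · exact (hbd z t).trans (by gcongr)
    · simp only [norm_mul, Complex.norm_real, Real.norm_eq_abs, Complex.norm_I, mul_one,
        abs_of_pos hπ, Complex.norm_ofNat]
      nlinarith
  · have h := ((hasDerivAt_id z).const_mul (2 * Real.pi * Complex.I * t)).cexp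
    simpa using h.const_mul (g t)

theorem norm_integral_mul_cexp_le {g : ℝ → ℂ} (hg : Integrable g)
    (hs : Function.support g ⊆ Icc (-1) 1) (z : ℂ) :
    ‖∫ t : ℝ, g t * Complex.exp (2 * Real.pi * Complex.I * t * z)‖ ≤
      (∫ t : ℝ, ‖g t‖) * Real.exp (2 * Real.pi * |z.im|) := by
  rw [← integral_mul_const]
  refine norm_integral_le_of_norm_le (hg.norm.mul_const _) (Eventually.of_forall fun t => ?_)
  by_cases ht : g t = 0
  · simp [ht]
  rw [norm_mul, Complex.norm_exp]
  gcongr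
  have h1 : |t| ≤ 1 := abs_le.mpr (hs ht)
  have hπ := Real.pi_pos
  have e : (2 * Real.pi * Complex.I * t * z).re = 2 * Real.pi * (-(t * z.im)) := by
    simp
    ring
  rw [e]
  gcongr
  refine (neg_le_abs _).trans ?_
  rw [abs_mul]
  exact mul_le_of_le_one_left (abs_nonneg _) h1

/-- Two entire functions that agree on the real line are equal. -/
theorem eq_of_eq_ofReal {f g : ℂ → ℂ} (hf : Differentiable ℂ f) (hg : Differentiable ℂ g)
    (h : ∀ x : ℝ, f x = g x) : f = g := by
  have hf' : AnalyticOnNhd ℂ f univ := fun z _ => hf.analyticAt z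
  have hg' : AnalyticOnNhd ℂ g univ := fun z _ => hg.analyticAt z
  refine hf'.eq_of_frequently_eq hg' (z₀ := 0) ?_
  have ht : Tendsto (fun x : ℝ => (x : ℂ)) (𝓝[≠] 0) (𝓝[≠] 0) := by
    refine tendsto_nhdsWithin_iff.mpr ⟨?_, ?_⟩
    · exact (Complex.continuous_ofReal.tendsto' 0 0 (by simp)).mono_left nhdsWithin_le_nhds
    · filter_upwards [self_mem_nhdsWithin] with x hx
      simpa using hx
  exact ht.frequently (Frequently.of_forall h)

theorem Admissible.integrable_fourier {R : ℂ → ℂ} (hR : Admissible R) :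
    Integrable (𝓕 fun x : ℝ => R x) := by
  have hgc : Continuous (𝓕 fun x : ℝ => R x) :=
    VectorFourier.fourierIntegral_continuous Real.continuous_fourierChar
      (by exact continuous_inner) hR.integrable
  exact hgc.integrable_of_hasCompactSupport
    (HasCompactSupport.of_support_subset_isCompact isCompact_Icc hR.support_fourier)

theorem Admissible.fourierInv_fourier {R : ℂ → ℂ} (hR : Admissible R) :
    𝓕⁻ (𝓕 fun x : ℝ => R x) = fun x : ℝ => R x :=
  (hR.entire.continuous.comp Complex.continuous_ofReal).fourierInv_fourier_eq hR.integrable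
    hR.integrable_fourier

/-- The transform is continuous with compact support, hence integrable. Inversion shows that R
agrees on ℝ with the entire Fourier–Laplace integral of its transform, so the two agree everywhere
and the bound is read off from the integral. -/
theorem Admissible.exists_bound {R : ℂ → ℂ} (hR : Admissible R) :
    ∃ A : ℝ, 0 < A ∧ ∀ z : ℂ, ‖R z‖ ≤ A * Real.exp (2 * Real.pi * |z.im|) := by
  set g : ℝ → ℂ := 𝓕 (fun x : ℝ => R x)
  have hgi : Integrable g := hR.integrable_fourier
  have hE := differentiable_integral_mul_cexp hgi hR.support_fourier
  have hEq : R = fun z : ℂ => ∫ t : ℝ, g t * Complex.exp (2 * Real.pi * Complex.I * t * z) := by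
    refine eq_of_eq_ofReal hR.entire hE fun x => ?_
    have h := congrFun hR.fourierInv_fourier x
    rw [← h, Real.fourierInv_eq']
    refine integral_congr_ae (Eventually.of_forall fun t => ?_)
    simp only [smul_eq_mul]
    rw [mul_comm]
    congr 2
    simp
    ring
  refine ⟨(∫ t : ℝ, ‖g t‖) + 1, by positivity, fun z => ?_⟩
  have := norm_integral_mul_cexp_le hgi hR.support_fourier z
  rw [← congrFun hEq z] at this
  exact this.trans (by gcongr; linarith)

theorem Admissible.hasExpType {R : ℂ → ℂ} (hR : Admissible R) :
    HasExpTypeAtMost R (2 * Real.pi) := by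
  obtain ⟨A, hA, h⟩ := hR.exists_bound
  refine fun ε hε => ⟨A, hA, fun z => (h z).trans ?_⟩
  have := Real.pi_pos
  have := Complex.abs_im_le_norm z
  gcongr
  linarith

/-- Riemann–Lebesgue, since R is itself the Fourier transform of an integrable function up to
reflection. -/
theorem Admissible.tendsto_zero {R : ℂ → ℂ} (hR : Admissible R) :
    Tendsto (fun x : ℝ => R x) (cocompact ℝ) (𝓝 0) := by
  set g : ℝ → ℂ := 𝓕 (fun x : ℝ => R x)
  have hgi : Integrable g := hR.integrable_fourier
  have h := hR.fourierInv_fourier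
  have h2 : (fun x : ℝ => R x) = fun x : ℝ => 𝓕 g (-x) := by
    conv_lhs => rw [← h]
    funext x
    rw [Real.fourierInv_eq_fourier_neg]
  rw [h2]
  exact (Real.zero_at_infty_fourier g).comp (Homeomorph.neg ℝ).isClosedEmbedding.tendsto_cocompact

/-- An entire function of exponential type `2π`, integrable on the real line, is
admissible. -/
theorem admissible_of_hasExpType {R : ℂ → ℂ} (hd : Differentiable ℂ R)
    (ht : HasExpTypeAtMost R (2 * Real.pi)) (hint : Integrable fun x : ℝ => R x) :
    Admissible R := by
  refine ⟨hd, hint, fun t htS => ?_⟩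
  by_contra hmem
  refine htS ?_
  have hπ := Real.pi_pos
  have h1 : 1 ≤ |t| := by
    by_contra! h
    exact hmem ⟨(abs_lt.mp h).1.le, (abs_lt.mp h).2.le⟩
  have := integral_mul_exp_eq_zero (f := R) (μ := -(2 * Real.pi * t)) (τ := 2 * Real.pi)
    (by positivity) (by
      rw [abs_neg, abs_mul, abs_of_pos (by positivity : 0 < 2 * Real.pi)]
      nlinarith) hd ht hint
  rw [Real.fourier_eq', ← this]
  refine integral_congr_ae (Eventually.of_forall fun x => ?_)
  simp only [smul_eq_mul]
  rw [mul_comm]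
  congr 2
  simp
  ring

/-! ### The equality case: divisibility and rigidity. -/

/-- A quotient of entire functions that is locally analytic is globally so. -/
theorem exists_entire_quotient {F G : ℂ → ℂ} (hG : ∀ z, ∀ᶠ w in 𝓝[≠] z, G w ≠ 0)
    (hF : ∀ z, ∃ φ : ℂ → ℂ, AnalyticAt ℂ φ z ∧ ∀ᶠ w in 𝓝 z, F w = G w * φ w) :
    ∃ h : ℂ → ℂ, Differentiable ℂ h ∧ ∀ z, F z = G z * h z := by
  choose φ hφ hFφ using hF
  -- The local quotients agree where G ≠ 0, in particular on a punctured neighbourhood of each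
  -- point, so their diagonal is analytic.
  refine ⟨fun z => φ z z, fun z => ?_, fun z => (hFφ z).self_of_nhds⟩
  have : (fun w => φ w w) =ᶠ[𝓝 z] φ z := by
    have h1 := eventually_nhdsWithin_iff.mp (hG z)
    filter_upwards [h1, hFφ z] with w hw1 hw2
    by_cases hwz : w = z
    · rw [hwz]
    · exact mul_left_cancel₀ (hw1 hwz) ((hFφ w).self_of_nhds.symm.trans hw2)
  exact ((hφ z).congr this.symm).differentiableAt

/-- An entire function with quadratic growth on the boundaries of a sequence of squares exhausting
the plane is a quadratic polynomial. -/
theorem exists_eq_quadratic {h : ℂ → ℂ} (hd : Differentiable ℂ h) {A : ℝ} {N : ℕ → ℝ}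
    (hN1 : ∀ n, 1 ≤ N n) (hN : Tendsto N atTop atTop)
    (hb : ∀ n, ∀ z : ℂ, |z.re| ≤ N n → |z.im| ≤ N n → (|z.re| = N n ∨ |z.im| = N n) →
      ‖h z‖ ≤ A * N n ^ 2) :
    ∃ b c : ℂ, ∀ z, h z = h 0 + b * z + c * z ^ 2 := by
  -- Removing the first two Taylor terms and dividing by z² leaves k, bounded on the boundaries of
  -- the squares, hence everywhere by the maximum principle; Liouville then makes k constant.
  obtain ⟨g, hg, hhg, -⟩ := exists_entire_div_at hd 0
  obtain ⟨k, hk, hgk, -⟩ := exists_entire_div_at hg 0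
  have hle : ∀ z, ‖k z‖ ≤ A + ‖h 0‖ + ‖g 0‖ := by
    intro z
    obtain ⟨n, hn⟩ := ((tendsto_atTop.mp hN (‖z‖ + 1))).exists
    have hN0 : 0 < N n := by linarith [hN1 n]
    have hz1 := Complex.abs_re_le_norm z
    have hz2 := Complex.abs_im_le_norm z
    refine Complex.norm_le_of_forall_mem_frontier_norm_le
      (U := Ioo (-(N n)) (N n) ×ℂ Ioo (-(N n)) (N n)) ?_ hk.diffContOnCl ?_ ?_
    · exact (Metric.isBounded_Ioo _ _).reProdIm (Metric.isBounded_Ioo _ _)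
    · intro w hw
      rw [Complex.frontier_reProdIm, closure_Ioo (by linarith), frontier_Ioo (by linarith)] at hw
      have habs : ∀ t : ℝ, t ∈ ({-(N n), N n} : Set ℝ) → |t| = N n := by
        rintro t (rfl | rfl)
        · rw [abs_neg, abs_of_pos hN0]
        · exact abs_of_pos hN0
      have hw' : |w.re| ≤ N n ∧ |w.im| ≤ N n ∧ (|w.re| = N n ∨ |w.im| = N n) := by
        rcases hw with ⟨h1, h2⟩ | ⟨h1, h2⟩
        · exact ⟨abs_le.mpr h1, (habs _ h2).le, Or.inr (habs _ h2)⟩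
        · exact ⟨(habs _ h1).le, abs_le.mpr h2, Or.inl (habs _ h1)⟩
      have hwn : N n ≤ ‖w‖ := by
        rcases hw'.2.2 with h | h
        · exact h.symm.le.trans (Complex.abs_re_le_norm w)
        · exact h.symm.le.trans (Complex.abs_im_le_norm w)
      have hw0 : 0 < ‖w‖ := hN0.trans_le hwn
      have hhw := hb n w hw'.1 hw'.2.1 hw'.2.2
      have e : w ^ 2 * k w = h w - h 0 - w * g 0 := by
        rw [hhg w, hgk w]; ring
      have e2 : ‖w‖ ^ 2 * ‖k w‖ ≤ (A + ‖h 0‖ + ‖g 0‖) * ‖w‖ ^ 2 := by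
        rw [← norm_pow, ← norm_mul, e]
        have hA : 0 ≤ A := by
          by_contra! hA
          have : A * N n ^ 2 < 0 := mul_neg_of_neg_of_pos hA (by positivity)
          linarith [norm_nonneg (h w)]
        have hw1 : 1 ≤ ‖w‖ := (hN1 n).trans hwn
        have a1 : A * N n ^ 2 ≤ A * ‖w‖ ^ 2 := by gcongr
        have a2 : ‖h 0‖ ≤ ‖h 0‖ * ‖w‖ ^ 2 :=
          le_mul_of_one_le_right (norm_nonneg _) (one_le_pow₀ hw1)
        have a3 : ‖w‖ * ‖g 0‖ ≤ ‖g 0‖ * ‖w‖ ^ 2 := by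
          rw [mul_comm]
          gcongr
          nlinarith
        have b1 := norm_sub_le (h w - h 0) (w * g 0)
        have b2 := norm_sub_le (h w) (h 0)
        rw [norm_mul] at b1
        rw [norm_pow]
        linarith
      rw [mul_comm] at e2
      exact le_of_mul_le_mul_right e2 (by positivity)
    · refine subset_closure ⟨?_, ?_⟩
      · exact abs_lt.mp (by linarith)
      · exact abs_lt.mp (by linarith)
  have hbd : Bornology.IsBounded (range k) :=
    isBounded_iff_forall_norm_le.mpr ⟨_, by rintro _ ⟨z, rfl⟩; exact hle z⟩
  refine ⟨g 0, k 0, fun z => ?_⟩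
  rw [hhg z, hgk z, hk.apply_eq_apply_of_bounded hbd z 0]
  ring

/-- A real zero is a minimum of R along ℝ, and the complex derivative is computed along ℝ, where R
is real. -/
theorem deriv_eq_zero_of_nonneg {R : ℂ → ℂ} (hd : Differentiable ℂ R)
    (hpos : ∀ x : ℝ, 0 ≤ R x) {ξ : ℝ} (h0 : R ξ = 0) : deriv R ξ = 0 := by
  have h1 : HasDerivAt R (deriv R ξ) ξ := (hd ξ).hasDerivAt
  have h2 := h1.real_of_complex
  have h3 : IsLocalMin (fun x : ℝ => (R x).re) ξ := Eventually.of_forall fun x => by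
    simp only [h0, Complex.zero_re]
    exact (Complex.le_def.mp (hpos x)).1
  have h4 : (deriv R ξ).re = 0 := h3.hasDerivAt_eq_zero h2
  have h5 : HasDerivAt (fun x : ℝ => R x) (deriv R ξ) ξ := h1.comp_ofReal
  have h6 : HasDerivAt (fun x : ℝ => (((R x).re : ℝ) : ℂ)) (((deriv R ξ).re : ℝ) : ℂ) ξ :=
    h2.ofReal_comp
  have h7 : (fun x : ℝ => (((R x).re : ℝ) : ℂ)) = fun x : ℝ => R x := by
    funext x
    exact Complex.ext rfl (Complex.le_def.mp (hpos x)).2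
  rw [h7] at h6
  rw [h5.unique h6, h4, Complex.ofReal_zero]

/-- In the open upper half-plane |U| < |V| excludes U + V = 0; evenness excludes the lower one. -/
theorem im_eq_zero_of_robinCos_eq_zero {z : ℂ} (h : robinCos z = 0) : z.im = 0 := by
  rcases lt_trichotomy z.im 0 with h1 | h1 | h1
  · refine absurd ?_ (robinCos_ne_zero (-z).re (y := (-z).im) (by simpa using h1))
    rw [Complex.re_add_im, robinCos_neg, h]
  · exact h1
  · refine absurd ?_ (robinCos_ne_zero z.re h1)
    rw [Complex.re_add_im, h]

theorem exists_real_of_extremal_eq_zero {z : ℂ} (h : extremal z = 0) :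
    ∃ ξ : ℝ, z = ξ ∧ robinCos ξ = 0 ∧ 1 / 2 < |ξ| := by
  have hC : robinCos z = 0 := by rw [← extremal_mul, h, zero_mul]
  have hz : z = (z.re : ℂ) := Complex.ext rfl (im_eq_zero_of_robinCos_eq_zero hC)
  refine ⟨z.re, hz, hz ▸ hC, ?_⟩
  by_contra! hle
  have := extremal_re_pos hle
  rw [← hz, h] at this
  exact lt_irrefl _ this

/-- A double zero would be a common zero of `robinCos` and its derivative. Eliminating the cosine
gives sin w·(1 + a + (aw)²) = 0 with a > 0, hence sin w = 0 and then cos w = 0, which is impossible.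
-/
theorem deriv_extremal_ne_zero {ξ : ℝ} (h : extremal ξ = 0) : deriv extremal ξ ≠ 0 := by
  intro hd
  have hC : robinCos ξ = 0 := by rw [← extremal_mul, h, zero_mul]
  have h1 : HasDerivAt extremal 0 ξ := hd ▸ (differentiable_extremal ξ).hasDerivAt
  have h2 : HasDerivAt (fun z : ℂ => 1 - 2 * (Real.pi : ℂ) ^ 2 * z ^ 2)
      (deriv (fun z : ℂ => 1 - 2 * (Real.pi : ℂ) ^ 2 * z ^ 2) ξ) ξ :=
    DifferentiableAt.hasDerivAt (by fun_prop)
  have h3 := h1.mul h2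
  rw [h, zero_mul, zero_mul, add_zero,
    show extremal * (fun z : ℂ => 1 - 2 * (Real.pi : ℂ) ^ 2 * z ^ 2) = robinCos from
      funext extremal_mul] at h3
  have h4 := h3.unique (hasDerivAt_robinCos ξ)
  have hw : ((Real.pi : ℂ) * ξ) = ((Real.pi * ξ : ℝ) : ℂ) := by push_cast; rfl
  rw [robinCos, hw, ← Complex.ofReal_cos, ← Complex.ofReal_sin] at hC
  rw [hw, ← Complex.ofReal_cos, ← Complex.ofReal_sin] at h4
  norm_cast at hC h4
  set w := Real.pi * ξ
  have hcos : Real.cos w = robin * w * Real.sin w := by linarith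
  have hr := robin_pos
  have h5 : Real.sin w * (1 + robin + (robin * w) ^ 2) = 0 := by
    have h6 : Real.pi * ((1 + robin) * Real.sin w + robin * w * Real.cos w) = 0 := by linarith
    have h7 := (mul_eq_zero.mp h6).resolve_left Real.pi_ne_zero
    rw [hcos] at h7
    linarith
  have h8 : Real.sin w = 0 :=
    (mul_eq_zero.mp h5).resolve_right (by positivity)
  have := Real.sin_sq_add_cos_sq w
  rw [hcos, h8] at this
  norm_num at this

theorem eventually_extremal_ne_zero (z : ℂ) : ∀ᶠ w in 𝓝[≠] z, extremal w ≠ 0 := by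
  rcases (differentiable_extremal.analyticAt z).eventually_eq_zero_or_eventually_ne_zero with h | h
  · have h1 : AnalyticOnNhd ℂ extremal univ := fun z _ => differentiable_extremal.analyticAt z
    have h2 : extremal = fun _ => 0 := h1.eq_of_eventuallyEq (fun z _ => analyticAt_const) h
    have := extremal_zero
    rw [h2] at this
    exact absurd this zero_ne_one
  · exact h

/-- A nonnegative entire function vanishing at the zeros of `extremal` is divisible by
`extremal ^ 2`. -/
theorem exists_eq_extremal_sq_mul {R : ℂ → ℂ} (hd : Differentiable ℂ R)
    (hpos : ∀ x : ℝ, 0 ≤ R x)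
    (h0 : ∀ ξ : ℝ, robinCos ξ = 0 → 1 / 2 < |ξ| → R ξ = 0) :
    ∃ h : ℂ → ℂ, Differentiable ℂ h ∧ ∀ z, R z = extremal z ^ 2 * h z := by
  refine exists_entire_quotient
    (fun z => (eventually_extremal_ne_zero z).mono fun w hw => pow_ne_zero 2 hw) fun z => ?_
  by_cases hz : extremal z = 0
  · obtain ⟨ξ, rfl, hξ, hξ2⟩ := exists_real_of_extremal_eq_zero hz
    have hRξ := h0 ξ hξ hξ2
    -- R has at least a double zero at ξ and `extremal` a simple one, so the factors (w - ξ)² cancel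
    -- in the quotient.
    obtain ⟨r, hr, hRr, hr0⟩ := exists_entire_div_at hd ξ
    obtain ⟨s, hs, hrs, -⟩ := exists_entire_div_at hr ξ
    obtain ⟨e, he, hEe, he0⟩ := exists_entire_div_at differentiable_extremal ξ
    have heξ : e ξ ≠ 0 := he0 ▸ deriv_extremal_ne_zero hz
    rw [deriv_eq_zero_of_nonneg hd hpos hRξ] at hr0
    refine ⟨fun w => s w / e w ^ 2, ((hs.analyticAt _).div ((he.analyticAt _).pow 2)
      (pow_ne_zero 2 heξ)), ?_⟩
    filter_upwards [he.continuous.continuousAt.eventually_ne heξ] with w hw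
    rw [hRr w, hrs w, hEe w, hr0, hRξ, hz]
    field_simp
    ring
  · refine ⟨fun w => R w / extremal w ^ 2, (hd.analyticAt _).div
      ((differentiable_extremal.analyticAt _).pow 2) (pow_ne_zero 2 hz), ?_⟩
    filter_upwards [differentiable_extremal.continuous.continuousAt.eventually_ne hz] with w hw
    field_simp

theorem exp_abs_le_two_mul_cosh (y : ℝ) : Real.exp |y| ≤ 2 * Real.cosh y := by
  rw [← Real.cosh_abs, Real.cosh_eq]
  linarith [Real.exp_pos (-|y|)]

/-- When cos πN = 0, the real part of `robinCos` on the vertical line is exactly ∓aπN cosh πy. -/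
theorem norm_robinCos_ge_of_re {z : ℂ} {N : ℝ} (hN : 0 < N) (hcos : Real.cos (Real.pi * N) = 0)
    (hz : |z.re| = N) :
    robin * Real.pi / 4 * N * Real.exp (Real.pi * |z.im|) ≤ ‖robinCos z‖ := by
  have hr := robin_pos
  have hπ := Real.pi_pos
  have key : ∀ y : ℝ, robin * Real.pi / 4 * N * Real.exp (Real.pi * |y|) ≤
      ‖robinCos (N + y * Complex.I)‖ := by
    intro y
    have hs := Real.sin_sq_add_cos_sq (Real.pi * N)
    rw [hcos] at hs
    have hre : (robinCos (N + y * Complex.I)).re =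
        -(robin * (Real.pi * N) * (Real.sin (Real.pi * N) * Real.cosh (Real.pi * y))) := by
      have e : (Real.pi : ℂ) * (N + y * Complex.I) =
          ((Real.pi * N : ℝ) : ℂ) + ((Real.pi * y : ℝ) : ℂ) * Complex.I := by push_cast; ring
      rw [robinCos, e, Complex.cos_add_mul_I, Complex.sin_add_mul_I, ← Complex.ofReal_cos,
        ← Complex.ofReal_sin, ← Complex.ofReal_cosh, ← Complex.ofReal_sinh, hcos]
      simp [-Complex.ofReal_cos, -Complex.ofReal_sin, -Complex.ofReal_cosh, -Complex.ofReal_sinh,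
        -Complex.ofReal_mul]
    have habs : |Real.sin (Real.pi * N)| = 1 := by
      rw [← sq_eq_sq₀ (abs_nonneg _) zero_le_one, sq_abs]; linarith
    refine le_trans ?_ (Complex.abs_re_le_norm _)
    rw [hre, abs_neg, abs_mul, abs_mul (Real.sin _), habs, one_mul,
      abs_of_pos (by positivity : 0 < robin * (Real.pi * N)), abs_of_pos (Real.cosh_pos _)]
    have := exp_abs_le_two_mul_cosh (Real.pi * y)
    rw [abs_mul, abs_of_pos hπ] at this
    calc _ ≤ robin * Real.pi / 4 * N * (2 * Real.cosh (Real.pi * y)) := by gcongr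
      _ = robin * (Real.pi * N) * Real.cosh (Real.pi * y) / 2 := by ring
      _ ≤ _ := half_le_self (by have := Real.cosh_pos (Real.pi * y); positivity)
  rcases eq_or_eq_neg_of_abs_eq hz with h | h
  · simpa [← h] using key z.im
  · have := key (-z.im)
    rw [abs_neg] at this
    have e : (N : ℂ) + ((-z.im : ℝ) : ℂ) * Complex.I = -z := by
      rw [show N = -z.re by linarith]
      apply Complex.ext <;> simp
    rwa [e, robinCos_neg] at this

/-- At height N ≥ 1 the exponentials give |U| ≤ |V|/2, so V dominates the sum U + V = 2C. -/
theorem norm_robinCos_ge_of_im {z : ℂ} {N : ℝ} (hN : 1 ≤ N) (hz : |z.im| = N) :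
    robin * Real.pi / 4 * N * Real.exp (Real.pi * |z.im|) ≤ ‖robinCos z‖ := by
  have hr := robin_pos
  have hπ := Real.pi_gt_three
  have key : ∀ x : ℝ, robin * Real.pi / 4 * N * Real.exp (Real.pi * N) ≤
      ‖robinCos (x + N * Complex.I)‖ := by
    intro x
    have hU := normSq_outerU x N
    have hV := normSq_outerV x N
    set U := outerU (x + N * Complex.I)
    set V := outerV (x + N * Complex.I)
    have hUV : U + V = 2 * robinCos (x + N * Complex.I) := outerU_add_outerV _
    set Q := (1 + robin * Real.pi * N) ^ 2 + (robin * Real.pi * x) ^ 2 with hQ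
    have hb : 0 < robin * Real.pi * N := by positivity
    have hQ1 : (robin * Real.pi * N) ^ 2 ≤ Q := by nlinarith [sq_nonneg (robin * Real.pi * x)]
    have hVge : Real.exp (Real.pi * N) * (robin * Real.pi * N) ≤ ‖V‖ := by
      refine le_of_sq_le_sq ?_ (norm_nonneg _)
      rw [hV, mul_pow, ← Real.exp_nat_mul]
      have : ((2 : ℕ) : ℝ) * (Real.pi * N) = 2 * Real.pi * N := by push_cast; ring
      rw [this]
      gcongr
    have hUle : ‖U‖ ≤ ‖V‖ / 2 := by
      refine le_of_sq_le_sq ?_ (by positivity)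
      have h1 : ‖U‖ ^ 2 ≤ 1 * Q := by
        rw [hU]
        refine mul_le_mul (Real.exp_le_one_iff.mpr (by nlinarith)) ?_ (by positivity) zero_le_one
        nlinarith
      have h2 : (4 : ℝ) ≤ Real.exp (2 * Real.pi * N) := by
        have := Real.add_one_le_exp (2 * Real.pi * N)
        nlinarith
      have h3 : 4 * Q ≤ ‖V‖ ^ 2 := by
        rw [hV]; gcongr
      rw [div_pow]
      linarith
    have h := norm_sub_le (U + V) U
    rw [add_sub_cancel_left, hUV, norm_mul, Complex.norm_ofNat] at h
    linarith
  rcases eq_or_eq_neg_of_abs_eq hz with h | h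
  · have := key z.re
    rw [← h, Complex.re_add_im] at this
    rwa [hz, ← h]
  · have := key (-z).re
    have e : (((-z).re : ℝ) : ℂ) + N * Complex.I = -z := by
      rw [show N = -z.im by linarith]
      apply Complex.ext <;> simp
    rw [e, robinCos_neg] at this
    rwa [hz]

/-- Lower bound for `extremal` on the boundaries of large squares. -/
theorem exists_norm_extremal_ge : ∃ κ : ℝ, 0 < κ ∧ ∀ N : ℝ, 1 ≤ N →
    Real.cos (Real.pi * N) = 0 → ∀ z : ℂ, |z.re| ≤ N → |z.im| ≤ N → (|z.re| = N ∨ |z.im| = N) →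
      κ * Real.exp (Real.pi * |z.im|) ≤ ‖extremal z‖ * N := by
  have hr := robin_pos
  have hπ := Real.pi_pos
  refine ⟨robin * Real.pi / 4 / (1 + 8 * Real.pi ^ 2), by positivity,
    fun N hN hcos z h1 h2 h3 => ?_⟩
  have hC : robin * Real.pi / 4 * N * Real.exp (Real.pi * |z.im|) ≤ ‖robinCos z‖ := by
    rcases h3 with h | h
    · exact norm_robinCos_ge_of_re (by linarith) hcos h
    · exact norm_robinCos_ge_of_im hN h
  have hz : ‖z‖ ≤ 2 * N := by
    have := Complex.norm_le_abs_re_add_abs_im z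
    linarith
  have hden : ‖1 - 2 * (Real.pi : ℂ) ^ 2 * z ^ 2‖ ≤ (1 + 8 * Real.pi ^ 2) * N ^ 2 := by
    refine (norm_sub_le _ _).trans ?_
    simp only [norm_one, norm_mul, norm_pow, Complex.norm_real, Real.norm_eq_abs, sq_abs,
      Complex.norm_ofNat]
    calc 1 + 2 * Real.pi ^ 2 * ‖z‖ ^ 2 ≤ 1 * N ^ 2 + 2 * Real.pi ^ 2 * (2 * N) ^ 2 := by
          gcongr
          rw [one_mul]
          exact one_le_pow₀ hN
      _ = _ := by ring
  rw [← extremal_mul, norm_mul] at hC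
  have h4 : robin * Real.pi / 4 * N * Real.exp (Real.pi * |z.im|) ≤
      ‖extremal z‖ * ((1 + 8 * Real.pi ^ 2) * N ^ 2) :=
    hC.trans (by gcongr)
  rw [div_mul_eq_mul_div, div_le_iff₀ (by positivity)]
  refine le_of_mul_le_mul_right ?_ (by linarith : 0 < N)
  linarith

theorem tendsto_add_three_halves : Tendsto (fun n : ℕ => (n : ℝ) + 3 / 2) atTop atTop :=
  tendsto_natCast_atTop_atTop.atTop_add tendsto_const_nhds

theorem cos_pi_mul_add_three_halves (n : ℕ) : Real.cos (Real.pi * (n + 3 / 2)) = 0 := by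
  rw [Real.cos_eq_zero_iff]
  exact ⟨n + 1, by push_cast; ring⟩

/-- An admissible nonnegative function with `R 0 = 1` that vanishes at the real zeros of `robinCos`
outside `[-1/2, 1/2]` is the square of `extremal`. -/
theorem Admissible.eq_extremal_sq {R : ℂ → ℂ} (hR : Admissible R) (hpos : ∀ x : ℝ, 0 ≤ R x)
    (h0 : ∀ ξ : ℝ, robinCos ξ = 0 → 1 / 2 < |ξ| → R ξ = 0) (hR0 : R 0 = 1) (z : ℂ) :
    R z = extremal z ^ 2 := by
  obtain ⟨h, hd, hRh⟩ := exists_eq_extremal_sq_mul hR.entire hpos h0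
  obtain ⟨A, hA, hRA⟩ := hR.exists_bound
  obtain ⟨κ, hκ, hE⟩ := exists_norm_extremal_ge
  have hN1 : ∀ n : ℕ, (1 : ℝ) ≤ n + 3 / 2 := fun n => by
    have : (0 : ℝ) ≤ n := Nat.cast_nonneg n
    linarith
  have hh : ∀ n : ℕ, ∀ z : ℂ, |z.re| ≤ n + 3 / 2 → |z.im| ≤ n + 3 / 2 →
      (|z.re| = n + 3 / 2 ∨ |z.im| = n + 3 / 2) →
      κ ^ 2 * Real.exp (2 * Real.pi * |z.im|) * ‖h z‖ ≤ ‖R z‖ * (n + 3 / 2) ^ 2 := by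
    intro n z h1 h2 h3
    have := pow_le_pow_left₀ (by positivity)
      (hE _ (hN1 n) (cos_pi_mul_add_three_halves n) z h1 h2 h3) 2
    rw [mul_pow, ← Real.exp_nat_mul, show ((2 : ℕ) : ℝ) * (Real.pi * |z.im|) =
      2 * Real.pi * |z.im| by push_cast; ring] at this
    rw [hRh z, norm_mul, norm_pow]
    calc _ ≤ (‖extremal z‖ * (n + 3 / 2)) ^ 2 * ‖h z‖ := by gcongr
      _ = _ := by ring
  -- The exponentials in the bounds for R and `extremal` squared cancel, leaving |h| ≤ AN²/κ² on the
  -- squares of half-side N = n + 3/2.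
  obtain ⟨b, c, hq⟩ := exists_eq_quadratic hd (A := A / κ ^ 2) hN1 tendsto_add_three_halves
    (fun n z h1 h2 h3 => by
      have := (hh n z h1 h2 h3).trans (mul_le_mul_of_nonneg_right (hRA z) (by positivity))
      rw [div_mul_eq_mul_div, le_div_iff₀ (by positivity)]
      refine le_of_mul_le_mul_right ?_ (Real.exp_pos (2 * Real.pi * |z.im|))
      linarith)
  have hh0 : h 0 = 1 := by
    have := hRh 0
    rw [hR0, extremal_zero] at this
    simpa using this.symm
  rw [hh0] at hq
  have hreal : ∀ n : ℕ, ‖h ((n + 3 / 2 : ℝ) : ℂ)‖ / ((n : ℝ) + 3 / 2) ^ 2 ≤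
      ‖R ((n + 3 / 2 : ℝ) : ℂ)‖ / κ ^ 2 := by
    intro n
    have hn := hN1 n
    have := hh n ((n + 3 / 2 : ℝ) : ℂ) (by rw [Complex.ofReal_re, abs_of_pos (by linarith)])
      (by rw [Complex.ofReal_im, abs_zero]; linarith)
      (Or.inl (by rw [Complex.ofReal_re, abs_of_pos (by linarith)]))
    rw [Complex.ofReal_im, abs_zero, mul_zero, Real.exp_zero, mul_one] at this
    rw [div_le_div_iff₀ (by positivity) (by positivity)]
    linarith
  have hinv : Tendsto (fun n : ℕ => (((n : ℝ) + 3 / 2 : ℝ) : ℂ)⁻¹) atTop (𝓝 0) := by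
    have := (Complex.continuous_ofReal.tendsto 0).comp
      (tendsto_inv_atTop_zero.comp tendsto_add_three_halves)
    simpa [Function.comp_def] using this
  have hne : ∀ n : ℕ, (((n : ℝ) + 3 / 2 : ℝ) : ℂ) ≠ 0 := fun n => by
    have := hN1 n
    exact_mod_cast (by linarith : (0 : ℝ) < n + 3 / 2).ne'
  -- Along N = n + 3/2 the ratio h(N)/N² tends to c, yet it is bounded by |R(N)|/κ², which tends to
  -- 0.
  have hc : c = 0 := by
    have h1 : Tendsto (fun n : ℕ => h ((n + 3 / 2 : ℝ) : ℂ) * ((((n : ℝ) + 3 / 2 : ℝ) : ℂ)⁻¹) ^ 2)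
        atTop (𝓝 c) := by
      have : Tendsto (fun n : ℕ => ((((n : ℝ) + 3 / 2 : ℝ) : ℂ)⁻¹) ^ 2 +
          b * (((n : ℝ) + 3 / 2 : ℝ) : ℂ)⁻¹ + c) atTop (𝓝 (0 ^ 2 + b * 0 + c)) :=
        ((hinv.pow 2).add (hinv.const_mul b)).add_const c
      rw [zero_pow two_ne_zero, mul_zero, zero_add, zero_add] at this
      refine this.congr fun n => ?_
      rw [hq]
      have := hne n
      field_simp
    have h2 : Tendsto (fun n : ℕ => h ((n + 3 / 2 : ℝ) : ℂ) * ((((n : ℝ) + 3 / 2 : ℝ) : ℂ)⁻¹) ^ 2)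
        atTop (𝓝 0) := by
      have h3 : Tendsto (fun n : ℕ => ‖R ((n + 3 / 2 : ℝ) : ℂ)‖ / κ ^ 2) atTop (𝓝 0) := by
        have := ((hR.tendsto_zero.comp (tendsto_add_three_halves.mono_right
          atTop_le_cocompact)).norm).div_const (κ ^ 2)
        simpa [Function.comp_def] using this
      refine squeeze_zero_norm (fun n => ?_) h3
      rw [norm_mul, norm_pow, norm_inv, Complex.norm_real, Real.norm_eq_abs,
        abs_of_pos (by linarith [hN1 n] : (0 : ℝ) < n + 3 / 2), inv_pow, ← div_eq_mul_inv]
      exact hreal n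
    exact tendsto_nhds_unique h1 h2
  -- Nonnegativity of 1 + bσN, divided by N, gives σb ≥ 0 in the limit. The order is that of ℂ, so b
  -- is real as well, and the two signs force b = 0.
  have hb : ∀ σ : ℝ, |σ| = 1 → 0 ≤ σ * b := by
    intro σ hσ
    have hpos' : ∀ n : ℕ, 0 ≤ (((n : ℝ) + 3 / 2 : ℝ) : ℂ)⁻¹ + σ * b := by
      intro n
      have hn := hN1 n
      set N : ℝ := n + 3 / 2
      have hN0 : 0 < N := by linarith
      have hσN : |σ * N| = N := by rw [abs_mul, hσ, one_mul, abs_of_pos hN0]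
      have hEn := hE N hn (cos_pi_mul_add_three_halves n) ((σ * N : ℝ) : ℂ)
        (by rw [Complex.ofReal_re, hσN]) (by rw [Complex.ofReal_im, abs_zero]; linarith)
        (Or.inl (by rw [Complex.ofReal_re, hσN]))
      have hE0 : extremal ((σ * N : ℝ) : ℂ) ≠ 0 := by
        intro h
        rw [h, norm_zero, zero_mul] at hEn
        exact absurd hEn (not_le.mpr (by positivity))
      have hRn := hpos (σ * N)
      rw [hRh, hq, hc, ← extremal_ofReal_re, ← Complex.ofReal_pow] at hRn
      have he : 0 < (extremal ((σ * N : ℝ) : ℂ)).re ^ 2 := by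
        refine sq_pos_iff.mpr ?_
        intro h
        rw [← extremal_ofReal_re, h] at hE0
        exact hE0 Complex.ofReal_zero
      have h1 : 0 ≤ 1 + b * ((σ * N : ℝ) : ℂ) := by
        have := mul_nonneg (Complex.zero_le_real.mpr (inv_nonneg.mpr he.le)) hRn
        rw [← mul_assoc, ← Complex.ofReal_mul, inv_mul_cancel₀ he.ne', Complex.ofReal_one,
          one_mul, zero_mul, add_zero] at this
        exact this
      have h2 := mul_nonneg (Complex.zero_le_real.mpr (inv_nonneg.mpr hN0.le)) h1
      have hNc : (N : ℂ) ≠ 0 := by exact_mod_cast hN0.ne'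
      have e : ((N⁻¹ : ℝ) : ℂ) * (1 + b * ((σ * N : ℝ) : ℂ)) = (N : ℂ)⁻¹ + σ * b := by
        push_cast; field_simp
      rwa [e] at h2
    have := ge_of_tendsto' (hinv.add_const (σ * b)) hpos'
    rwa [zero_add] at this
  have hb0 : b = 0 := by
    have h1 := hb 1 (by simp)
    have h2 := hb (-1) (by simp)
    simp only [Complex.ofReal_one, one_mul, Complex.ofReal_neg, neg_mul] at h1 h2
    exact le_antisymm (neg_nonneg.mp h2) h1
  rw [hRh, hq, hb0, hc]
  ring

/-! ### Numerical value of the constant. -/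

/-- Twelve terms of the exponential series at iθ. Since θ² = 1/2, the truncations c of cos θ and s
of (sin θ)/θ are rational, and the constant is cos θ divided by (sin θ)/θ, minus 1/2. -/
theorem gapConst_bounds : 0.3274992 ≤ gapConst ∧ gapConst < 0.3274993 := by
  have hθ := theta_pos
  have h2 := theta_sq
  have hnorm : ‖(theta : ℂ) * Complex.I‖ = theta := by
    rw [norm_mul, Complex.norm_I, mul_one, Complex.norm_real, Real.norm_eq_abs, abs_of_pos hθ]
  have hb := Complex.exp_bound (x := theta * Complex.I) (n := 12)
    (by rw [hnorm]; exact theta_lt_one.le) (by norm_num)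
  rw [hnorm, Complex.exp_mul_I, ← Complex.ofReal_cos, ← Complex.ofReal_sin] at hb
  have hδ : theta ^ 12 * (((Nat.succ 12 : ℕ) : ℝ) * ((Nat.factorial 12 : ℝ) * (12 : ℕ))⁻¹) ≤
      1 / 10 ^ 10 := by
    rw [show theta ^ 12 = (theta ^ 2) ^ 6 by ring, h2]
    norm_num [Nat.factorial]
  have hb' := hb.trans hδ
  have hre := (Complex.abs_re_le_norm _).trans hb'
  have him := (Complex.abs_im_le_norm _).trans hb'
  set c : ℝ := 1 - 1 / 4 + 1 / 96 - 1 / 5760 + 1 / 645120 - 1 / 116121600 with hc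
  set s : ℝ := 1 - 1 / 12 + 1 / 480 - 1 / 40320 + 1 / 5806080 - 1 / 1277337600 with hs
  have hsum : ∑ m ∈ Finset.range 12, ((theta : ℂ) * Complex.I) ^ m / (m.factorial : ℂ) =
      (c : ℂ) + (theta * s : ℝ) * Complex.I := by
    have h2c : (theta : ℂ) ^ 2 = 1 / 2 := by
      rw [← Complex.ofReal_pow, h2]; norm_num
    have hx2 : ((theta : ℂ) * Complex.I) ^ 2 = -(1 / 2) := by
      rw [mul_pow, h2c, Complex.I_sq]; ring
    have heven : ∀ k : ℕ, ((theta : ℂ) * Complex.I) ^ (2 * k) = (-(1 / 2)) ^ k := fun k => by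
      rw [pow_mul, hx2]
    have hodd : ∀ k : ℕ, ((theta : ℂ) * Complex.I) ^ (2 * k + 1) =
        (-(1 / 2)) ^ k * (theta * Complex.I) := fun k => by
      rw [pow_succ, heven]
    have e2 := heven 1; have e4 := heven 2; have e6 := heven 3; have e8 := heven 4
    have e10 := heven 5
    have e3 := hodd 1; have e5 := hodd 2; have e7 := hodd 3; have e9 := hodd 4
    have e11 := hodd 5
    norm_num only at e2 e4 e6 e8 e10 e3 e5 e7 e9 e11
    simp only [Finset.sum_range_succ, Finset.sum_range_zero, e2, e4, e6, e8, e10, e3, e5, e7, e9,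
      e11, hc, hs, pow_zero, pow_one]
    norm_num [Nat.factorial]
    ring
  rw [hsum] at hre him
  simp only [Complex.sub_re, Complex.add_re, Complex.ofReal_re, Complex.mul_re, Complex.I_re,
    Complex.ofReal_im, Complex.I_im, Complex.sub_im, Complex.add_im, Complex.mul_im, mul_zero,
    mul_one, sub_zero, add_zero, zero_add] at hre him
  rw [abs_le] at hre him
  obtain ⟨S, hS⟩ : ∃ S, Real.sin theta = theta * S :=
    ⟨Real.sin theta / theta, by field_simp⟩
  rw [hS] at him
  -- Dividing the error in sin θ by θ then at most doubles it.
  have hθ2 : 1 / 2 < theta := by nlinarith [theta_lt_one]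
  have hS1 : s - 2 / 10 ^ 10 ≤ S := by
    by_contra! h
    nlinarith [him.1]
  have hS2 : S ≤ s + 2 / 10 ^ 10 := by
    by_contra! h
    nlinarith [him.2]
  have hSpos : 0 < S := lt_of_lt_of_le (by rw [hs]; norm_num) hS1
  have hg : gapConst = Real.cos theta / S - 1 / 2 := by
    rw [gapConst, ← theta, Real.cot_eq_cos_div_sin, hS]
    field_simp
  rw [hg]
  constructor
  · rw [le_sub_iff_add_le, le_div_iff₀ hSpos]
    norm_num only [hc, hs] at hre hS2 ⊢
    linarith [hre.1]
  · rw [sub_lt_iff_lt_add, div_lt_iff₀ hSpos]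
    norm_num only [hc, hs] at hre hS1 ⊢
    linarith [hre.2]

theorem gapConst_pos : 0 < gapConst := lt_of_lt_of_le (by norm_num) gapConst_bounds.1

/-! ### Existence and uniqueness of the reproducing kernel. -/

theorem isReproducingAt_zero : IsReproducingAt 0 fun z => (gapConst : ℂ)⁻¹ * extremal z := by
  have hg : (gapConst : ℂ) ≠ 0 := by exact_mod_cast gapConst_pos.ne'
  refine ⟨memH_extremal.const_mul _, fun f hf => ?_⟩
  have h : innerH f (fun z => (gapConst : ℂ)⁻¹ * extremal z) =
      (gapConst : ℂ)⁻¹ * ∫ x : ℝ, f x * extremal x * (weight x : ℂ) := by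
    rw [innerH, ← integral_const_mul]
    refine integral_congr_ae (Eventually.of_forall fun x => ?_)
    simp only [map_mul, map_inv₀, Complex.conj_ofReal, conj_extremal_ofReal]
    ring
  rw [h, integral_mul_extremal hf, inv_mul_cancel_left₀ hg]

theorem weight_pos {x : ℝ} (hx : x ≠ 0) : 0 < weight x := by
  have hπ := Real.pi_pos
  have h0 : Real.pi * x ≠ 0 := mul_ne_zero hπ.ne' hx
  have h1 : |Real.sin (Real.pi * x)| < |Real.pi * x| := Real.abs_sin_lt_abs h0
  have h2 : |Real.sinc (Real.pi * x)| < 1 := by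
    rw [Real.sinc_of_ne_zero h0, abs_div, div_lt_one (abs_pos.mpr h0)]
    exact h1
  have := (sq_lt_one_iff_abs_lt_one _).mpr h2
  unfold weight
  linarith

/-- The weight vanishes only at 0, so the continuous integrand forces f = 0 on the rest of ℝ, then
on ℝ by density and on ℂ by the identity theorem. -/
theorem MemH.eq_zero_of_innerH_self {f : ℂ → ℂ} (hf : MemH f) (h : innerH f f = 0) (z : ℂ) :
    f z = 0 := by
  have h1 : innerH f f = ((∫ x : ℝ, ‖f x‖ ^ 2 * weight x : ℝ) : ℂ) := by
    rw [innerH, ← integral_complex_ofReal]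
    refine integral_congr_ae (Eventually.of_forall fun x => ?_)
    simp only [Complex.mul_conj, Complex.normSq_eq_norm_sq]
    push_cast; rfl
  rw [h1, Complex.ofReal_eq_zero, integral_eq_zero_iff_of_nonneg
    (fun x => mul_nonneg (sq_nonneg _) (weight_nonneg x)) hf.sqIntegrable] at h
  have hc : Continuous fun x : ℝ => ‖f x‖ ^ 2 * weight x :=
    (hf.continuous_ofReal.norm.pow 2).mul continuous_weight
  have h2 := (hc.ae_eq_iff_eq volume continuous_const).mp h
  have h3 : ∀ x : ℝ, x ≠ 0 → f x = 0 := fun x hx => by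
    have := (mul_eq_zero.mp (congrFun h2 x)).resolve_right (weight_pos hx).ne'
    exact norm_eq_zero.mp (pow_eq_zero_iff two_ne_zero |>.mp this)
  have h4 : (fun x : ℝ => f x) = fun _ => 0 := by
    refine (hf.continuous_ofReal).ext_on (dense_compl_singleton (0 : ℝ)) continuous_const ?_
    exact fun x hx => h3 x hx
  exact congrFun (eq_of_eq_ofReal hf.entire (differentiable_const 0) (congrFun h4)) z

/-- The difference of two representatives is orthogonal to all of 𝓗, in particular to itself. -/
theorem IsReproducingAt.unique {w : ℂ} {k l : ℂ → ℂ} (hk : IsReproducingAt w k)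
    (hl : IsReproducingAt w l) : k = l := by
  have hd : MemH fun z => k z + (-1) * l z := hk.1.add (hl.1.const_mul (-1))
  have h : innerH (fun z => k z + (-1) * l z) (fun z => k z + (-1) * l z) = 0 := by
    have e1 := hk.2 _ hd
    have e2 := hl.2 _ hd
    rw [e1] at e2
    have : innerH (fun z => k z + (-1) * l z) (fun z => k z + (-1) * l z) =
        innerH (fun z => k z + (-1) * l z) k - innerH (fun z => k z + (-1) * l z) l := by
      rw [innerH, innerH, innerH, ← integral_sub (hd.integrable_mul hk.1)
        (hd.integrable_mul hl.1)]
      refine integral_congr_ae (Eventually.of_forall fun x => ?_)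
      simp only [map_add, map_mul, map_neg, map_one]
      ring
    rw [this, e2, sub_self]
  funext z
  have := hd.eq_zero_of_innerH_self h z
  linear_combination this

theorem K_zero_zero : K 0 0 = (gapConst : ℂ)⁻¹ := by
  have hex : ∃ k : ℂ → ℂ, IsReproducingAt 0 k := ⟨_, isReproducingAt_zero⟩
  have : K 0 = fun z => (gapConst : ℂ)⁻¹ * extremal z := by
    rw [K, dif_pos hex]
    exact hex.choose_spec.unique isReproducingAt_zero
  rw [this]
  simp only [extremal_zero, mul_one]

/-! ### The inequality, its equality case and the final statement. -/

theorem admissible_extremal_sq : Admissible fun z => extremal z ^ 2 :=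
  admissible_of_hasExpType (differentiable_extremal.pow 2) hasExpType_extremal_sq
    integrable_extremal_sq

theorem extremal_sq_nonneg (x : ℝ) : 0 ≤ extremal x ^ 2 := by
  rw [← extremal_ofReal_re]
  exact_mod_cast sq_nonneg (extremal x).re

/-- The lower bound for `M R` together with the case of equality. -/
theorem Admissible.gapConst_le_M {R : ℂ → ℂ} (hR : Admissible R) (hpos : ∀ x : ℝ, 0 ≤ R x)
    (h1 : 1 ≤ R 0) :
    (gapConst : ℂ) ≤ M R ∧ (M R = gapConst ↔ ∀ z, R z = extremal z ^ 2) := by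
  obtain ⟨I, hI, hM, hI0⟩ := exists_M_eq_add hR.entire hR.hasExpType hR.integrable hpos
  have hg := gapConst_pos
  obtain ⟨r, hr1, hr⟩ : ∃ r : ℝ, 1 ≤ r ∧ R 0 = r := by
    refine ⟨(R 0).re, (Complex.le_def.mp h1).1, Complex.ext rfl ?_⟩
    exact (Complex.le_def.mp h1).2.symm
  have hM' : M R = ((gapConst * r + I : ℝ) : ℂ) := by rw [hM, hr]; push_cast; rfl
  refine ⟨?_, fun h => ?_, fun h => ?_⟩
  · rw [hM', Complex.real_le_real]
    nlinarith
  · rw [hM', Complex.ofReal_inj] at h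
    -- In γ = γr + I with γ > 0, r ≥ 1 and I ≥ 0, both inequalities must be equalities.
    have hr' : r = 1 := by nlinarith
    have hI' : I = 0 := by rw [hr'] at h; linarith
    exact hR.eq_extremal_sq hpos (hI0 hI') (by rw [hr, hr', Complex.ofReal_one])
  · rw [← integral_extremal_sq_mul_weight, M]
    simp only [h]

/-- Off the zeros of `1 - 2π²z²`, the square of `extremal` is given by the closed formula, which
determines an entire function. -/
theorem eq_extremal_sq_iff {R : ℂ → ℂ} (hd : Differentiable ℂ R) :
    (∀ z, R z = extremal z ^ 2) ↔ ∀ z : ℂ, 1 - 2 * (Real.pi : ℂ) ^ 2 * z ^ 2 ≠ 0 →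
      R z = 1 / (1 - 2 * (Real.pi : ℂ) ^ 2 * z ^ 2) ^ 2 * robinCos z ^ 2 := by
  have hform : ∀ z : ℂ, 1 - 2 * (Real.pi : ℂ) ^ 2 * z ^ 2 ≠ 0 →
      extremal z ^ 2 = 1 / (1 - 2 * (Real.pi : ℂ) ^ 2 * z ^ 2) ^ 2 * robinCos z ^ 2 := by
    intro z hz
    rw [← extremal_mul]
    field_simp
  refine ⟨fun h z hz => (h z).trans (hform z hz), fun h => ?_⟩
  have hev : ∀ᶠ z : ℂ in 𝓝 0, 1 - 2 * (Real.pi : ℂ) ^ 2 * z ^ 2 ≠ 0 :=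
    ContinuousAt.eventually_ne (by fun_prop) (by simp)
  have h1 : AnalyticOnNhd ℂ R univ := fun z _ => hd.analyticAt z
  have h2 : AnalyticOnNhd ℂ (fun z => extremal z ^ 2) univ := fun z _ =>
    (differentiable_extremal.pow 2).analyticAt z
  refine congrFun (h1.eq_of_eventuallyEq h2 (z₀ := 0) ?_)
  filter_upwards [hev] with z hz
  rw [h z hz, hform z hz]

end PairCorrelation

end

theorem corollary10 :
    -- the reproducing kernel `K(0, ·)` exists and is unique
    (∃! k : ℂ → ℂ, PairCorrelation.IsReproducingAt 0 k) ∧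
    -- the value of `1 / K(0,0)`
    1 / PairCorrelation.K 0 0 = (((√2)⁻¹ * Real.cot (√2)⁻¹ - 1 / 2 : ℝ) : ℂ) ∧
    (0.3274992 : ℝ) ≤ (√2)⁻¹ * Real.cot (√2)⁻¹ - 1 / 2 ∧
    (√2)⁻¹ * Real.cot (√2)⁻¹ - 1 / 2 < (0.3274993 : ℝ) ∧
    -- the lower bound and the characterization of equality
    (∀ R : ℂ → ℂ, PairCorrelation.Admissible R → (∀ x : ℝ, 0 ≤ R x) → 1 ≤ R 0 →
      1 / PairCorrelation.K 0 0 ≤ PairCorrelation.M R ∧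
      (PairCorrelation.M R = 1 / PairCorrelation.K 0 0 ↔
        ∀ z : ℂ, 1 - 2 * (Real.pi : ℂ) ^ 2 * z ^ 2 ≠ 0 →
          R z = 1 / (1 - 2 * (Real.pi : ℂ) ^ 2 * z ^ 2) ^ 2 *
            (Complex.cos (Real.pi * z) -
              ((√2 : ℝ) : ℂ) * Real.pi * z * ((Real.cot (√2)⁻¹ : ℝ) : ℂ) *
                Complex.sin (Real.pi * z)) ^ 2)) ∧
    -- equality is attained
    (∃ R : ℂ → ℂ, PairCorrelation.Admissible R ∧ (∀ x : ℝ, 0 ≤ R x) ∧ 1 ≤ R 0 ∧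
      PairCorrelation.M R = 1 / PairCorrelation.K 0 0) := by
  have hK : 1 / PairCorrelation.K 0 0 = (PairCorrelation.gapConst : ℂ) := by
    rw [PairCorrelation.K_zero_zero, one_div, inv_inv]
  have hrobin : ∀ z : ℂ, PairCorrelation.robinCos z = Complex.cos (Real.pi * z) -
      ((√2 : ℝ) : ℂ) * Real.pi * z * ((Real.cot (√2)⁻¹ : ℝ) : ℂ) * Complex.sin (Real.pi * z) := by
    intro z
    rw [PairCorrelation.robinCos, PairCorrelation.robin, PairCorrelation.theta]
    push_cast
    ring
  refine ⟨⟨_, PairCorrelation.isReproducingAt_zero,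
    fun k hk => hk.unique PairCorrelation.isReproducingAt_zero⟩, hK,
    PairCorrelation.gapConst_bounds.1, PairCorrelation.gapConst_bounds.2, fun R hR hpos h1 => ?_,
    _, PairCorrelation.admissible_extremal_sq, PairCorrelation.extremal_sq_nonneg, ?_, ?_⟩
  · simp only [hK, ← hrobin]
    obtain ⟨h2, h3⟩ := hR.gapConst_le_M hpos h1
    exact ⟨h2, h3.trans (PairCorrelation.eq_extremal_sq_iff hR.entire)⟩
  · simp [PairCorrelation.extremal_zero]
  · rw [hK]
    exact PairCorrelation.integral_extremal_sq_mul_weight
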